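/- Let $\Omega\subset\mathbb R^2$ be a connected open set whose boundary $\partial\Omega$ is compact, $C^\infty$ smooth, nonempty, and has finitely many connected components $\Gamma_1,\dots,\Gamma_m$, with $\Omega$ lying locally on one side of $\partial\Omega$ ($\Omega$ may be unbounded). Let $\Gamma_i$ have length $L_i$ and be parametrized by arc length by a smooth $L_i$-periodic map $\gamma_i$, oriented so that $\Omega$ lies on the left. Let $\nu$ be the unit outward normal, $T=\gamma_i'$ the unit tangent, and let the curvature $\kappa$ be defined by $T'=-\kappa\,\nu$ (so that $\kappa=1/R$ for a disc of radius $R$). Assume that $\kappa$ attains its maximum $\kappa_{\max}$ over $\partial\Omega$ at a unique point, that this point is $\gamma_{i_0}(0)$, and that the maximum is nondegenerate: the second derivative of $s\mapsto\kappa(\gamma_{i_0}(s))$ at $s=0$ is negative. (On the other components the base point $\gamma_i(0)$ is arbitrary.) For $x\in\Omega$ near $\partial\Omega$ let $s(x)\in(-L_i/2,L_i/2]$ be the arc-length coordinate of the point of $\partial\Omega$ nearest to $x$, i.e. $|x-\gamma_i(s(x))|=\mathrm{dist}(x,\partial\Omega)$, where $\Gamma_i$ is the component nearest to $x$. For $h>0$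 let $\mathcal L_h=-h^2\Delta$ be the operator in $L^2(\Omega)$ with domain $\{u\in H^2(\Omega): \nu\cdot h^{1/2}\nabla u-u=0 \text{ on }\partial\Omega\}$. **Theorem.** Let $M>0$ and let $\chi_1\in C_c^\infty([0,\infty))$ be real-valued. There exist constants $C>0$, $\alpha>0$ and $h_0\in(0,1)$ such that, for all $h\in(0,h_0)$, if $u_h$ is an eigenfunction of $\mathcal L_h$, normalized in $L^2(\Omega)$, whose eigenvalue $\mu(h)$ satisfies $$\mu(h)\le -h-\kappa_{\max}h^{3/2}+Mh^{7/4},$$ then $$\int_\Omega \chi_1\!\left(\frac{\mathrm{dist}(x,\partial\Omega)}{h^{1/8}}\right)^{2}\left\{|u_h(x)|^2+h|\nabla u_h(x)|^2\right\}\exp\!\left(\frac{2\alpha\,|s(x)|^2}{h^{1/4}}\right)dx\le C .$$ (For $h<h_0$ the coordinate $s(x)$ is well defined wherever $\chi_1(\mathrm{dist}(x,\partial\Omega)/h^{1/8})\neq0$.) -/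

import Mathlib

open MeasureTheory Set
open scoped ContDiff

noncomputable section

namespace Robin

/-- The Euclidean plane. -/
abbrev Plane : Type := EuclideanSpace ℝ (Fin 2)

/-- The `k`-th partial derivative of a real function on the plane. -/
def partialDeriv (k : Fin 2) (φ : Plane → ℝ) (x : Plane) : ℝ :=
  fderiv ℝ φ x (EuclideanSpace.single k 1)

/-! ### Smooth compact boundaries and their arc-length parametrizations -/

/-- The unit tangent vector `T(s) = c'(s)`. -/
def tangent (c : ℝ → Plane) (s : ℝ) : Plane := deriv c s

/-- The unit tangent vector turned by a quarter turn clockwise. For a boundary curve that keeps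
the domain on its left this is the unit outward normal vector. -/
def outwardNormal (c : ℝ → Plane) (s : ℝ) : Plane := !₂[tangent c s 1, -tangent c s 0]

/-- The curvature `κ(s)`, defined by `T'(s) = -κ(s) ν(s)`, where `ν` is the outward normal:
it is nonnegative when the domain is convex, and a disc of radius `R` has curvature `1 / R`. -/
def curvature (c : ℝ → Plane) (s : ℝ) : ℝ :=
  -inner ℝ (deriv (tangent c) s) (outwardNormal c s)

/-- `Ω` has a smooth compact boundary with the `m` connected components `γ i (ℝ)`. The curve `γ i`
is a smooth simple closed curve of length `L i`, parametrized by arc length (periodically), the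
curves are pairwise disjoint, and `Ω` lies locally on the left-hand side of each curve and only
there (for the outer boundary of a bounded domain this is the counterclockwise orientation). -/
structure IsArcLengthBoundary (Ω : Set Plane) {m : ℕ} (L : Fin m → ℝ)
    (γ : Fin m → ℝ → Plane) : Prop where
  length_pos : ∀ i, 0 < L i
  smooth : ∀ i, ContDiff ℝ ∞ (γ i)
  unit_speed : ∀ i s, ‖tangent (γ i) s‖ = 1
  periodic : ∀ i, Function.Periodic (γ i) (L i)
  simple : ∀ i j s t, γ i s = γ j t → i = j ∧ ∃ n : ℤ, t - s = n * L i
  frontier_eq : frontier Ω = ⋃ i, range (γ i)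
  one_sided : ∀ i s, ∃ ε > 0, ∀ t ∈ Ioo (0 : ℝ) ε,
    γ i s - t • outwardNormal (γ i) s ∈ Ω ∧ γ i s + t • outwardNormal (γ i) s ∉ Ω

/-- The curvature of the boundary attains its maximum at one point only, the point `γ i₀ 0`, and
this maximum is nondegenerate. -/
structure HasUniqueNondegenerateMaxCurvature {m : ℕ} (γ : Fin m → ℝ → Plane) (i₀ : Fin m) :
    Prop where
  le_max : ∀ i s, curvature (γ i) s ≤ curvature (γ i₀) 0
  unique : ∀ i s, curvature (γ i) s = curvature (γ i₀) 0 → γ i s = γ i₀ 0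
  nondegenerate : iteratedDeriv 2 (curvature (γ i₀)) 0 < 0

/-- The distance to the boundary of `Ω`. -/
def boundaryDist (Ω : Set Plane) (x : Plane) : ℝ := Metric.infDist x (frontier Ω)

open Classical in
/-- The boundary coordinate `s(x)`: the number `s` in `(-L i / 2, L i / 2]` such that `γ i s` is a
nearest point to `x` on the boundary. Near the boundary the nearest point, and hence `i` and `s`,
are unique. (Elsewhere one of the nearest points is chosen.) -/
def arcCoord (Ω : Set Plane) {m : ℕ} (L : Fin m → ℝ) (γ : Fin m → ℝ → Plane) (x : Plane) : ℝ :=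
  if hx : ∃ p : Fin m × ℝ, p.2 ∈ Ioc (-(L p.1 / 2)) (L p.1 / 2) ∧
      dist x (γ p.1 p.2) = boundaryDist Ω x
  then hx.choose.2 else 0

/-! ### Sobolev spaces, traces and the Robin operator -/

/-- `u` belongs to `H¹(Ω)`, and `G` is its weak gradient. -/
structure IsH1 (Ω : Set Plane) (u : Plane → ℂ) (G : Fin 2 → Plane → ℂ) : Prop where
  memLp : MemLp u 2 (volume.restrict Ω)
  memLp_grad : ∀ k, MemLp (G k) 2 (volume.restrict Ω)
  integral_eq : ∀ (k : Fin 2) (φ : Plane → ℝ), ContDiff ℝ ∞ φ → HasCompactSupport φ →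
    tsupport φ ⊆ Ω → ∫ x in Ω, partialDeriv k φ x • u x = -∫ x in Ω, φ x • G k x

/-- `g i s` is the trace at the boundary point `γ i s` of the function `u` in `H¹(Ω)` with weak
gradient `G`: the function in `L²(∂Ω)` for which Green's formula
`∫_Ω (u ∂ₖφ + φ ∂ₖu) dx = ∫_{∂Ω} u φ νₖ ds` holds for all smooth compactly supported `φ` on the
plane. It is unique up to null sets. -/
structure IsTrace (Ω : Set Plane) {m : ℕ} (L : Fin m → ℝ) (γ : Fin m → ℝ → Plane)
    (u : Plane → ℂ) (G : Fin 2 → Plane → ℂ) (g : Fin m → ℝ → ℂ) : Prop where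
  memLp : ∀ i, MemLp (g i) 2 (volume.restrict (Ioc 0 (L i)))
  green : ∀ (k : Fin 2) (φ : Plane → ℝ), ContDiff ℝ ∞ φ → HasCompactSupport φ →
    ∫ x in Ω, (partialDeriv k φ x • u x + φ x • G k x) =
      ∑ i, ∫ s in Ioc 0 (L i), (φ (γ i s) * outwardNormal (γ i) s k) • g i s

/-- `u` belongs to the domain
`{u ∈ H²(Ω) : ν · h^{1/2} ∇u - u = 0 on ∂Ω}` of the Robin operator `-h² Δ`;
`G` is the weak gradient of `u`, and `H` is the matrix of its weak second derivatives. -/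
structure InRobinDomain (Ω : Set Plane) {m : ℕ} (L : Fin m → ℝ) (γ : Fin m → ℝ → Plane) (h : ℝ)
    (u : Plane → ℂ) (G : Fin 2 → Plane → ℂ) (H : Fin 2 → Fin 2 → Plane → ℂ) : Prop where
  isH1 : IsH1 Ω u G
  isH1_grad : ∀ j, IsH1 Ω (G j) (H j)
  robin : ∃ (g : Fin m → ℝ → ℂ) (dg : Fin 2 → Fin m → ℝ → ℂ),
    IsTrace Ω L γ u G g ∧ (∀ j, IsTrace Ω L γ (G j) (H j) (dg j)) ∧
    ∀ i, ∀ᵐ s ∂(volume.restrict (Ioc 0 (L i))),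
      ∑ j, outwardNormal (γ i) s j • (h ^ (1 / 2 : ℝ) • dg j i s) - g i s = 0

/-- `u`, with weak gradient `G`, is an eigenfunction, normalized in `L²(Ω)`, of the Robin operator
`-h² Δ`, with eigenvalue `μ`. -/
def IsNormalizedEigenfunction (Ω : Set Plane) {m : ℕ} (L : Fin m → ℝ) (γ : Fin m → ℝ → Plane)
    (h μ : ℝ) (u : Plane → ℂ) (G : Fin 2 → Plane → ℂ) : Prop :=
  ∃ H : Fin 2 → Fin 2 → Plane → ℂ, InRobinDomain Ω L γ h u G H ∧
    (∀ᵐ x ∂(volume.restrict Ω), -(h ^ 2 • ∑ j, H j j x) = μ • u x) ∧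
    ∫ x in Ω, ‖u x‖ ^ 2 = 1

/-- `χ ∈ C_c^∞([0, ∞))`: smooth up to the end point `0`, and zero far away. -/
def IsHalfLineCutoff (χ : ℝ → ℝ) : Prop :=
  ContDiffOn ℝ ∞ χ (Ici 0) ∧ ∃ R, ∀ t, R < t → χ t = 0

end Robin

end

open Filter Topology

noncomputable section

namespace Robin

/-! ### Plane geometry and regular curves -/

/-! Write `τ = h^(1/4)`. The proof needs neither tubular coordinates nor spectral asymptotics:
everything comes from one weighted identity in the plane. Extend the outward normal to a smooth
field `N` with `‖N‖ ≤ 1 - min(dist², 1)` (`exists_normal_extension`). The Robin condition says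
exactly that the field `h^(1/2) ∇u - u N` has no flux through the boundary (`flux_eq_zero`). Testing
this with `exp(2Φ) u` and completing the square gives (`energy_identity`) `∫ exp(2Φ) (|τ⁴∇u - τ²uN +
τ⁴u∇Φ|² + P u²) = 0`, where `P = -μ - τ⁴‖N‖² - τ⁶ div N - τ⁸|∇Φ|²`.

Since `‖N‖` is maximal on the boundary, `div N` equals the curvature there (`divg_eq_curvature`).
With `-μ ≥ τ⁴ + κ_max τ⁶ - M τ⁷`, the potential `P` contains the transverse confinement `τ⁴(1 -
‖N‖²) ≥ τ⁴ dist²` near the boundary and the tangential one `τ⁶(κ_max - div N)`, which is quadratic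
in the distance to the point `p` of maximal curvature, up to an error linear in `dist` that the
transverse term absorbs. For `Φ = α f / τ`, with `f` the bounded substitute `well p` for `|x - p|²`,
the inequality `|∇f|² ≤ 4f` lets the term in `∇Φ` be absorbed when `α` is small. Hence `P ≥ τ⁷(c f/τ
- C)` (`exists_potential_bound`).

Where `f/τ` is large this is at least `τ⁷`; where it is bounded, so is the weight. Thus the weighted
mass of `u` is bounded by its mass, and the square then controls the weighted gradient
(`energy_estimate`). Finally `s(x)² ≤ C(f + dist²)` (`exists_arcCoord_bound`), and `dist²/τ` is
bounded on the support of the cutoff.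

Using `exp(2Φ) u` as a test function requires density of smooth functions in `H¹(Ω)`. It is obtained
by mollifying the zero extension at the displaced point `x - εN(x)`, around which a ball of radius
`δε` lies in `Ω` (`exists_shift`, `exists_approx`). -/

theorem inner_eq (x y : Plane) : inner ℝ x y = x 0 * y 0 + x 1 * y 1 := by
  simp [PiLp.inner_apply, Fin.sum_univ_two, mul_comm]

theorem norm_sq_eq (x : Plane) : ‖x‖ ^ 2 = x 0 ^ 2 + x 1 ^ 2 := by
  rw [← real_inner_self_eq_norm_sq, inner_eq]; ring

/-- Rotation by a quarter turn clockwise. -/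
def rot (v : Plane) : Plane := !₂[v 1, -v 0]

@[simp] theorem rot_zero_coord (v : Plane) : rot v 0 = v 1 := by simp [rot]
@[simp] theorem rot_one_coord (v : Plane) : rot v 1 = -v 0 := by simp [rot]

theorem outwardNormal_eq_rot (c : ℝ → Plane) (s : ℝ) :
    outwardNormal c s = rot (tangent c s) := rfl

theorem inner_rot_right (v : Plane) : inner ℝ v (rot v) = 0 := by
  rw [inner_eq]; simp; ring

theorem norm_rot (v : Plane) : ‖rot v‖ = ‖v‖ := by
  have h : ‖rot v‖ ^ 2 = ‖v‖ ^ 2 := by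
    rw [norm_sq_eq, norm_sq_eq]; simp; ring
  exact (sq_eq_sq₀ (norm_nonneg _) (norm_nonneg _)).1 h

/-- A vector orthogonal to the unit vector `T` is a multiple of `rot T`. -/
theorem eq_smul_rot {T v : Plane} (hT : ‖T‖ = 1) (h : inner ℝ v T = 0) :
    v = (inner ℝ v (rot T)) • rot T := by
  have h1 : T 0 ^ 2 + T 1 ^ 2 = 1 := by rw [← norm_sq_eq, hT]; norm_num
  rw [inner_eq] at h
  ext k
  fin_cases k
  · simp [inner_eq]; linear_combination (-v 0) * h1 + T 0 * h
  · simp [inner_eq]; linear_combination (-v 1) * h1 + T 1 * h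

/-- Rotation as a continuous linear map. -/
noncomputable def rotL : Plane →L[ℝ] Plane :=
  LinearMap.toContinuousLinearMap
    { toFun := rot
      map_add' := fun x y => by ext k; fin_cases k <;> simp; ring
      map_smul' := fun c x => by ext k; fin_cases k <;> simp }

section Curve

variable {c : ℝ → Plane} (hc : ContDiff ℝ ∞ c)
include hc

theorem contDiff_tangent : ContDiff ℝ ∞ (tangent c) :=
  (contDiff_infty_iff_deriv.1 hc).2

theorem contDiff_outwardNormal : ContDiff ℝ ∞ (outwardNormal c) :=
  rotL.contDiff.comp (contDiff_tangent hc)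

theorem contDiff_curvature : ContDiff ℝ ∞ (curvature c) :=
  ((contDiff_infty_iff_deriv.1 (contDiff_tangent hc)).2.inner ℝ (contDiff_outwardNormal hc)).neg

theorem hasDerivAt_curve (s : ℝ) : HasDerivAt c (tangent c s) s :=
  (hc.differentiable (by simp) s).hasDerivAt

theorem hasDerivAt_tangent (s : ℝ) : HasDerivAt (tangent c) (deriv (tangent c) s) s :=
  ((contDiff_tangent hc).differentiable (by simp) s).hasDerivAt

theorem hasDerivAt_outwardNormal (s : ℝ) :
    HasDerivAt (outwardNormal c) (rot (deriv (tangent c) s)) s :=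
  rotL.hasFDerivAt.comp_hasDerivAt s (hasDerivAt_tangent hc s)

end Curve

theorem Periodic.deriv' {E : Type*} [NormedAddCommGroup E] [NormedSpace ℝ E] {c : ℝ → E} {L : ℝ}
    (h : Function.Periodic c L) : Function.Periodic (deriv c) L := by
  intro s
  rw [← deriv_comp_add_const]
  congr 1
  funext x
  exact h x

theorem periodic_outwardNormal {c : ℝ → Plane} {L : ℝ} (h : Function.Periodic c L) :
    Function.Periodic (outwardNormal c) L := fun s => by
  have := Periodic.deriv' h s
  simp only [outwardNormal_eq_rot, tangent, this]

theorem periodic_curvature {c : ℝ → Plane} {L : ℝ} (h : Function.Periodic c L) :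
    Function.Periodic (curvature c) L := fun s => by
  have h1 := Periodic.deriv' (c := tangent c) (Periodic.deriv' h) s
  have h2 := periodic_outwardNormal h s
  simp only [curvature, h1, h2]

/-! ### The boundary as a compact set, and its local structure -/

section Boundary

variable {Ω : Set Plane} {m : ℕ} {L : Fin m → ℝ} {γ : Fin m → ℝ → Plane}
  (hγ : IsArcLengthBoundary Ω L γ)
include hγ

theorem IsArcLengthBoundary.norm_normal (i : Fin m) (s : ℝ) : ‖outwardNormal (γ i) s‖ = 1 := by
  rw [outwardNormal_eq_rot, norm_rot, hγ.unit_speed]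

theorem IsArcLengthBoundary.continuous (i : Fin m) : Continuous (γ i) := (hγ.smooth i).continuous

theorem IsArcLengthBoundary.mem_frontier (i : Fin m) (s : ℝ) : γ i s ∈ frontier Ω := by
  rw [hγ.frontier_eq]; exact mem_iUnion.2 ⟨i, mem_range_self s⟩

theorem IsArcLengthBoundary.exists_eq {x : Plane} (hx : x ∈ frontier Ω) : ∃ i s, γ i s = x := by
  rw [hγ.frontier_eq] at hx
  simpa using hx

theorem IsArcLengthBoundary.exists_Ioc (i : Fin m) (a s : ℝ) :
    ∃ s' ∈ Ioc a (a + L i), ∃ n : ℤ, s' = s + n * L i := by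
  obtain ⟨n, hn, -⟩ := existsUnique_add_zsmul_mem_Ioc (hγ.length_pos i) s a
  exact ⟨_, hn, n, by simp⟩

theorem IsArcLengthBoundary.shift (i : Fin m) (s : ℝ) (n : ℤ) : γ i (s + n * L i) = γ i s :=
  (hγ.periodic i).int_mul n s

theorem IsArcLengthBoundary.isCompact_frontier : IsCompact (frontier Ω) := by
  rw [hγ.frontier_eq]
  refine isCompact_iUnion fun i => ?_
  have : range (γ i) = γ i '' Icc 0 (0 + L i) :=
    ((hγ.periodic i).image_Icc (hγ.length_pos i) 0).symm
  rw [this]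
  exact isCompact_Icc.image (hγ.continuous i)

theorem IsArcLengthBoundary.normal_congr {i j : Fin m} {s t : ℝ} (h : γ i s = γ j t) :
    outwardNormal (γ i) s = outwardNormal (γ j) t := by
  obtain ⟨rfl, n, hn⟩ := hγ.simple i j s t h
  have : t = s + n * L i := by linarith
  rw [this]
  exact ((periodic_outwardNormal (hγ.periodic i)).int_mul n s).symm

theorem IsArcLengthBoundary.curvature_congr {i j : Fin m} {s t : ℝ} (h : γ i s = γ j t) :
    curvature (γ i) s = curvature (γ j) t := by
  obtain ⟨rfl, n, hn⟩ := hγ.simple i j s t h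
  have : t = s + n * L i := by linarith
  rw [this]
  exact ((periodic_curvature (hγ.periodic i)).int_mul n s).symm

/-- Near the point `γ i s₀`, the boundary consists of the points `γ i s` with `s` near `s₀`. -/
theorem IsArcLengthBoundary.eventually_near (i : Fin m) (s₀ : ℝ) {r : ℝ} (hr : 0 < r) :
    ∀ᶠ x in 𝓝 (γ i s₀), x ∈ frontier Ω → ∃ s, |s - s₀| < r ∧ γ i s = x := by
  -- `K` is the rest of the boundary: the other components, and one period of `γ i` without the
  -- `r`-window around `s₀`. It is compact and misses `γ i s₀`, so its complement is the required
  -- neighbourhood.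
  set K : Set Plane := (⋃ j ∈ {j : Fin m | j ≠ i}, γ j '' Icc 0 (0 + L j)) ∪
    γ i '' Icc (s₀ + r) (s₀ + L i - r) with hK
  have hKc : IsCompact K := by
    refine IsCompact.union ?_ (isCompact_Icc.image (hγ.continuous i))
    exact (Set.toFinite _).isCompact_biUnion fun j _ => isCompact_Icc.image (hγ.continuous j)
  have hp : γ i s₀ ∉ K := by
    rintro (h | ⟨s, hs, h⟩)
    · simp only [mem_ofPred_eq, mem_iUnion, mem_image] at h
      obtain ⟨j, hj, s, -, h⟩ := h
      exact hj (hγ.simple j i s s₀ h).1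
    · obtain ⟨-, n, hn⟩ := hγ.simple i i s s₀ h
      have hL := hγ.length_pos i
      have h1 : (n : ℝ) * L i < 0 := by rw [← hn]; linarith [hs.1]
      have h2 : -(L i) < (n : ℝ) * L i := by rw [← hn]; linarith [hs.2]
      have h3 : (n : ℝ) < 0 := by nlinarith
      have h4 : (-1 : ℝ) < n := by nlinarith
      have h5 : n < 0 := by exact_mod_cast h3
      have h6 : -1 < n := by exact_mod_cast h4
      omega
  filter_upwards [hKc.isClosed.isOpen_compl.mem_nhds hp] with x hx hxf
  obtain ⟨j, s, rfl⟩ := hγ.exists_eq hxf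
  have hji : j = i := by
    by_contra hji
    obtain ⟨s', hs', n, hn⟩ := hγ.exists_Ioc j 0 s
    exact hx (Or.inl (mem_iUnion₂.2 ⟨j, hji, s', Ioc_subset_Icc_self hs',
      by rw [hn, hγ.shift]⟩))
  subst hji
  obtain ⟨s', hs', n, hn⟩ := hγ.exists_Ioc j (s₀ - r) s
  by_cases h : s' < s₀ + r
  · exact ⟨s', abs_lt.2 ⟨by linarith [hs'.1], by linarith⟩, by rw [hn, hγ.shift]⟩
  · exact absurd (Or.inr ⟨s', ⟨by linarith, by linarith [hs'.2]⟩, by rw [hn, hγ.shift]⟩) hx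

end Boundary

/-- The inverse function theorem on a symmetric interval. The last clause lives on the source side;
it is what lets a boundary point near `γ i s₀` recover its own parameter. -/
theorem exists_local_inverse {a : ℝ → ℝ} (ha : ContDiff ℝ ∞ a) {s₀ : ℝ} (h0 : deriv a s₀ ≠ 0) :
    ∃ g : ℝ → ℝ, ∃ η > 0, ContDiffOn ℝ ∞ g (Ioo (a s₀ - η) (a s₀ + η)) ∧
      (∀ z ∈ Ioo (a s₀ - η) (a s₀ + η), a (g z) = z) ∧ g (a s₀) = s₀ ∧
      ∀ᶠ s in 𝓝 s₀, g (a s) = s := by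
  have hd : ∀ s, HasStrictDerivAt a (deriv a s) s := fun s =>
    ha.contDiffAt.hasStrictDerivAt (by simp)
  set e := ((hd s₀).hasStrictFDerivAt_equiv h0).toOpenPartialHomeomorph a with he
  have hea : ∀ s, e s = a s := fun s => rfl
  have hs : s₀ ∈ e.source :=
    ((hd s₀).hasStrictFDerivAt_equiv h0).mem_toOpenPartialHomeomorph_source
  have hmem : a s₀ ∈ e.target := e.map_source hs
  have hsym : e.symm (a s₀) = s₀ := e.left_inv hs
  have hcont : ContinuousAt e.symm (a s₀) := e.continuousAt_symm hmem
  have hcd : Continuous (deriv a) := (contDiff_infty_iff_deriv.1 ha).2.continuous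
  have h1 : ∀ᶠ z in 𝓝 (a s₀), z ∈ e.target ∧ deriv a (e.symm z) ≠ 0 := by
    refine Filter.Eventually.and (e.open_target.mem_nhds hmem) ?_
    refine (hcd.continuousAt.comp hcont).eventually_ne ?_
    rw [Function.comp, hsym]; exact h0
  obtain ⟨η, hη, hball⟩ := Metric.eventually_nhds_iff_ball.1 h1
  rw [Real.ball_eq_Ioo] at hball
  refine ⟨e.symm, η, hη, fun z hz => ?_, fun z hz => e.right_inv (hball z hz).1, hsym, ?_⟩
  · exact (e.contDiffAt_symm_deriv (hball z hz).2 (hball z hz).1 (hd _).hasDerivAt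
      ha.contDiffAt).contDiffWithinAt
  · filter_upwards [e.open_source.mem_nhds hs] with s hs using e.left_inv hs

/-- The open sets `U` and the complement of `closure U` are disjoint, and together they miss only
the frontier. -/
theorem _root_.IsPreconnected.subset_of_disjoint_frontier {X : Type*} [TopologicalSpace X]
    {S U : Set X} (hS : IsPreconnected S) (hU : IsOpen U) (hd : ∀ x ∈ S, x ∉ frontier U)
    (hne : (S ∩ U).Nonempty) : S ⊆ U := by
  refine hS.subset_left_of_subset_union hU isClosed_closure.isOpen_compl
    (disjoint_compl_right_iff_subset.2 subset_closure) (fun x hx => ?_) hne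
  by_contra! hcon
  simp only [mem_union, mem_compl_iff, not_or, not_not] at hcon
  exact hd x hx (by rw [hU.frontier_eq]; exact ⟨hcon.2, hcon.1⟩)

/-- A coordinate system near the boundary point `γ i s₀`: `σ x` is the arc-length coordinate of the
boundary point below or above `x` in the direction of the normal at `γ i s₀`, and `ρ x` is the
signed distance from that boundary point. -/
theorem IsArcLengthBoundary.exists_chart {Ω : Set Plane} {m : ℕ} {L : Fin m → ℝ}
    {γ : Fin m → ℝ → Plane} (hΩ : IsOpen Ω) (hγ : IsArcLengthBoundary Ω L γ) (i : Fin m) (s₀ : ℝ) :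
    ∃ (σ ρ : Plane → ℝ) (W : Set Plane), IsOpen W ∧ γ i s₀ ∈ W ∧ ContDiffOn ℝ ∞ σ W ∧
      ContDiffOn ℝ ∞ ρ W ∧ ρ (γ i s₀) = 0 ∧
      (∀ x ∈ W, x - γ i (σ x) = ρ x • outwardNormal (γ i) s₀) ∧
      (∀ x ∈ W, ∀ b : ℝ, ρ (x + b • outwardNormal (γ i) s₀) = ρ x + b) ∧
      (∀ᶠ x in 𝓝 (γ i s₀), x ∈ frontier Ω → γ i (σ x) = x) ∧
      (∀ᶠ x in 𝓝 (γ i s₀), x ∈ Ω ↔ ρ x < 0) := by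
  set p := γ i s₀ with hp
  set T := tangent (γ i) s₀ with hT
  set ν := outwardNormal (γ i) s₀ with hν
  have hTn : ‖T‖ = 1 := hγ.unit_speed i s₀
  have hνn : ‖ν‖ = 1 := hγ.norm_normal i s₀
  have hνT : inner ℝ ν T = 0 := by rw [real_inner_comm]; exact inner_rot_right T
  -- `a` is the coordinate along the tangent line at `s₀`. Its derivative there is `‖T‖² = 1`, so
  -- near `s₀` the curve is a graph over this line.
  set a : ℝ → ℝ := fun s => inner ℝ (γ i s - p) T with ha
  have hasm : ContDiff ℝ ∞ a := ((hγ.smooth i).sub contDiff_const).inner ℝ contDiff_const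
  have ha0 : a s₀ = 0 := by simp [ha, hp]
  have hda : deriv a s₀ = 1 := by
    have : HasDerivAt a (inner ℝ T T) s₀ := by
      have := ((hasDerivAt_curve (hγ.smooth i) s₀).sub_const p).inner ℝ (hasDerivAt_const s₀ T)
      simpa only [inner_zero_right, zero_add] using this
    rw [this.deriv, real_inner_self_eq_norm_sq, hTn]; norm_num
  obtain ⟨g, η, hη, hg, hag, hg0, hga⟩ := exists_local_inverse hasm (s₀ := s₀) (by simp [hda])
  rw [ha0] at hg hag hg0
  simp only [zero_sub, zero_add] at hg hag
  set z : Plane → ℝ := fun x => inner ℝ (x - p) T with hz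
  have hzs : ContDiff ℝ ∞ z := (contDiff_id.sub contDiff_const).inner ℝ contDiff_const
  have hzp : z p = 0 := by simp [hz]
  set W : Set Plane := z ⁻¹' Ioo (-η) η with hW
  have hWo : IsOpen W := isOpen_Ioo.preimage hzs.continuous
  have hpW : p ∈ W := by simp [hW, hzp, hη]
  set σ : Plane → ℝ := fun x => g (z x) with hσ
  set ρ : Plane → ℝ := fun x => inner ℝ (x - γ i (σ x)) ν with hρ
  have hσs : ContDiffOn ℝ ∞ σ W := hg.comp hzs.contDiffOn fun x hx => hx
  have hρs : ContDiffOn ℝ ∞ ρ W :=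
    (contDiffOn_id.sub ((hγ.smooth i).comp_contDiffOn hσs)).inner ℝ contDiffOn_const
  have hzb : ∀ x (b : ℝ), z (x + b • ν) = z x := fun x b => by
    simp only [hz]
    rw [add_sub_right_comm, inner_add_left, inner_smul_left, hνT]; simp
  have hfoot : ∀ x ∈ W, x - γ i (σ x) = ρ x • ν := fun x hx => by
    refine eq_smul_rot hTn ?_
    have h1 : a (σ x) = z x := hag _ hx
    simp only [ha, hz] at h1
    have : x - γ i (σ x) = (x - p) - (γ i (σ x) - p) := by abel
    rw [this, inner_sub_left, h1, sub_self]
  have hρb : ∀ x (b : ℝ), ρ (x + b • ν) = ρ x + b := fun x b => by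
    simp only [hρ, hσ, hzb]
    rw [add_sub_right_comm, inner_add_left, inner_smul_left, real_inner_self_eq_norm_sq, hνn]
    simp
  have hfr : ∀ᶠ x in 𝓝 p, x ∈ frontier Ω → γ i (σ x) = x := by
    obtain ⟨r, hr, hr'⟩ := Metric.eventually_nhds_iff.1 hga
    filter_upwards [hγ.eventually_near i s₀ hr] with x hx hxf
    obtain ⟨s, hs, rfl⟩ := hx hxf
    have : g (a s) = s := hr' (by rwa [Real.dist_eq])
    show γ i (g (a s)) = _
    rw [this]
  have hρp : ρ p = 0 := by simp only [hρ, hσ, hzp, hg0]; rw [hp, sub_self, inner_zero_left]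
  refine ⟨σ, ρ, W, hWo, hpW, hσs, hρs, hρp, hfoot, fun x _ => hρb x, hfr, ?_⟩
  -- the two sides
  set ψ : ℝ × ℝ → Plane := fun q => γ i (g q.1) + q.2 • ν with hψ
  have hψc : ContinuousOn ψ (Ioo (-η) η ×ˢ univ) :=
    (((hγ.continuous i).comp_continuousOn
      (hg.continuousOn.comp continuousOn_fst fun q hq => hq.1))).add
      (continuousOn_snd.smul continuousOn_const)
  have hψ0 : ψ (0, 0) = p := by simp [hψ, hg0, hp]
  have hψat : ContinuousAt ψ (0, 0) :=
    hψc.continuousAt ((isOpen_Ioo.prod isOpen_univ).mem_nhds (by simp [hη]))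
  have hzψ : ∀ q : ℝ × ℝ, q.1 ∈ Ioo (-η) η → z (ψ q) = q.1 := fun q hq => by
    rw [hψ]; simp only [hzb]; exact hag _ hq
  have hρψ : ∀ q : ℝ × ℝ, q.1 ∈ Ioo (-η) η → ρ (ψ q) = q.2 := fun q hq => by
    rw [hψ]; simp only [hρb]
    have : z (γ i (g q.1)) = q.1 := hag _ hq
    simp [hρ, hσ, this]
  have hψx : ∀ x ∈ W, ψ (z x, ρ x) = x := fun x hx => by
    simp only [hψ]; rw [← hfoot x hx]; simp [hσ]
  have hev : ∀ᶠ q in 𝓝 ((0 : ℝ), (0 : ℝ)), ψ q ∈ frontier Ω → γ i (σ (ψ q)) = ψ q :=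
    hψat.eventually (by rw [hψ0]; exact hfr)
  obtain ⟨r₀, hr₀, hball⟩ := Metric.eventually_nhds_iff_ball.1 hev
  set r := min r₀ η with hr
  have hrpos : 0 < r := lt_min hr₀ hη
  have hIη : ∀ t, t ∈ Ioo (-r) r → t ∈ Ioo (-η) η := fun t ht =>
    ⟨by linarith [ht.1, min_le_right r₀ η], by linarith [ht.2, min_le_right r₀ η]⟩
  have hnotfr : ∀ q : ℝ × ℝ, q.1 ∈ Ioo (-r) r → q.2 ∈ Ioo (-r) r → q.2 ≠ 0 →
      ψ q ∉ frontier Ω := fun q h1 h2 h3 hf => by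
    have hq : q ∈ Metric.ball ((0 : ℝ), (0 : ℝ)) r₀ := by
      rw [Metric.mem_ball, Prod.dist_eq, max_lt_iff, Real.dist_eq, Real.dist_eq]
      simp only [sub_zero, abs_lt]
      exact ⟨⟨by linarith [h1.1, min_le_left r₀ η], by linarith [h1.2, min_le_left r₀ η]⟩,
        ⟨by linarith [h2.1, min_le_left r₀ η], by linarith [h2.2, min_le_left r₀ η]⟩⟩
    have h4 := hball q hq hf
    have h5 : ρ (ψ q) = q.2 := hρψ q (hIη _ h1)
    apply h3
    rw [← h5]; simp [hρ, h4]
  obtain ⟨ε, hε, hside⟩ := hγ.one_sided i s₀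
  -- In the coordinates `ψ` the boundary inside the small square has height zero. Each open half is
  -- connected and avoids the frontier, so it lies in `Ω` or misses it; `one_sided`, used only on
  -- the normal at `s₀`, then decides which.
  have hside_of : ∀ S : Set ℝ, Convex ℝ S → (∀ b ∈ S, b ∈ Ioo (-r) r ∧ b ≠ 0) →
      ψ '' (Ioo (-r) r ×ˢ S) ⊆ Ω ∨ Disjoint (ψ '' (Ioo (-r) r ×ˢ S)) Ω := by
    intro S hS hSr
    have hpre : IsPreconnected (ψ '' (Ioo (-r) r ×ˢ S)) :=
      ((convex_Ioo _ _).prod hS).isPreconnected.image _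
        (hψc.mono (prod_mono (fun t ht => hIη t ht) (subset_univ _)))
    refine or_iff_not_imp_right.2 fun h2 => ?_
    rw [not_disjoint_iff_nonempty_inter] at h2
    refine hpre.subset_of_disjoint_frontier hΩ ?_ h2
    rintro _ ⟨q, ⟨hq1, hq2⟩, rfl⟩
    exact hnotfr q hq1 (hSr _ hq2).1 (hSr _ hq2).2
  set b₀ := min ε r / 2 with hb₀
  have hb₀pos : 0 < b₀ := by have := lt_min hε hrpos; positivity
  have hb₀ε : b₀ < ε := by have := lt_min hε hrpos; linarith [min_le_left ε r]
  have hb₀r : b₀ < r := by have := lt_min hε hrpos; linarith [min_le_right ε r]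
  have hψb : ∀ b : ℝ, ψ (0, b) = p + b • ν := fun b => by simp [hψ, hg0, hp]
  have hneg : ψ '' (Ioo (-r) r ×ˢ Ioo (-r) 0) ⊆ Ω := by
    refine (hside_of _ (convex_Ioo _ _)
      fun b hb => ⟨⟨hb.1, by linarith [hb.2]⟩, hb.2.ne⟩).resolve_right fun hdis => ?_
    refine disjoint_left.1 hdis ⟨(0, -b₀), ⟨⟨by simpa using hrpos, hrpos⟩,
      by simp only; linarith, by simpa using hb₀pos⟩, rfl⟩ ?_
    rw [hψb, neg_smul, ← sub_eq_add_neg]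
    exact (hside b₀ ⟨hb₀pos, hb₀ε⟩).1
  have hpos : Disjoint (ψ '' (Ioo (-r) r ×ˢ Ioo 0 r)) Ω := by
    refine (hside_of _ (convex_Ioo _ _)
      fun b hb => ⟨⟨by linarith [hb.1], hb.2⟩, hb.1.ne'⟩).resolve_left fun hsub => ?_
    refine (hside b₀ ⟨hb₀pos, hb₀ε⟩).2 ?_
    rw [← hψb]
    exact hsub ⟨(0, b₀), ⟨⟨by simpa using hrpos, hrpos⟩, hb₀pos, hb₀r⟩, rfl⟩
  have e1 : ∀ᶠ x in 𝓝 p, z x ∈ Ioo (-r) r :=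
    hzs.continuous.continuousAt.eventually (by rw [hzp]; exact Ioo_mem_nhds (by linarith) hrpos)
  have e2 : ∀ᶠ x in 𝓝 p, ρ x ∈ Ioo (-r) r :=
    (hρs.continuousOn.continuousAt (hWo.mem_nhds hpW)).eventually
      (by rw [hρp]; exact Ioo_mem_nhds (by linarith) hrpos)
  filter_upwards [e1, e2, hWo.mem_nhds hpW] with x h1 h2 h3
  refine ⟨fun hx => ?_, fun hx => hneg ⟨(z x, ρ x), ⟨h1, h2.1, hx⟩, hψx x h3⟩⟩
  by_contra! hcon
  rcases hcon.eq_or_lt with h0 | h0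
  · have : x = γ i (σ x) := by
      have := hfoot x h3
      rw [← h0, zero_smul, sub_eq_zero] at this
      exact this
    have hxf : x ∈ frontier Ω := by rw [this]; exact hγ.mem_frontier _ _
    rw [hΩ.frontier_eq] at hxf
    exact hxf.2 hx
  · exact disjoint_left.1 hpos ⟨(z x, ρ x), ⟨h1, h0, h2.2⟩, hψx x h3⟩ hx

/-! ### Extension of the normal field -/

/-- The divergence of a vector field on the plane. -/
noncomputable def divg (N : Plane → Plane) (x : Plane) : ℝ :=
  ∑ k, partialDeriv k (fun y => N y k) x

theorem partialDeriv_coord {N : Plane → Plane} {x : Plane} (hN : DifferentiableAt ℝ N x)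
    (j k : Fin 2) :
    partialDeriv k (fun y => N y j) x = fderiv ℝ N x (EuclideanSpace.single k 1) j := by
  have h : HasFDerivAt (fun y => N y j)
      ((EuclideanSpace.proj j : Plane →L[ℝ] ℝ).comp (fderiv ℝ N x)) x :=
    (EuclideanSpace.proj j : Plane →L[ℝ] ℝ).hasFDerivAt.comp x hN.hasFDerivAt
  rw [partialDeriv, h.fderiv]; rfl

theorem eq_sum_single (v : Plane) :
    v = v 0 • EuclideanSpace.single 0 (1 : ℝ) + v 1 • EuclideanSpace.single 1 (1 : ℝ) := by
  ext k; fin_cases k <;> simp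

theorem map_apply_eq (A : Plane →L[ℝ] Plane) (v : Plane) (j : Fin 2) :
    A v j = v 0 * A (EuclideanSpace.single 0 1) j + v 1 * A (EuclideanSpace.single 1 1) j := by
  conv_lhs => rw [eq_sum_single v]
  simp

section Extension

variable {Ω : Set Plane} {m : ℕ} {L : Fin m → ℝ} {γ : Fin m → ℝ → Plane}

theorem boundaryDist_le_dist (hγ : IsArcLengthBoundary Ω L γ) (x : Plane) (i : Fin m) (s : ℝ) :
    boundaryDist Ω x ≤ dist x (γ i s) :=
  Metric.infDist_le_dist_of_mem (hγ.mem_frontier i s)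

theorem boundaryDist_nonneg (Ω : Set Plane) (x : Plane) : 0 ≤ boundaryDist Ω x :=
  Metric.infDist_nonneg

theorem lipschitzWith_boundaryDist (Ω : Set Plane) : LipschitzWith 1 (boundaryDist Ω) :=
  Metric.lipschitz_infDist_pt _

theorem ball_boundaryDist_subset (hΩ : IsOpen Ω) {x : Plane} (hx : x ∈ Ω) :
    Metric.ball x (boundaryDist Ω x) ⊆ Ω := by
  by_cases h : 0 < boundaryDist Ω x
  · refine (convex_ball _ _).isPreconnected.subset_of_disjoint_frontier hΩ (fun y hy hyf => ?_)
      ⟨x, Metric.mem_ball_self h, hx⟩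
    have := Metric.infDist_le_dist_of_mem (x := x) hyf
    rw [Metric.mem_ball, dist_comm] at hy
    exact absurd hy (not_lt.2 this)
  · rw [Metric.ball_eq_empty.2 (not_lt.1 h)]; exact empty_subset _

open scoped Manifold in
-- At each point the two requirements confine the value to a convex set, so local solutions glue by
-- a partition of unity. Near the boundary, `(1 - ρ²)` times the normal at `σ x` is a solution,
-- because `|ρ x|` is the distance to a boundary point and hence at least `boundaryDist`; elsewhere
-- zero is one. The quadratic loss of length later confines `u` transversally, and no smooth
-- distance function is needed.
theorem IsArcLengthBoundary.exists_normal_extension (hΩ : IsOpen Ω)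
    (hγ : IsArcLengthBoundary Ω L γ) :
    ∃ N : Plane → Plane, ContDiff ℝ ∞ N ∧ (∀ i s, N (γ i s) = outwardNormal (γ i) s) ∧
      ∀ x, ‖N x‖ ≤ 1 - min (boundaryDist Ω x ^ 2) 1 := by
  set t : Plane → Set Plane := fun x =>
    {v | ∀ i s, γ i s = x → v = outwardNormal (γ i) s} ∩
      {v | ‖v‖ ≤ 1 - min (boundaryDist Ω x ^ 2) 1} with ht
  have hconv : ∀ x, Convex ℝ (t x) := fun x => by
    refine Convex.inter ?_ ?_
    · intro v hv w hw a b ha hb hab i s his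
      rw [hv i s his, hw i s his, ← add_smul, hab, one_smul]
    · simpa [Metric.closedBall, dist_zero_right] using
        convex_closedBall (0 : Plane) (1 - min (boundaryDist Ω x ^ 2) 1)
  obtain ⟨N, hN⟩ := exists_contMDiffMap_forall_mem_convex_of_local (n := (⊤ : ℕ∞)) (t := t)
    𝓘(ℝ, Plane) hconv (fun x₀ => by
      by_cases hx₀ : x₀ ∈ frontier Ω
      · obtain ⟨i, s₀, rfl⟩ := hγ.exists_eq hx₀
        obtain ⟨σ, ρ, W, hWo, hpW, hσ, hρ, hρp, hfoot, -, hfr, -⟩ := hγ.exists_chart hΩ i s₀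
        have hν : ‖outwardNormal (γ i) s₀‖ = 1 := hγ.norm_normal i s₀
        have hρ1 : ∀ᶠ x in 𝓝 (γ i s₀), |ρ x| < 1 := by
          have : ContinuousAt (fun x => |ρ x|) (γ i s₀) :=
            (hρ.continuousOn.continuousAt (hWo.mem_nhds hpW)).abs
          exact this.eventually_lt_const (by simp [hρp])
        refine ⟨_, (hfr.and hρ1).and (hWo.mem_nhds hpW),
          fun x => (1 - ρ x ^ 2) • outwardNormal (γ i) (σ x), ?_, ?_⟩
        · refine ContDiffOn.contMDiffOn ?_
          have h1 : ContDiffOn ℝ ∞ (fun x => (1 - ρ x ^ 2) • outwardNormal (γ i) (σ x)) W :=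
            (contDiffOn_const.sub (hρ.pow 2)).smul
              ((contDiff_outwardNormal (hγ.smooth i)).comp_contDiffOn hσ)
          exact h1.mono fun x hx => hx.2
        · rintro x ⟨⟨hx1, hx2⟩, hx3⟩
          refine ⟨fun j s hjs => ?_, ?_⟩
          · have h1 := hx1 (hjs ▸ hγ.mem_frontier j s)
            have h2 := hfoot x hx3
            rw [h1, sub_self] at h2
            have h3 : ρ x = 0 := by
              have := congrArg norm h2.symm
              rw [norm_smul, hν, norm_zero, mul_one] at this
              exact norm_eq_zero.1 this
            have h4 := hγ.normal_congr (h1.trans hjs.symm)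
            simp [h3, h4]
          · have h1 : boundaryDist Ω x ≤ |ρ x| := by
              refine (boundaryDist_le_dist hγ x i (σ x)).trans_eq ?_
              rw [dist_eq_norm, hfoot x hx3, norm_smul, hν, mul_one, Real.norm_eq_abs]
            have h2 : boundaryDist Ω x ^ 2 ≤ ρ x ^ 2 := by
              rw [← sq_abs (ρ x)]
              exact pow_le_pow_left₀ (boundaryDist_nonneg _ _) h1 2
            have h3 : ρ x ^ 2 < 1 := by
              rw [← sq_abs (ρ x)]; nlinarith [abs_nonneg (ρ x)]
            simp only [mem_ofPred_eq]
            rw [norm_smul, hγ.norm_normal, mul_one, Real.norm_eq_abs, abs_of_pos (by linarith)]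
            linarith [min_le_left (boundaryDist Ω x ^ 2) 1]
      · refine ⟨(frontier Ω)ᶜ, isClosed_frontier.isOpen_compl.mem_nhds hx₀, fun _ => 0,
          contMDiffOn_const, fun y hy => ⟨fun i s his => ?_, ?_⟩⟩
        · exact absurd (his ▸ hγ.mem_frontier i s) hy
        · simp)
  refine ⟨N, N.contMDiff.contDiff, fun i s => (hN _).1 i s rfl, fun x => (hN x).2⟩

/-! ### Displacement into the domain along the extended normal, and the divergence of the extension.
-/

variable {N : Plane → Plane}

/-- In a chart `Ω` is `{ρ < 0}`, and the derivative of `ρ` along `N` is `1` at `p`. By strict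
differentiability, moving by `-ε N` lowers `ρ` at a uniform rate, with room for a ball of comparable
radius. -/
theorem IsArcLengthBoundary.exists_local_shift (hΩ : IsOpen Ω) (hγ : IsArcLengthBoundary Ω L γ)
    (hNc : Continuous N) (hN1 : ∀ x, ‖N x‖ ≤ 1)
    (hNν : ∀ i s, N (γ i s) = outwardNormal (γ i) s) {p : Plane} (hp : p ∈ frontier Ω) :
    ∃ δ > 0, ∃ ε₀ > 0, ∃ r > 0, ∀ ε ∈ Ioo (0 : ℝ) ε₀, ∀ x ∈ Ω, x ∈ Metric.ball p r →
      Metric.closedBall (x - ε • N x) (δ * ε) ⊆ Ω := by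
  obtain ⟨i, s₀, rfl⟩ := hγ.exists_eq hp
  obtain ⟨σ, ρ, W, hWo, hpW, -, hρ, hρp, -, hρb, -, hside⟩ := hγ.exists_chart hΩ i s₀
  set p := γ i s₀
  have hat : ContDiffAt ℝ ∞ ρ p := hρ.contDiffAt (hWo.mem_nhds hpW)
  have hstr := hat.hasStrictFDerivAt (by simp)
  set A := fderiv ℝ ρ p with hA
  have hAν : A (N p) = 1 := by
    rw [hNν]
    have h1 : HasDerivAt (fun b : ℝ => ρ (p + b • outwardNormal (γ i) s₀))
        (A (outwardNormal (γ i) s₀)) 0 := by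
      have h2 : HasDerivAt (fun b : ℝ => p + b • outwardNormal (γ i) s₀)
          (outwardNormal (γ i) s₀) 0 := by
        simpa using ((hasDerivAt_id (0 : ℝ)).smul_const (outwardNormal (γ i) s₀)).const_add p
      have h3 : HasFDerivAt ρ A (p + (0 : ℝ) • outwardNormal (γ i) s₀) := by
        simpa using hstr.hasFDerivAt
      exact h3.comp_hasDerivAt 0 h2
    have h2 : (fun b : ℝ => ρ (p + b • outwardNormal (γ i) s₀)) = fun b => b := by
      funext b; rw [hρb p hpW, hρp, zero_add]
    rw [h2] at h1
    exact h1.unique (hasDerivAt_id 0)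
  have e1 := hstr.isLittleO.def (c := 1 / 4) (by norm_num)
  have e2 : ∀ᶠ x in 𝓝 p, 3 / 4 < A (N x) :=
    (A.continuous.comp hNc).continuousAt.eventually_const_lt
      (by simp only [Function.comp, hAν]; norm_num)
  obtain ⟨r₁, hr₁, h1⟩ := Metric.eventually_nhds_iff_ball.1 e1
  obtain ⟨r₂, hr₂, h2⟩ := Metric.eventually_nhds_iff_ball.1 (e2.and hside)
  set r := min r₁ r₂ with hr
  have hrpos : 0 < r := lt_min hr₁ hr₂
  -- This makes `‖A‖ δ ≤ 1/4` and `δ ≤ 1/4`. Against the drop `(3/4) ε` stand the contribution `ε/4`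
  -- of the ball and the remainder `(1 + δ) ε / 4 ≤ (5/16) ε`.
  set δ : ℝ := 1 / (4 * (‖A‖ + 1)) with hδ
  have hA0 := norm_nonneg A
  have hδpos : 0 < δ := by positivity
  have hδA : ‖A‖ * δ ≤ 1 / 4 := by
    rw [hδ, mul_one_div, div_le_div_iff₀ (by positivity) (by norm_num)]; linarith
  have hδ1 : δ ≤ 1 / 4 := by
    rw [hδ, div_le_div_iff₀ (by positivity) (by norm_num)]; linarith
  refine ⟨δ, hδpos, r / 4, by positivity, r / 2, by positivity, fun ε hε x hx hxr y hy => ?_⟩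
  set e := y - (x - ε • N x) with he
  have hen : ‖e‖ ≤ δ * ε := by rw [he, ← dist_eq_norm]; exact hy
  have hyx : y - x = -(ε • N x) + e := by rw [he]; abel
  have hyxn : ‖y - x‖ ≤ (1 + δ) * ε := by
    rw [hyx]
    refine (norm_add_le _ _).trans ?_
    rw [norm_neg, norm_smul, Real.norm_of_nonneg hε.1.le]
    nlinarith [hN1 x, hε.1]
  have hxr' : dist x p < r / 2 := hxr
  have hyr : dist y p < r := by
    have h3 : dist y x ≤ (1 + δ) * ε := by rw [dist_eq_norm]; exact hyxn
    have h4 : (1 + δ) * ε < r / 2 := by nlinarith [hε.1, hε.2]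
    linarith [dist_triangle y x p]
  have hxx := h2 x (by rw [Metric.mem_ball]; linarith [min_le_right r₁ r₂])
  have hyy := h2 y (by rw [Metric.mem_ball]; linarith [min_le_right r₁ r₂])
  have hpair := h1 (y, x) (by
    rw [Metric.mem_ball, Prod.dist_eq, max_lt_iff]
    exact ⟨by simp only; linarith [min_le_left r₁ r₂], by simp only; linarith [min_le_left r₁ r₂]⟩)
  simp only at hpair
  rw [hyy.2]
  have hρx : ρ x < 0 := hxx.2.1 hx
  have hAe : A e ≤ ‖A‖ * (δ * ε) :=
    (le_abs_self _).trans ((A.le_opNorm e).trans (mul_le_mul_of_nonneg_left hen hA0))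
  have h3 := (abs_le.1 hpair).2
  rw [hyx, map_add, map_neg, map_smul, smul_eq_mul, ← hyx] at h3
  have hεp := hε.1
  nlinarith [hxx.1, mul_le_mul_of_nonneg_right hδA hεp.le]

/-- The local constants are made uniform by compactness of the boundary. Farther than `r` from it,
the total displacement `(1 + δ) ε < r` cannot leave `Ω`. Uniformity allows mollification at scale `δ
ε` on all of `Ω` at once. -/
theorem IsArcLengthBoundary.exists_shift (hΩ : IsOpen Ω) (hγ : IsArcLengthBoundary Ω L γ)
    (hne : (frontier Ω).Nonempty)
    (hNc : Continuous N) (hN1 : ∀ x, ‖N x‖ ≤ 1)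
    (hNν : ∀ i s, N (γ i s) = outwardNormal (γ i) s) :
    ∃ δ > 0, ∃ ε₀ > 0, ∀ ε ∈ Ioo (0 : ℝ) ε₀, ∀ x ∈ Ω,
      Metric.closedBall (x - ε • N x) (δ * ε) ⊆ Ω := by
  obtain ⟨δ, hδ, ε₀, hε₀, V, hVo, hV, h⟩ : ∃ δ > 0, ∃ ε₀ > 0, ∃ V : Set Plane, IsOpen V ∧
      frontier Ω ⊆ V ∧ ∀ ε ∈ Ioo (0 : ℝ) ε₀, ∀ x ∈ Ω, x ∈ V →
        Metric.closedBall (x - ε • N x) (δ * ε) ⊆ Ω := by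
    refine hγ.isCompact_frontier.induction_on (p := fun S => ∃ δ > 0, ∃ ε₀ > 0, ∃ V : Set Plane,
      IsOpen V ∧ S ⊆ V ∧ ∀ ε ∈ Ioo (0 : ℝ) ε₀, ∀ x ∈ Ω, x ∈ V →
        Metric.closedBall (x - ε • N x) (δ * ε) ⊆ Ω) ?_ ?_ ?_ ?_
    · exact ⟨1, one_pos, 1, one_pos, ∅, isOpen_empty, subset_rfl, by simp⟩
    · rintro S S' hS ⟨δ, hδ, ε₀, hε₀, V, hVo, hV, h⟩
      exact ⟨δ, hδ, ε₀, hε₀, V, hVo, hS.trans hV, h⟩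
    · rintro S S' ⟨δ, hδ, ε₀, hε₀, V, hVo, hV, h⟩ ⟨δ', hδ', ε₀', hε₀', V', hVo', hV', h'⟩
      refine ⟨min δ δ', lt_min hδ hδ', min ε₀ ε₀', lt_min hε₀ hε₀', V ∪ V', hVo.union hVo',
        union_subset_union hV hV', fun ε hε x hx hxV => ?_⟩
      rcases hxV with hxV | hxV
      · exact (Metric.closedBall_subset_closedBall
          (mul_le_mul_of_nonneg_right (min_le_left _ _) hε.1.le)).trans
          (h ε ⟨hε.1, hε.2.trans_le (min_le_left _ _)⟩ x hx hxV)
      · exact (Metric.closedBall_subset_closedBall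
          (mul_le_mul_of_nonneg_right (min_le_right _ _) hε.1.le)).trans
          (h' ε ⟨hε.1, hε.2.trans_le (min_le_right _ _)⟩ x hx hxV)
    · intro p hp
      obtain ⟨δ, hδ, ε₀, hε₀, r, hr, h⟩ := hγ.exists_local_shift hΩ hNc hN1 hNν hp
      exact ⟨Metric.ball p r, mem_nhdsWithin_of_mem_nhds (Metric.ball_mem_nhds p hr), δ, hδ, ε₀,
        hε₀, Metric.ball p r, Metric.isOpen_ball, subset_rfl, h⟩
  obtain ⟨r, hr, hrV⟩ := hγ.isCompact_frontier.exists_thickening_subset_open hVo hV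
  refine ⟨δ, hδ, min ε₀ (r / (1 + δ)), lt_min hε₀ (by positivity), fun ε hε x hx => ?_⟩
  by_cases hxr : x ∈ Metric.thickening r (frontier Ω)
  · exact h ε ⟨hε.1, hε.2.trans_le (min_le_left _ _)⟩ x hx (hrV hxr)
  · have h1 : r ≤ boundaryDist Ω x := by
      by_contra! hlt
      exact hxr ((Metric.mem_thickening_iff_infDist_lt hne).2 hlt)
    intro y hy
    refine ball_boundaryDist_subset hΩ hx ?_
    rw [Metric.mem_ball]
    have h2 : dist y (x - ε • N x) ≤ δ * ε := hy
    have h3 : dist (x - ε • N x) x ≤ ε := by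
      rw [dist_eq_norm, sub_sub_cancel_left, norm_neg, norm_smul, Real.norm_of_nonneg hε.1.le]
      nlinarith [hN1 x, hε.1]
    have h4 : ε * (1 + δ) < r :=
      (lt_div_iff₀ (by positivity)).1 (hε.2.trans_le (min_le_right _ _))
    linarith [dist_triangle y (x - ε • N x) x]

/-- The divergence of a unit extension of the normal is the curvature. -/
theorem IsArcLengthBoundary.divg_eq_curvature (hγ : IsArcLengthBoundary Ω L γ)
    (hNs : ContDiff ℝ ∞ N) (hN1 : ∀ x, ‖N x‖ ≤ 1)
    (hNν : ∀ i s, N (γ i s) = outwardNormal (γ i) s) (i : Fin m) (s : ℝ) :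
    divg N (γ i s) = curvature (γ i) s := by
  set p := γ i s with hp
  set T := tangent (γ i) s with hT
  set ν := outwardNormal (γ i) s with hν
  have hNd : Differentiable ℝ N := hNs.differentiable (by simp)
  set A := fderiv ℝ N p with hA
  have hAT : A T = rot (deriv (tangent (γ i)) s) := by
    have h1 : HasDerivAt (fun s => N (γ i s)) (A T) s :=
      (hNd p).hasFDerivAt.comp_hasDerivAt s (hasDerivAt_curve (hγ.smooth i) s)
    have h2 : (fun s => N (γ i s)) = outwardNormal (γ i) := funext fun s => hNν i s
    rw [h2] at h1
    exact h1.unique (hasDerivAt_outwardNormal (hγ.smooth i) s)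
  -- On the normal line through `p`, `‖N‖²` attains its maximum `1` at `p`, so its derivative
  -- vanishes there.
  have hAν : inner ℝ ν (A ν) = 0 := by
    have h1 : HasDerivAt (fun b : ℝ => N (p + b • ν)) (A ν) 0 := by
      have h2 : HasDerivAt (fun b : ℝ => p + b • ν) ν 0 := by
        simpa using ((hasDerivAt_id (0 : ℝ)).smul_const ν).const_add p
      have h3 : HasFDerivAt N A (p + (0 : ℝ) • ν) := by
        simpa using (hNd p).hasFDerivAt
      exact h3.comp_hasDerivAt 0 h2
    have h2 := h1.norm_sq
    have h3 : IsLocalMax (fun b : ℝ => ‖N (p + b • ν)‖ ^ 2) 0 := by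
      refine Eventually.of_forall fun b => ?_
      simp only [zero_smul, add_zero, hp, hNν]
      rw [hγ.norm_normal]
      nlinarith [hN1 (γ i s + b • ν), norm_nonneg (N (γ i s + b • ν))]
    have h4 := h3.hasDerivAt_eq_zero h2
    have h5 : N (p + (0 : ℝ) • ν) = ν := by rw [zero_smul, add_zero, hp, hNν]
    rw [h5] at h4
    linarith
  have hT1 : T 0 ^ 2 + T 1 ^ 2 = 1 := by rw [← norm_sq_eq, hT, hγ.unit_speed]; norm_num
  have hAT0 := congrArg (fun v : Plane => v 0) hAT
  have hAT1 := congrArg (fun v : Plane => v 1) hAT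
  simp only [rot_zero_coord, rot_one_coord] at hAT0 hAT1
  rw [map_apply_eq] at hAT0 hAT1
  rw [inner_eq, map_apply_eq A ν 0, map_apply_eq A ν 1, hν, outwardNormal_eq_rot, ← hT] at hAν
  simp only [rot_zero_coord, rot_one_coord] at hAν
  rw [divg, Fin.sum_univ_two, partialDeriv_coord (hNd p), partialDeriv_coord (hNd p), ← hA,
    curvature, inner_eq, outwardNormal_eq_rot, ← hT]
  simp only [rot_zero_coord, rot_one_coord]
  -- The trace of `A` is computed in the orthonormal frame `T, ν`: the tangential entry is the
  -- curvature and the normal entry vanishes by `hAν`.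
  linear_combination (-(A (EuclideanSpace.single 0 1) 0 + A (EuclideanSpace.single 1 1) 1)) * hT1
    + T 0 * hAT0 + T 1 * hAT1 + hAν

end Extension

/-! ### Quadratic lower bounds for the curvature deficit -/

/-- Since `q ≥ 0`, a constant may be lowered, so the minimum over a finite subcover works. -/
theorem exists_mul_le_of_local {K : Set ℝ} (hK : IsCompact K) {g q : ℝ → ℝ}
    (hq : ∀ x, 0 ≤ q x) (h : ∀ x ∈ K, ∃ c > 0, ∀ᶠ y in 𝓝 x, c * q y ≤ g y) :
    ∃ c > 0, ∀ x ∈ K, c * q x ≤ g x := by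
  refine hK.induction_on (p := fun S => ∃ c > 0, ∀ x ∈ S, c * q x ≤ g x) ?_ ?_ ?_ ?_
  · exact ⟨1, one_pos, by simp⟩
  · rintro S S' hS ⟨c, hc, h⟩
    exact ⟨c, hc, fun x hx => h x (hS hx)⟩
  · rintro S S' ⟨c, hc, h⟩ ⟨c', hc', h'⟩
    refine ⟨min c c', lt_min hc hc', ?_⟩
    rintro x (hx | hx)
    · exact (mul_le_mul_of_nonneg_right (min_le_left _ _) (hq x)).trans (h x hx)
    · exact (mul_le_mul_of_nonneg_right (min_le_right _ _) (hq x)).trans (h' x hx)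
  · intro x hx
    obtain ⟨c, hc, h⟩ := h x hx
    exact ⟨_, mem_nhdsWithin_of_mem_nhds h, c, hc, fun y hy => hy⟩

theorem exists_eventually_mul_le {g q : ℝ → ℝ} {x : ℝ} (hg : ContinuousAt g x)
    (hq : ContinuousAt q x) (h : 0 < g x) : ∃ c > 0, ∀ᶠ y in 𝓝 x, c * q y ≤ g y := by
  refine ⟨g x / (2 * (|q x| + 1)), by positivity, ?_⟩
  have h1 : g x / (2 * (|q x| + 1)) * q x < g x := by
    rw [div_mul_eq_mul_div, div_lt_iff₀ (by positivity)]
    nlinarith [le_abs_self (q x), abs_nonneg (q x)]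
  exact ((continuousAt_const.mul hq).eventually_lt hg h1).mono fun y hy => hy.le

/-- A nondegenerate maximum is locally strict to second order. -/
theorem exists_quadratic_of_max {f : ℝ → ℝ} (hf : ContDiff ℝ ∞ f) (hmax : ∀ s, f s ≤ f 0)
    (h2 : iteratedDeriv 2 f 0 < 0) : ∃ c > 0, ∀ᶠ s in 𝓝 0, c * s ^ 2 ≤ f 0 - f s := by
  have hd : Differentiable ℝ f := hf.differentiable (by simp)
  have hf' : ContDiff ℝ ∞ (deriv f) := (contDiff_infty_iff_deriv.1 hf).2
  have h0 : deriv f 0 = 0 := IsLocalMax.deriv_eq_zero (Eventually.of_forall hmax)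
  set k := iteratedDeriv 2 f 0 with hk
  have hkd : HasDerivAt (deriv f) k 0 := by
    have := (hf'.differentiable (by simp) 0).hasDerivAt
    rwa [hk, iteratedDeriv_succ, iteratedDeriv_one]
  have h3 := hkd.isLittleO.def (c := -k / 2) (by linarith)
  simp only [h0, sub_zero, smul_eq_mul, Real.norm_eq_abs] at h3
  obtain ⟨r, hr, hball⟩ := Metric.eventually_nhds_iff_ball.1 h3
  rw [Real.ball_eq_Ioo, zero_sub, zero_add] at hball
  -- Half of the quadratic Taylor term `k s² / 2` is subtracted. The other half dominates the error
  -- in `deriv f`, so `φ` still increases before `0` and decreases after it.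
  set φ : ℝ → ℝ := fun s => f s - k / 4 * s ^ 2 with hφ
  have hφd : ∀ s, HasDerivAt φ (deriv f s - k / 2 * s) s := fun s => by
    have := (hd s).hasDerivAt.sub (((hasDerivAt_id s).pow 2).const_mul (k / 4))
    refine this.congr_deriv ?_
    simp; ring
  have hφc : Continuous φ := continuous_iff_continuousAt.2 fun s => (hφd s).continuousAt
  have hle : ∀ s ∈ Ioo (-r) r, φ s ≤ φ 0 := fun s hs => by
    rcases le_total 0 s with h | h
    · have := antitoneOn_of_deriv_nonpos (convex_Icc 0 s) hφc.continuousOn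
        (fun x _ => (hφd x).differentiableAt.differentiableWithinAt) (fun x hx => by
          rw [interior_Icc] at hx
          rw [(hφd x).deriv]
          have := (abs_le.1 (hball x ⟨by linarith [hx.1], by linarith [hx.2, hs.2]⟩)).2
          rw [abs_of_pos hx.1] at this
          linarith)
      exact this (left_mem_Icc.2 h) (right_mem_Icc.2 h) h
    · have := monotoneOn_of_deriv_nonneg (convex_Icc s 0) hφc.continuousOn
        (fun x _ => (hφd x).differentiableAt.differentiableWithinAt) (fun x hx => by
          rw [interior_Icc] at hx
          rw [(hφd x).deriv]
          have := (abs_le.1 (hball x ⟨by linarith [hx.1, hs.1], by linarith [hx.2]⟩)).1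
          rw [abs_of_neg hx.2] at this
          linarith)
      exact this (left_mem_Icc.2 h) (right_mem_Icc.2 h) h
  refine ⟨-k / 4, by linarith, ?_⟩
  filter_upwards [Ioo_mem_nhds (by linarith : -r < 0) hr] with s hs
  have := hle s hs
  simp only [hφ] at this
  linarith

section Boundary

variable {Ω : Set Plane} {m : ℕ} {L : Fin m → ℝ} {γ : Fin m → ℝ → Plane} {i₀ : Fin m}

theorem norm_curve_sub_le (hγ : IsArcLengthBoundary Ω L γ) (i : Fin m) (s t : ℝ) :
    ‖γ i s - γ i t‖ ≤ |s - t| := by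
  have := convex_univ.norm_image_sub_le_of_norm_hasDerivWithin_le (C := 1) (f := γ i)
    (fun x _ => (hasDerivAt_curve (hγ.smooth i) x).hasDerivWithinAt)
    (fun x _ => (hγ.unit_speed i x).le) (mem_univ t) (mem_univ s)
  simpa using this

theorem eq_zero_of_curve_eq (hγ : IsArcLengthBoundary Ω L γ) {i j : Fin m} {s : ℝ}
    (hs : s ∈ Icc (-(L i / 2)) (L i / 2)) (h : γ i s = γ j 0) : i = j ∧ s = 0 := by
  obtain ⟨rfl, n, hn⟩ := hγ.simple i j s 0 h
  refine ⟨rfl, ?_⟩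
  have hL := hγ.length_pos i
  have h1 : (n : ℝ) < 1 := by nlinarith [hs.1, hs.2]
  have h2 : (-1 : ℝ) < n := by nlinarith [hs.1, hs.2]
  have h3 : n < 1 := by exact_mod_cast h1
  have h4 : -1 < n := by exact_mod_cast h2
  obtain rfl : n = 0 := by omega
  simpa using hn

/-- At the base point of `γ i₀` the unit speed makes the chord comparable to the arc; everywhere
else on one period, and on the other components, the chord is positive and compactness applies. -/
theorem exists_sq_le_norm_sq (hγ : IsArcLengthBoundary Ω L γ) (i₀ : Fin m) :
    ∃ c > 0, ∀ i, ∀ s ∈ Icc (-(L i / 2)) (L i / 2), c * s ^ 2 ≤ ‖γ i s - γ i₀ 0‖ ^ 2 := by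
  have key : ∀ i, ∃ c > 0, ∀ s ∈ Icc (-(L i / 2)) (L i / 2),
      c * s ^ 2 ≤ ‖γ i s - γ i₀ 0‖ ^ 2 := fun i => by
    have hgc : Continuous fun s => ‖γ i s - γ i₀ 0‖ ^ 2 :=
      ((hγ.continuous i).sub continuous_const).norm.pow 2
    refine exists_mul_le_of_local isCompact_Icc (fun s => sq_nonneg s) fun s hs => ?_
    by_cases h : γ i s = γ i₀ 0
    · obtain ⟨rfl, rfl⟩ := eq_zero_of_curve_eq hγ hs h
      have hd := (hasDerivAt_curve (hγ.smooth i) 0).isLittleO.def (c := 1 / 2) (by norm_num)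
      refine ⟨1 / 4, by norm_num, hd.mono fun t ht => ?_⟩
      rw [sub_zero] at ht
      have h1 : ‖t • tangent (γ i) 0‖ = |t| := by
        rw [norm_smul, hγ.unit_speed, mul_one, Real.norm_eq_abs]
      have h2 := norm_sub_norm_le (t • tangent (γ i) 0) (t • tangent (γ i) 0 - (γ i t - γ i 0))
      rw [sub_sub_cancel, h1, norm_sub_rev] at h2
      rw [Real.norm_eq_abs] at ht
      have h3 : 1 / 2 * |t| ≤ ‖γ i t - γ i 0‖ := by linarith
      have h4 := pow_le_pow_left₀ (by positivity) h3 2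
      rw [mul_pow, sq_abs] at h4
      linarith
    · refine exists_eventually_mul_le hgc.continuousAt (continuous_pow 2).continuousAt ?_
      have : 0 < ‖γ i s - γ i₀ 0‖ := norm_pos_iff.2 (sub_ne_zero.2 h)
      positivity
  choose c hc h using key
  have : Nonempty (Fin m) := ⟨i₀⟩
  obtain ⟨j, hj⟩ := Finite.exists_min c
  exact ⟨c j, hc j, fun i s hs =>
    (mul_le_mul_of_nonneg_right (hj i) (sq_nonneg s)).trans (h i s hs)⟩

/-- Nondegeneracy gives the bound near the maximum, and uniqueness with compactness gives it
elsewhere. The chord replaces arc length because it makes sense on every component and compares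
directly with `well`. -/
theorem exists_norm_sq_le_deficit (hγ : IsArcLengthBoundary Ω L γ)
    (hmax : HasUniqueNondegenerateMaxCurvature γ i₀) :
    ∃ c > 0, ∀ i s, c * ‖γ i s - γ i₀ 0‖ ^ 2 ≤ curvature (γ i₀) 0 - curvature (γ i) s := by
  have key : ∀ i, ∃ c > 0, ∀ s ∈ Icc (-(L i / 2)) (L i / 2),
      c * ‖γ i s - γ i₀ 0‖ ^ 2 ≤ curvature (γ i₀) 0 - curvature (γ i) s := fun i => by
    have hgc : Continuous fun s => curvature (γ i₀) 0 - curvature (γ i) s :=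
      continuous_const.sub (contDiff_curvature (hγ.smooth i)).continuous
    refine exists_mul_le_of_local isCompact_Icc (fun s => sq_nonneg _) fun s hs => ?_
    by_cases h : γ i s = γ i₀ 0
    · obtain ⟨rfl, rfl⟩ := eq_zero_of_curve_eq hγ hs h
      obtain ⟨c, hc, hq⟩ := exists_quadratic_of_max (contDiff_curvature (hγ.smooth i))
        (hmax.le_max i) hmax.nondegenerate
      refine ⟨c, hc, hq.mono fun t ht => le_trans ?_ ht⟩
      have h1 := norm_curve_sub_le hγ i t 0
      rw [sub_zero] at h1
      have h2 := pow_le_pow_left₀ (norm_nonneg _) h1 2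
      rw [sq_abs] at h2
      exact mul_le_mul_of_nonneg_left h2 hc.le
    · refine exists_eventually_mul_le hgc.continuousAt
        (((hγ.continuous i).sub continuous_const).norm.pow 2).continuousAt ?_
      exact sub_pos.2 (lt_of_le_of_ne (hmax.le_max i s) fun he => h (hmax.unique i s he))
  choose c hc h using key
  have : Nonempty (Fin m) := ⟨i₀⟩
  obtain ⟨j, hj⟩ := Finite.exists_min c
  refine ⟨c j, hc j, fun i s => ?_⟩
  obtain ⟨s', hs', n, hn⟩ := hγ.exists_Ioc i (-(L i / 2)) s
  have h1 : γ i s' = γ i s := by rw [hn, hγ.shift]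
  rw [← hγ.curvature_congr h1, ← h1]
  refine (mul_le_mul_of_nonneg_right (hj i) (sq_nonneg _)).trans (h i s' ?_)
  exact ⟨hs'.1.le, by linarith [hs'.2]⟩

/-! ### The boundary coordinate -/

theorem exists_nearest (hγ : IsArcLengthBoundary Ω L γ) (i₀ : Fin m) (x : Plane) :
    ∃ p : Fin m × ℝ, p.2 ∈ Ioc (-(L p.1 / 2)) (L p.1 / 2) ∧
      dist x (γ p.1 p.2) = boundaryDist Ω x := by
  obtain ⟨y, hy, hxy⟩ := hγ.isCompact_frontier.exists_infDist_eq_dist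
    ⟨_, hγ.mem_frontier i₀ 0⟩ x
  obtain ⟨i, s, rfl⟩ := hγ.exists_eq hy
  obtain ⟨s', hs', n, hn⟩ := hγ.exists_Ioc i (-(L i / 2)) s
  refine ⟨(i, s'), ⟨hs'.1, by linarith [hs'.2]⟩, ?_⟩
  simp only [hn, hγ.shift]
  exact hxy.symm

theorem arcCoord_spec (hγ : IsArcLengthBoundary Ω L γ) (i₀ : Fin m) (x : Plane) :
    ∃ i, arcCoord Ω L γ x ∈ Ioc (-(L i / 2)) (L i / 2) ∧
      dist x (γ i (arcCoord Ω L γ x)) = boundaryDist Ω x := by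
  have hx := exists_nearest hγ i₀ x
  have : arcCoord Ω L γ x = hx.choose.2 := by rw [arcCoord, dif_pos hx]
  rw [this]
  exact ⟨hx.choose.1, hx.choose_spec⟩

/-- On the segment from `x` to a nearest point the distance to `S` is exactly affine. Only a
one-sided derivative is available this way, and it suffices because the distance is assumed
differentiable. -/
theorem fderiv_infDist_apply {S : Set Plane} {x q : Plane}
    (hd : DifferentiableAt ℝ (fun y => Metric.infDist y S) x) (hq : q ∈ S)
    (hxq : dist x q = Metric.infDist x S) :
    fderiv ℝ (fun y => Metric.infDist y S) x (q - x) = -Metric.infDist x S := by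
  set d : Plane → ℝ := fun y => Metric.infDist y S with hdef
  have hline : ∀ τ ∈ Icc (0 : ℝ) 1, d (x + τ • (q - x)) = d x - τ * d x := fun τ hτ => by
    have e1 : dist (x + τ • (q - x)) q = (1 - τ) * d x := by
      have : x + τ • (q - x) - q = (1 - τ) • (x - q) := by module
      rw [dist_eq_norm, this, norm_smul, ← dist_eq_norm x q, hxq,
        Real.norm_of_nonneg (by linarith [hτ.2])]
    have e2 : dist x (x + τ • (q - x)) = τ * d x := by
      rw [dist_eq_norm, sub_add_cancel_left, norm_neg, norm_smul, norm_sub_rev, ← dist_eq_norm x q,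
        hxq, Real.norm_of_nonneg hτ.1]
    have h1 : d (x + τ • (q - x)) ≤ (1 - τ) * d x := e1 ▸ Metric.infDist_le_dist_of_mem hq
    have h2 : d x ≤ d (x + τ • (q - x)) + τ * d x := e2 ▸ Metric.infDist_le_infDist_add_dist
    linarith
  have h1 : HasDerivAt (fun τ : ℝ => x + τ • (q - x)) (q - x) 0 := by
    simpa using ((hasDerivAt_id (0 : ℝ)).smul_const (q - x)).const_add x
  have h2 : HasFDerivAt d (fderiv ℝ d x) (x + (0 : ℝ) • (q - x)) := by
    simpa using hd.hasFDerivAt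
  have h3 := (h2.comp_hasDerivAt 0 h1).hasDerivWithinAt (s := Icc 0 1)
  have h4 : HasDerivWithinAt (fun τ : ℝ => d x - τ * d x) (-d x) (Icc 0 1) 0 := by
    have := (((hasDerivAt_id (0 : ℝ)).mul_const (d x)).const_sub (d x)).hasDerivWithinAt
      (s := Icc 0 1)
    simpa using this
  have h5 := h4.congr hline (hline 0 (by simp))
  exact (uniqueDiffOn_Icc zero_lt_one 0 (by simp)).eq_deriv _ h3 h5

/-- Almost every point has at most one nearest point in a given set. -/
theorem ae_nearest_unique (S : Set Plane) : ∀ᵐ x : Plane, ∀ q ∈ S, ∀ q' ∈ S,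
    dist x q = Metric.infDist x S → dist x q' = Metric.infDist x S → q = q' := by
  have hl : LipschitzWith 1 fun y : Plane => Metric.infDist y S := Metric.lipschitz_infDist_pt S
  filter_upwards [hl.ae_differentiableAt] with x hd q hq q' hq' h h'
  have h1 := fderiv_infDist_apply hd hq h
  have h2 := fderiv_infDist_apply hd hq' h'
  set A := fderiv ℝ (fun y => Metric.infDist y S) x
  set d := Metric.infDist x S
  -- The derivative has norm at most `1` and equals `-d` on both `q - x` and `q' - x`, so their sum
  -- has length at least `2d`. Two vectors of length `d` with such a sum coincide, by the
  -- parallelogram law.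
  have hA : ‖A‖ ≤ 1 := by simpa using norm_fderiv_le_of_lipschitz ℝ hl (x₀ := x)
  have h3 : 2 * d ≤ ‖(q - x) + (q' - x)‖ := by
    have e1 := A.le_opNorm ((q - x) + (q' - x))
    rw [map_add, h1, h2, Real.norm_eq_abs] at e1
    have e2 := neg_le_abs (-d + -d)
    nlinarith [norm_nonneg ((q - x) + (q' - x))]
  have hpar := parallelogram_law_with_norm ℝ (q - x) (q' - x)
  rw [← dist_eq_norm q x, ← dist_eq_norm q' x, dist_comm q x, dist_comm q' x, h, h',
    sub_sub_sub_cancel_right] at hpar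
  have hd0 : 0 ≤ d := Metric.infDist_nonneg
  have h5 : ‖q - q'‖ * ‖q - q'‖ ≤ 0 := by nlinarith
  have h6 : ‖q - q'‖ = 0 := by nlinarith [norm_nonneg (q - q')]
  exact sub_eq_zero.1 (norm_eq_zero.1 h6)

/-- `arcCoord` is defined by choice where the nearest point is not unique, but that set is null. Off
it, a sublevel set is a countable union of closed sets on which some compact arc realizes the
distance to the boundary. -/
theorem aemeasurable_arcCoord (hγ : IsArcLengthBoundary Ω L γ) (i₀ : Fin m) :
    AEMeasurable (arcCoord Ω L γ) := by
  refine NullMeasurable.aemeasurable ?_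
  suffices h : ∀ a, NullMeasurableSet (arcCoord Ω L γ ⁻¹' Iic a) volume by
    have hm : @Measurable (NullMeasurableSpace Plane volume) ℝ _ _ (arcCoord Ω L γ) :=
      measurable_of_Iic h
    exact fun s hs => hm hs
  intro a
  -- These compact intervals exhaust the half-open parameter interval up to level `a`. Excluding the
  -- left end keeps the parameter of a boundary point unique.
  set I : Fin m → ℕ → Set ℝ := fun i n => Icc (-(L i / 2) + 1 / ((n : ℝ) + 1)) (min a (L i / 2))
  set S : Set Plane := ⋃ (i : Fin m) (n : ℕ) (_ : (I i n).Nonempty),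
    {x | Metric.infDist x (γ i '' I i n) = boundaryDist Ω x} with hS
  have hSm : MeasurableSet S := by
    refine MeasurableSet.iUnion fun i => MeasurableSet.iUnion fun n => MeasurableSet.iUnion fun _ =>
      IsClosed.measurableSet (isClosed_eq (Metric.continuous_infDist_pt _)
        (lipschitzWith_boundaryDist Ω).continuous)
  refine hSm.nullMeasurableSet.congr ?_
  filter_upwards [ae_nearest_unique (frontier Ω)] with x hx
  refine propext (show x ∈ S ↔ arcCoord Ω L γ x ≤ a from ?_)
  obtain ⟨j, hj, hjd⟩ := arcCoord_spec hγ i₀ x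
  simp only [hS, mem_iUnion, mem_ofPred_eq]
  constructor
  · rintro ⟨i, n, hne, hi⟩
    obtain ⟨_, ⟨s, hs, rfl⟩, hsx⟩ := ((isCompact_Icc (a := -(L i / 2) + 1 / ((n : ℝ) + 1))
      (b := min a (L i / 2))).image (hγ.continuous i)).exists_infDist_eq_dist (hne.image _) x
    have h1 := hx _ (hγ.mem_frontier i s) _ (hγ.mem_frontier j _) (hsx.symm.trans hi) hjd
    obtain ⟨rfl, k, hk⟩ := hγ.simple _ _ _ _ h1
    have hn : 0 < 1 / ((n : ℝ) + 1) := by positivity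
    have hL := hγ.length_pos i
    have hs2 : s ≤ L i / 2 := hs.2.trans (min_le_right _ _)
    have h2 : (k : ℝ) < 1 := by nlinarith [hs.1, hj.2]
    have h3 : (-1 : ℝ) < k := by nlinarith [hj.1]
    have h4 : k < 1 := by exact_mod_cast h2
    have h5 : -1 < k := by exact_mod_cast h3
    obtain rfl : k = 0 := by omega
    have : arcCoord Ω L γ x = s := by simpa [sub_eq_zero] using hk
    rw [this]
    exact hs.2.trans (min_le_left _ _)
  · intro ha
    obtain ⟨n, hn⟩ := exists_nat_one_div_lt (K := ℝ)
      (show 0 < arcCoord Ω L γ x + L j / 2 by linarith [hj.1])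
    have hmem : arcCoord Ω L γ x ∈ I j n := ⟨by linarith, le_min ha hj.2⟩
    refine ⟨j, n, ⟨_, hmem⟩, le_antisymm ?_ ?_⟩
    · rw [← hjd]; exact Metric.infDist_le_dist_of_mem ⟨_, hmem, rfl⟩
    · refine Metric.infDist_le_infDist_of_subset ?_ ⟨_, _, hmem, rfl⟩
      rintro _ ⟨s, -, rfl⟩
      exact hγ.mem_frontier j s

end Boundary

/-! ### Translations and mollification in `L²` -/

theorem eLpNorm_two_sq (f : Plane → ℝ) (μ : Measure Plane) :
    eLpNorm f 2 μ ^ 2 = ∫⁻ x, ‖f x‖ₑ ^ 2 ∂μ := by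
  have := eLpNorm_nnreal_pow_eq_lintegral (f := f) (μ := μ) (p := 2) (by norm_num)
  simpa using this

theorem tendsto_eLpNorm_translation {f : Plane → ℝ} (hf : MemLp f 2 volume) :
    Tendsto (fun z => eLpNorm (fun x => f (x + z) - f x) 2 volume) (𝓝 0) (𝓝 0) := by
  set g : Plane → C(Plane, Plane) := fun z => ⟨fun x => x + z, by fun_prop⟩ with hg
  have hgc : Tendsto g (𝓝 0) (𝓝 (g 0)) := by
    have h1 : Continuous (fun q : Plane × Plane => q.2 + q.1) := by fun_prop
    have := (ContinuousMap.curry ⟨_, h1⟩).continuous.tendsto 0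
    exact this
  have hgm : ∀ z, MeasurePreserving (g z) volume volume := fun z =>
    measurePreserving_add_right volume z
  have := Filter.Tendsto.compMeasurePreservingLp (f := fun _ => hf.toLp f)
    (tendsto_const_nhds (x := hf.toLp f)) hgc hgm (hgm 0) (by norm_num)
  rw [tendsto_iff_edist_tendsto_0] at this
  refine this.congr fun z => ?_
  rw [Lp.toLp_compMeasurePreserving, Lp.toLp_compMeasurePreserving, Lp.edist_toLp_toLp]
  congr 1
  funext x
  simp [hg]

theorem sq_lintegral_le (μ : Measure Plane) {g : Plane → ENNReal} (hg : AEMeasurable g μ) :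
    (∫⁻ x, g x ∂μ) ^ 2 ≤ μ univ * ∫⁻ x, g x ^ 2 ∂μ := by
  have h := ENNReal.lintegral_mul_le_Lp_mul_Lq μ (p := 2) (q := 2) Real.HolderConjugate.two_two
    hg (aemeasurable_const (b := (1 : ENNReal)))
  simp only [Pi.mul_apply, mul_one, ENNReal.rpow_two, one_pow, lintegral_const, one_mul] at h
  have h2 := pow_le_pow_left₀ (zero_le) h 2
  have e : ∀ a : ENNReal, (a ^ (1 / 2 : ℝ)) ^ 2 = a := fun a => by
    rw [← ENNReal.rpow_natCast, ← ENNReal.rpow_mul]; norm_num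
  rw [mul_pow, e, e] at h2
  rwa [mul_comm (μ univ)]

/-- Only values of `f` within `2ε` of `x` enter, so Cauchy–Schwarz and Tonelli reduce the error to
the `L²` modulus of continuity of `f`. Since the kernel is used only through its supremum, the
evaluation point `T x` may depend on `x` without any change of variables. -/
theorem mollify_bound {f : Plane → ℝ} (hf : MemLp f 2 volume) {ε K : ℝ}
    {ρ : Plane → ℝ} (hρc : Continuous ρ) (hρ1 : ∫ y, ρ y = 1)
    (hρs : ∀ y, ε < ‖y‖ → ρ y = 0) (hρK : ∀ y, |ρ y| ≤ K) {T : Plane → Plane}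
    (hT : ∀ x, ‖T x - x‖ ≤ ε) {η : ENNReal}
    (hη : ∀ z ∈ Metric.closedBall (0 : Plane) (2 * ε),
      eLpNorm (fun x => f (x + z) - f x) 2 volume ≤ η) :
    eLpNorm (fun x => (∫ t, f t * ρ (T x - t)) - f x) 2 volume ≤
      ENNReal.ofReal K * volume (Metric.closedBall (0 : Plane) (2 * ε)) * η := by
  set B := Metric.closedBall (0 : Plane) (2 * ε) with hB
  have hBm : MeasurableSet B := Metric.isClosed_closedBall.measurableSet
  have hloc : LocallyIntegrable f volume := hf.locallyIntegrable (by norm_num)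
  have hρcs : HasCompactSupport ρ := HasCompactSupport.of_support_subset_isCompact
    (isCompact_closedBall (0 : Plane) ε) fun y hy => by
      rw [mem_closedBall_zero_iff]
      by_contra! h
      exact hy (hρs y h)
  have hpt : ∀ x, ‖(∫ t, f t * ρ (T x - t)) - f x‖ₑ ≤
      ENNReal.ofReal K * ∫⁻ z in B, ‖f (x + z) - f x‖ₑ := fun x => by
    have hcs : HasCompactSupport fun t => ρ (T x - t) :=
      hρcs.comp_homeomorph (Homeomorph.subLeft (T x))
    have hcc : Continuous fun t => ρ (T x - t) := by fun_prop
    have h1 : (∫ t, f t * ρ (T x - t)) - f x = ∫ t, (f t - f x) * ρ (T x - t) := by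
      have e1 : ∫ t, f x * ρ (T x - t) = f x := by
        rw [integral_const_mul, integral_sub_left_eq_self ρ volume (T x), hρ1, mul_one]
      rw [← e1, ← integral_sub]
      · congr 1; funext t; rw [e1]; ring
      · exact hloc.integrable_smul_right_of_hasCompactSupport hcc hcs
      · exact (hcc.integrable_of_hasCompactSupport hcs).const_mul _
    rw [h1]
    calc ‖∫ t, (f t - f x) * ρ (T x - t)‖ₑ
        ≤ ∫⁻ t, ‖(f t - f x) * ρ (T x - t)‖ₑ := enorm_integral_le_lintegral_enorm _
      _ = ∫⁻ z, ‖(f (x + z) - f x) * ρ (T x - (x + z))‖ₑ :=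
          (lintegral_add_left_eq_self (fun t => ‖(f t - f x) * ρ (T x - t)‖ₑ) x).symm
      _ ≤ ∫⁻ z, B.indicator (fun z => ENNReal.ofReal K * ‖f (x + z) - f x‖ₑ) z := by
          refine lintegral_mono fun z => ?_
          by_cases hz : z ∈ B
          · rw [indicator_of_mem hz, enorm_mul, mul_comm]
            gcongr
            rw [← ofReal_norm]
            exact ENNReal.ofReal_le_ofReal (hρK _)
          · rw [indicator_of_notMem hz, hρs, mul_zero, enorm_zero]
            rw [hB, mem_closedBall_zero_iff, not_le] at hz
            have e1 : z = (T x - x) - (T x - (x + z)) := by abel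
            have e2 := norm_sub_le (T x - x) (T x - (x + z))
            rw [← e1] at e2
            linarith [hT x]
      _ = ENNReal.ofReal K * ∫⁻ z in B, ‖f (x + z) - f x‖ₑ := by
          rw [lintegral_indicator hBm,
            lintegral_const_mul' _ _ ENNReal.ofReal_ne_top]
  have hjoint : AEMeasurable (fun q : Plane × Plane => ‖f (q.1 + q.2) - f q.1‖ₑ ^ 2)
      (volume.prod (volume.restrict B)) := by
    have h1 : AEMeasurable (fun q : Plane × Plane => f (q.1 + q.2)) (volume.prod volume) :=
      hf.1.aemeasurable.comp_quasiMeasurePreserving (quasiMeasurePreserving_add volume volume)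
    have h2 : AEMeasurable (fun q : Plane × Plane => f q.1) (volume.prod volume) :=
      hf.1.aemeasurable.comp_quasiMeasurePreserving Measure.quasiMeasurePreserving_fst
    exact ((h1.sub h2).enorm.pow_const 2).mono_ac
      (Measure.AbsolutelyContinuous.prod Measure.AbsolutelyContinuous.rfl
        Measure.restrict_le_self.absolutelyContinuous)
  have hslice : ∀ x, AEMeasurable (fun z => ‖f (x + z) - f x‖ₑ) (volume.restrict B) := fun x => by
    have h1 : AEMeasurable (fun z => f (x + z)) volume :=
      hf.1.aemeasurable.comp_quasiMeasurePreserving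
        (measurePreserving_add_left volume x).quasiMeasurePreserving
    exact (h1.sub_const _).enorm.mono_measure Measure.restrict_le_self
  refine (ENNReal.pow_le_pow_left_iff two_ne_zero).1 ?_
  rw [eLpNorm_two_sq]
  set k := ENNReal.ofReal K
  calc ∫⁻ x, ‖(∫ t, f t * ρ (T x - t)) - f x‖ₑ ^ 2
      ≤ ∫⁻ x, k ^ 2 * (volume B * ∫⁻ z in B, ‖f (x + z) - f x‖ₑ ^ 2) := by
        refine lintegral_mono fun x => ?_
        refine (pow_le_pow_left₀ zero_le (hpt x) 2).trans ?_
        rw [mul_pow]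
        gcongr
        refine (sq_lintegral_le _ (hslice x)).trans_eq ?_
        rw [Measure.restrict_apply_univ]
    _ = k ^ 2 * (volume B * ∫⁻ z in B, ∫⁻ x, ‖f (x + z) - f x‖ₑ ^ 2) := by
        rw [lintegral_const_mul' _ _ (ENNReal.pow_ne_top ENNReal.ofReal_ne_top),
          lintegral_const_mul' _ _ measure_closedBall_lt_top.ne, lintegral_lintegral_swap hjoint]
    _ ≤ k ^ 2 * (volume B * ∫⁻ z in B, η ^ 2) := by
        gcongr k ^ 2 * (volume B * ?_)
        refine setLIntegral_mono' hBm fun z hz => ?_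
        rw [← eLpNorm_two_sq (fun x => f (x + z) - f x)]
        exact pow_le_pow_left₀ zero_le (hη z hz) 2
    _ = (k * volume B * η) ^ 2 := by
        rw [setLIntegral_const]; ring

/-- A smooth kernel of total mass one, supported in the ball of radius `r`. -/
theorem exists_kernel {r : ℝ} (hr : 0 < r) : ∃ ρ : Plane → ℝ, ContDiff ℝ ∞ ρ ∧
    HasCompactSupport ρ ∧ ∫ y, ρ y = 1 ∧ (∀ y, r < ‖y‖ → ρ y = 0) ∧
    ∀ y, |ρ y| ≤ 4 / volume.real (Metric.closedBall (0 : Plane) r) := by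
  -- The inner radius is half the outer one, whence the factor `4 = 2²` in the bound.
  set β : ContDiffBump (0 : Plane) := ⟨r / 2, r, by positivity, by linarith⟩ with hβ
  refine ⟨β.normed volume, β.contDiff_normed, β.hasCompactSupport_normed, β.integral_normed,
    fun y hy => ?_, fun y => ?_⟩
  · have : y ∉ Function.support (β.normed volume) := by
      rw [β.support_normed_eq, Metric.mem_ball, dist_zero_right, not_lt]; exact hy.le
    simpa using this
  · rw [abs_of_nonneg (β.nonneg_normed y)]
    have := β.normed_le_div_measure_closedBall_rOut volume 2 (by simp only [hβ]; linarith) y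
    refine this.trans_eq ?_
    rw [finrank_euclideanSpace_fin]; norm_num [hβ]

/-- The kernel lives at scale `δ r`, the averaging at scale `2 r`. In dimension two the loss is `4
(2/δ)²`, independent of `r`. -/
theorem volume_ratio {r δ : ℝ} (hr : 0 < r) (hδ : 0 < δ) :
    ENNReal.ofReal (4 / volume.real (Metric.closedBall (0 : Plane) (δ * r))) *
      volume (Metric.closedBall (0 : Plane) (2 * r)) = ENNReal.ofReal (16 / δ ^ 2) := by
  have h1 : volume.real (Metric.closedBall (0 : Plane) (2 * r)) =
      (2 / δ) ^ 2 * volume.real (Metric.closedBall (0 : Plane) (δ * r)) := by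
    rw [Measure.addHaar_real_closedBall _ _ (by positivity),
      Measure.addHaar_real_closedBall _ _ (by positivity), finrank_euclideanSpace_fin]
    field_simp
  have h2 : 0 < volume.real (Metric.closedBall (0 : Plane) (δ * r)) :=
    ENNReal.toReal_pos (Metric.measure_closedBall_pos _ _ (by positivity)).ne'
      measure_closedBall_lt_top.ne
  rw [← ENNReal.ofReal_toReal (a := volume (Metric.closedBall (0 : Plane) (2 * r)))
    measure_closedBall_lt_top.ne, ← ENNReal.ofReal_mul (by positivity)]
  congr 1
  change _ * volume.real _ = _
  rw [h1]
  field_simp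
  norm_num

/-- Derivatives of a mollified function. -/
theorem hasFDerivAt_mollify {f ρ : Plane → ℝ} (hf : LocallyIntegrable f volume)
    (hρ : ContDiff ℝ ∞ ρ) (hρcs : HasCompactSupport ρ) :
    ContDiff ℝ ∞ (fun y => ∫ t, f t * ρ (y - t)) ∧
    ∀ y e, fderiv ℝ (fun y => ∫ t, f t * ρ (y - t)) y e = ∫ t, f t * fderiv ℝ ρ (y - t) e := by
  have h0 : (fun y => ∫ t, f t * ρ (y - t)) =
      convolution f ρ (ContinuousLinearMap.mul ℝ ℝ) volume := by
    funext y; rw [convolution_def]; rfl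
  rw [h0]
  refine ⟨hρcs.contDiff_convolution_right _ hf hρ, fun y e => ?_⟩
  rw [(hρcs.hasFDerivAt_convolution_right _ hf (hρ.of_le (by simp)) y).fderiv,
    convolution_precompR_apply _ hf (hρcs.fderiv ℝ) (hρ.continuous_fderiv (by simp))]
  rfl

/-! ### Density of smooth functions in `H¹` -/

/-- The real functions `G k` are the weak partial derivatives of `u` on `Ω`, and all of these
functions are square integrable. -/
structure IsRealH1 (Ω : Set Plane) (u : Plane → ℝ) (G : Fin 2 → Plane → ℝ) : Prop where
  memLp : MemLp u 2 (volume.restrict Ω)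
  memLp_grad : ∀ k, MemLp (G k) 2 (volume.restrict Ω)
  integral_eq : ∀ (k : Fin 2) (φ : Plane → ℝ), ContDiff ℝ ∞ φ → HasCompactSupport φ →
    tsupport φ ⊆ Ω → ∫ x in Ω, partialDeriv k φ x * u x = -∫ x in Ω, φ x * G k x

/-- The kernels are chosen before `f`, so one sequence serves a function and its weak derivatives
simultaneously. -/
theorem exists_mollifier_seq {N : Plane → Plane} (hN1 : ∀ x, ‖N x‖ ≤ 1)
    {δ ε₀ : ℝ} (hδ : 0 < δ) (hδ1 : δ ≤ 1) (hε₀ : 0 < ε₀) :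
    ∃ (ε : ℕ → ℝ) (ρ : ℕ → Plane → ℝ), (∀ n, ε n ∈ Ioo 0 ε₀) ∧ Tendsto ε atTop (𝓝 0) ∧
      (∀ n, ContDiff ℝ ∞ (ρ n)) ∧ (∀ n, HasCompactSupport (ρ n)) ∧
      (∀ n y, δ * ε n < ‖y‖ → ρ n y = 0) ∧
      ∀ f : Plane → ℝ, MemLp f 2 volume → Tendsto (fun n => eLpNorm
        (fun x => (∫ t, f t * ρ n (x - ε n • N x - t)) - f x) 2 volume) atTop (𝓝 0) := by
  set ε : ℕ → ℝ := fun n => ε₀ / 2 * (1 / ((n : ℝ) + 1)) with hε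
  have hεpos : ∀ n, 0 < ε n := fun n => by simp only [hε]; positivity
  have hε0 : Tendsto ε atTop (𝓝 0) := by
    simpa [hε] using (tendsto_one_div_add_atTop_nhds_zero_nat (𝕜 := ℝ)).const_mul (ε₀ / 2)
  have hρ := fun n => exists_kernel (r := δ * ε n) (mul_pos hδ (hεpos n))
  choose ρ hρs hρc hρ1 hρ0 hρK using hρ
  refine ⟨ε, ρ, fun n => ⟨hεpos n, ?_⟩, hε0, hρs, hρc, hρ0, fun f hf => ?_⟩
  · have h1 : 1 / ((n : ℝ) + 1) ≤ 1 := by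
      rw [div_le_one (by positivity)]; linarith [n.cast_nonneg (α := ℝ)]
    simp only [hε]; nlinarith
  · rw [ENNReal.tendsto_nhds_zero]
    intro η hη
    rcases eq_or_ne η ⊤ with rfl | hηt
    · exact Eventually.of_forall fun _ => le_top
    set k := ENNReal.ofReal (16 / δ ^ 2) with hk
    have hk0 : k ≠ 0 := by rw [hk, ENNReal.ofReal_ne_zero_iff]; positivity
    have hkt : k ≠ ⊤ := ENNReal.ofReal_ne_top
    have h1 := (ENNReal.tendsto_nhds_zero.1 (tendsto_eLpNorm_translation hf)) (η / k)
      (ENNReal.div_pos hη.ne' hkt)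
    obtain ⟨r, hr, hball⟩ := Metric.eventually_nhds_iff_ball.1 h1
    have h2 : ∀ᶠ n in atTop, ε n < r / 2 := hε0.eventually_lt_const (by positivity)
    filter_upwards [h2] with n hn
    have h3 := mollify_bound hf (ε := ε n) (hρs n).continuous (hρ1 n)
      (fun y hy => hρ0 n y (by nlinarith [hεpos n])) (hρK n) (T := fun x => x - ε n • N x)
      (fun x => by
        rw [sub_sub_cancel_left, norm_neg, norm_smul, Real.norm_of_nonneg (hεpos n).le]
        nlinarith [hN1 x, hεpos n])
      (η := η / k) (fun z hz => hball z (by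
        rw [mem_closedBall_zero_iff] at hz
        rw [mem_ball_zero_iff]; linarith))
    rw [volume_ratio (hεpos n) hδ] at h3
    exact h3.trans_eq (ENNReal.mul_div_cancel hk0 hkt)

/-- The kernel centred at `y` is supported in `Ω` and so is an admissible test function there; the
jump of the zero extension across the boundary is not seen. -/
theorem IsRealH1.mollify_deriv {Ω : Set Plane} (hΩ : IsOpen Ω) {u : Plane → ℝ}
    {G : Fin 2 → Plane → ℝ} (hu : IsRealH1 Ω u G) {ρ : Plane → ℝ} (hρ : ContDiff ℝ ∞ ρ)
    (hρc : HasCompactSupport ρ) {r : ℝ} (hρr : ∀ y, r < ‖y‖ → ρ y = 0) {y : Plane}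
    (hy : Metric.closedBall y r ⊆ Ω) (k : Fin 2) :
    ∫ t, Ω.indicator u t * fderiv ℝ ρ (y - t) (EuclideanSpace.single k 1) =
      ∫ t, Ω.indicator (G k) t * ρ (y - t) := by
  have hcs : HasCompactSupport fun t => ρ (y - t) := hρc.comp_homeomorph (Homeomorph.subLeft y)
  have hsm : ContDiff ℝ ∞ fun t => ρ (y - t) := hρ.comp (contDiff_const.sub contDiff_id)
  have hsub : tsupport (fun t => ρ (y - t)) ⊆ Ω := by
    refine (closure_minimal (fun t ht => ?_) Metric.isClosed_closedBall).trans hy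
    rw [Metric.mem_closedBall, dist_comm, dist_eq_norm]
    by_contra! h
    exact ht (hρr _ h)
  have h1 := hu.integral_eq k _ hsm hcs hsub
  have hd : ∀ t, partialDeriv k (fun t => ρ (y - t)) t =
      -fderiv ℝ ρ (y - t) (EuclideanSpace.single k 1) := fun t => by
    have e1 : HasFDerivAt (fun t : Plane => y - t) (-ContinuousLinearMap.id ℝ Plane) t :=
      (hasFDerivAt_id t).const_sub y
    have e2 := ((hρ.differentiable (by simp) (y - t)).hasFDerivAt).comp t e1
    have e3 : HasFDerivAt (fun t => ρ (y - t)) _ t := e2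
    rw [partialDeriv, e3.fderiv]
    simp
  simp only [hd, neg_mul, integral_neg, neg_inj] at h1
  have e1 : ∀ (v g : Plane → ℝ), ∫ t, Ω.indicator v t * g t = ∫ t in Ω, g t * v t :=
    fun v g => by
      rw [← integral_indicator hΩ.measurableSet]
      congr 1
      funext t
      by_cases ht : t ∈ Ω
      · simp [ht, mul_comm]
      · simp [ht]
  rw [e1, e1]
  exact h1

/-- The approximants are mollifications of the zero extension evaluated at `x - ε N x`. By the chain
rule their derivatives are the same averages of `G k`, minus `ε` times averages weighted by the
bounded derivative of `N`, which vanish in the limit. -/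
theorem IsRealH1.exists_approx {Ω : Set Plane} (hΩ : IsOpen Ω) {u : Plane → ℝ}
    {G : Fin 2 → Plane → ℝ} (hu : IsRealH1 Ω u G) {N : Plane → Plane} (hN : ContDiff ℝ ∞ N)
    (hN1 : ∀ x, ‖N x‖ ≤ 1) {D : ℝ} (hD : ∀ x, ‖fderiv ℝ N x‖ ≤ D) {δ ε₀ : ℝ} (hδ : 0 < δ)
    (hε₀ : 0 < ε₀) (hshift : ∀ ε ∈ Ioo (0 : ℝ) ε₀, ∀ x ∈ Ω,
      Metric.closedBall (x - ε • N x) (δ * ε) ⊆ Ω) :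
    ∃ φ : ℕ → Plane → ℝ, (∀ n, ContDiff ℝ ∞ (φ n)) ∧
      Tendsto (fun n => eLpNorm (fun x => φ n x - u x) 2 (volume.restrict Ω)) atTop (𝓝 0) ∧
      ∀ k, Tendsto (fun n => eLpNorm (fun x => partialDeriv k (φ n) x - G k x) 2
        (volume.restrict Ω)) atTop (𝓝 0) := by
  obtain ⟨ε, ρ, hε, hε0, hρs, hρc, hρ0, hconv⟩ := exists_mollifier_seq hN1
    (δ := min δ 1) (ε₀ := ε₀) (lt_min hδ one_pos) (min_le_right _ _) hε₀
  set S : ℕ → (Plane → ℝ) → Plane → ℝ := fun n f x => ∫ t, f t * ρ n (x - ε n • N x - t) with hS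
  have hf : MemLp (Ω.indicator u) 2 volume := (memLp_indicator_iff_restrict hΩ.measurableSet).2
    hu.memLp
  have hF : ∀ k, MemLp (Ω.indicator (G k)) 2 volume := fun k =>
    (memLp_indicator_iff_restrict hΩ.measurableSet).2 (hu.memLp_grad k)
  have hTs : ∀ n, ContDiff ℝ ∞ fun x => x - ε n • N x := fun n =>
    contDiff_id.sub (hN.const_smul (ε n))
  have hSs : ∀ n f, MemLp f 2 volume → ContDiff ℝ ∞ (S n f) := fun n f hf =>
    (hasFDerivAt_mollify (hf.locallyIntegrable (by norm_num)) (hρs n) (hρc n)).1.comp (hTs n)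
  refine ⟨fun n => S n (Ω.indicator u), fun n => hSs n _ hf, ?_, fun k => ?_⟩
  · refine tendsto_of_tendsto_of_tendsto_of_le_of_le tendsto_const_nhds (hconv _ hf)
      (fun _ => zero_le) fun n => ?_
    refine le_trans (le_of_eq (eLpNorm_congr_ae ?_))
      (eLpNorm_mono_measure _ (Measure.restrict_le_self (s := Ω)))
    filter_upwards [ae_restrict_mem hΩ.measurableSet] with x hx
    simp only [hS, indicator_of_mem hx]
  · have hderiv : ∀ n, ∀ x ∈ Ω, partialDeriv k (S n (Ω.indicator u)) x =
        S n (Ω.indicator (G k)) x - ∑ j, ε n *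
          fderiv ℝ N x (EuclideanSpace.single k 1) j * S n (Ω.indicator (G j)) x := by
      intro n x hx
      obtain ⟨hsm, hder⟩ := hasFDerivAt_mollify (hf.locallyIntegrable (by norm_num)) (hρs n) (hρc n)
      set Cf : Plane → ℝ := fun y => ∫ t, Ω.indicator u t * ρ n (y - t) with hCf
      set y := x - ε n • N x with hy
      have hball : Metric.closedBall y (min δ 1 * ε n) ⊆ Ω :=
        (Metric.closedBall_subset_closedBall
          (mul_le_mul_of_nonneg_right (min_le_left _ _) (hε n).1.le)).trans
          (hshift (ε n) (hε n) x hx)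
      have h1 : ∀ j, fderiv ℝ Cf y (EuclideanSpace.single j 1) = S n (Ω.indicator (G j)) x :=
        fun j => by
          rw [hder]
          exact hu.mollify_deriv hΩ (hρs n) (hρc n) (hρ0 n) hball j
      have h2 : HasFDerivAt (fun x => x - ε n • N x)
          (ContinuousLinearMap.id ℝ Plane - ε n • fderiv ℝ N x) x :=
        (hasFDerivAt_id x).sub ((hN.differentiable (by simp) x).hasFDerivAt.const_smul (ε n))
      have h3 : HasFDerivAt (S n (Ω.indicator u))
          ((fderiv ℝ Cf y).comp (ContinuousLinearMap.id ℝ Plane - ε n • fderiv ℝ N x)) x :=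
        HasFDerivAt.comp (g := Cf) (f := fun x => x - ε n • N x) x
          (hsm.differentiable (by simp) y).hasFDerivAt h2
      rw [partialDeriv, h3.fderiv]
      simp only [ContinuousLinearMap.comp_apply, sub_apply,
        ContinuousLinearMap.id_apply, smul_apply, map_sub, map_smul, h1]
      set v := fderiv ℝ N x (EuclideanSpace.single k 1)
      have h4 : fderiv ℝ Cf y v = v 0 * S n (Ω.indicator (G 0)) x +
          v 1 * S n (Ω.indicator (G 1)) x := by
        conv_lhs => rw [eq_sum_single v]
        simp only [map_add, map_smul, h1, smul_eq_mul]
      rw [h4, Fin.sum_univ_two, smul_eq_mul]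
      ring
    set E : ℕ → Fin 2 → ENNReal := fun n j => eLpNorm
        (fun x => S n (Ω.indicator (G j)) x - Ω.indicator (G j) x) 2 volume with hE
    have hE0 : ∀ j, Tendsto (fun n => E n j) atTop (𝓝 0) := fun j => hconv _ (hF j)
    have hlim : Tendsto (fun n => E n k + ∑ j, ENNReal.ofReal (ε n * D) *
        (E n j + eLpNorm (Ω.indicator (G j)) 2 volume)) atTop (𝓝 0) := by
      have h1 : Tendsto (fun n => ENNReal.ofReal (ε n * D)) atTop (𝓝 0) := by
        have := ENNReal.tendsto_ofReal (hε0.mul_const D)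
        simpa using this
      have h2 : ∀ j, Tendsto (fun n => ENNReal.ofReal (ε n * D) *
          (E n j + eLpNorm (Ω.indicator (G j)) 2 volume)) atTop (𝓝 0) := fun j => by
        have h3 := (hE0 j).add_const (eLpNorm (Ω.indicator (G j)) 2 volume)
        rw [zero_add] at h3
        have h4 := ENNReal.Tendsto.mul h1 (Or.inr (hF j).2.ne) h3 (Or.inr ENNReal.zero_ne_top)
        rwa [zero_mul] at h4
      have h3 := (hE0 k).add (tendsto_finsetSum Finset.univ fun j _ => h2 j)
      simpa using h3
    refine tendsto_of_tendsto_of_tendsto_of_le_of_le tendsto_const_nhds hlim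
      (fun _ => zero_le) fun n => ?_
    have hSm : ∀ j, AEStronglyMeasurable (S n (Ω.indicator (G j))) volume := fun j =>
      (hSs n _ (hF j)).continuous.aestronglyMeasurable
    have hcN : ∀ j, Continuous fun x => fderiv ℝ N x (EuclideanSpace.single k 1) j := fun j =>
      (EuclideanSpace.proj j : Plane →L[ℝ] ℝ).continuous.comp
        ((hN.continuous_fderiv (by simp)).clm_apply continuous_const)
    set A : Plane → ℝ := fun x => S n (Ω.indicator (G k)) x - Ω.indicator (G k) x with hA
    set Bj : Fin 2 → Plane → ℝ := fun j x => ε n *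
      fderiv ℝ N x (EuclideanSpace.single k 1) j * S n (Ω.indicator (G j)) x with hBj
    have hBm : ∀ j, AEStronglyMeasurable (Bj j) volume := fun j =>
      ((continuous_const.mul (hcN j)).aestronglyMeasurable).mul (hSm j)
    have hAm : AEStronglyMeasurable A volume := (hSm k).sub (hF k).1
    calc eLpNorm (fun x => partialDeriv k (S n (Ω.indicator u)) x - G k x) 2 (volume.restrict Ω)
        = eLpNorm (A - ∑ j, Bj j) 2 (volume.restrict Ω) := by
          refine eLpNorm_congr_ae ?_
          filter_upwards [ae_restrict_mem hΩ.measurableSet] with x hx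
          rw [hderiv n x hx]
          simp only [hA, hBj, Pi.sub_apply, Finset.sum_apply, indicator_of_mem hx]
          ring
      _ ≤ eLpNorm (A - ∑ j, Bj j) 2 volume := eLpNorm_mono_measure _ Measure.restrict_le_self
      _ ≤ eLpNorm A 2 volume + eLpNorm (∑ j, Bj j) 2 volume :=
          eLpNorm_sub_le hAm (Finset.aestronglyMeasurable_sum _ fun j _ => hBm j) (by norm_num)
      _ ≤ E n k + ∑ j, eLpNorm (Bj j) 2 volume := by
          gcongr
          exact eLpNorm_sum_le (fun j _ => hBm j) (by norm_num)
      _ ≤ _ := by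
          gcongr with j
          calc eLpNorm (Bj j) 2 volume
              ≤ ENNReal.ofReal (ε n * D) * eLpNorm (S n (Ω.indicator (G j))) 2 volume := by
                refine eLpNorm_le_mul_eLpNorm_of_ae_le_mul (Eventually.of_forall fun x => ?_) 2
                simp only [hBj]
                rw [norm_mul, norm_mul, Real.norm_of_nonneg (hε n).1.le]
                gcongr
                · exact (hε n).1.le
                · refine (PiLp.norm_apply_le _ j).trans (((fderiv ℝ N x).le_opNorm _).trans ?_)
                  simpa using hD x
            _ ≤ _ := by
                gcongr
                have : S n (Ω.indicator (G j)) = (fun x => S n (Ω.indicator (G j)) x -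
                    Ω.indicator (G j) x) + Ω.indicator (G j) := by
                  funext x; simp
                conv_lhs => rw [this]
                exact eLpNorm_add_le ((hSm j).sub (hF j).1) (hF j).1 (by norm_num)

/-! ### Fields without flux through the boundary -/

theorem partialDeriv_mul {f g : Plane → ℝ} {x : Plane} (hf : DifferentiableAt ℝ f x)
    (hg : DifferentiableAt ℝ g x) (k : Fin 2) :
    partialDeriv k (fun y => f y * g y) x =
      partialDeriv k f x * g x + f x * partialDeriv k g x := by
  have h : HasFDerivAt (fun y => f y * g y) _ x := hf.hasFDerivAt.mul hg.hasFDerivAt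
  rw [partialDeriv, h.fderiv]
  simp [partialDeriv]; ring

theorem contDiff_partialDeriv {f : Plane → ℝ} (hf : ContDiff ℝ ∞ f) (k : Fin 2) :
    ContDiff ℝ ∞ (partialDeriv k f) :=
  (hf.fderiv_right (m := ∞) (by simp)).clm_apply contDiff_const

theorem MemLp.bdd_mul_of_continuous {Ω : Set Plane} {g f : Plane → ℝ} (hg : Continuous g) {c : ℝ}
    (hc : ∀ x, |g x| ≤ c) (hf : MemLp f 2 (volume.restrict Ω)) :
    MemLp (fun x => g x * f x) 2 (volume.restrict Ω) :=
  hf.of_le_mul (hg.aestronglyMeasurable.mul hf.1) (c := c) (Eventually.of_forall fun x => by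
    rw [norm_mul]
    exact mul_le_mul_of_nonneg_right (hc x) (norm_nonneg _))

theorem tendsto_integral_mul {μ : Measure Plane} {ψ : ℕ → Plane → ℝ} {ψ₀ g : Plane → ℝ}
    (hψ : ∀ᶠ n in atTop, MemLp (ψ n) 2 μ) (hψ₀ : MemLp ψ₀ 2 μ) (hg : MemLp g 2 μ)
    (h : Tendsto (fun n => eLpNorm (fun x => ψ n x - ψ₀ x) 2 μ) atTop (𝓝 0)) :
    Tendsto (fun n => ∫ x, ψ n x * g x ∂μ) atTop (𝓝 (∫ x, ψ₀ x * g x ∂μ)) := by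
  refine tendsto_integral_of_L1' _ (hψ₀.integrable_mul hg).1
    (hψ.mono fun n hn => hn.integrable_mul hg) ?_
  have h1 := ENNReal.Tendsto.mul_const h (b := eLpNorm g 2 μ) (Or.inr hg.2.ne)
  rw [zero_mul] at h1
  refine tendsto_of_tendsto_of_tendsto_of_le_of_le' tendsto_const_nhds h1
    (Eventually.of_forall fun _ => zero_le) (hψ.mono fun n hn => ?_)
  have h2 := eLpNorm_smul_le_mul_eLpNorm (p := 2) (q := 2) (r := 1) hg.1 (hn.sub hψ₀).1
  refine le_trans (le_of_eq ?_) h2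
  congr 1
  funext x
  simp [sub_mul]

theorem exists_cutoff : ∃ C : ℝ, ∃ θ : ℕ → Plane → ℝ, (∀ n, ContDiff ℝ ∞ (θ n)) ∧
    (∀ n, HasCompactSupport (θ n)) ∧ (∀ n x, |θ n x| ≤ 1) ∧
    (∀ n k x, |partialDeriv k (θ n) x| ≤ C) ∧
    ∀ x, ∀ᶠ n in atTop, θ n x = 1 ∧ ∀ k, partialDeriv k (θ n) x = 0 := by
  set β : ContDiffBump (0 : Plane) := ⟨1, 2, by norm_num, by norm_num⟩ with hβ
  have hβs : ContDiff ℝ ∞ β := β.contDiff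
  obtain ⟨C, hC⟩ := (hβs.continuous_fderiv (by simp)).bounded_above_of_compact_support
    (β.hasCompactSupport.fderiv ℝ)
  have hC0 : 0 ≤ C := (norm_nonneg _).trans (hC 0)
  set c : ℕ → ℝ := fun n => 1 / ((n : ℝ) + 1) with hc
  have hc0 : ∀ n, 0 < c n := fun n => by simp only [hc]; positivity
  have hc1 : ∀ n, c n ≤ 1 := fun n => by
    simp only [hc]; rw [div_le_one (by positivity)]; linarith [n.cast_nonneg (α := ℝ)]
  have hd : ∀ n k x, partialDeriv k (fun x => β (c n • x)) x =
      c n * fderiv ℝ β (c n • x) (EuclideanSpace.single k 1) := fun n k x => by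
    have h1 : HasFDerivAt (fun x : Plane => c n • x) (c n • ContinuousLinearMap.id ℝ Plane) x :=
      (hasFDerivAt_id x).const_smul (c n)
    have h2 : HasFDerivAt (fun x : Plane => β (c n • x)) _ x :=
      HasFDerivAt.comp (g := β) x (hβs.differentiable (by simp) _).hasFDerivAt h1
    rw [partialDeriv, h2.fderiv]
    simp
  refine ⟨C, fun n x => β (c n • x), fun n => hβs.comp (contDiff_id.const_smul (c n)),
    fun n => β.hasCompactSupport.comp_homeomorph (Homeomorph.smulOfNeZero (c n) (hc0 n).ne'),
    fun n x => ?_, fun n k x => ?_, fun x => ?_⟩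
  · rw [abs_of_nonneg β.nonneg]; exact β.le_one
  · rw [hd, abs_mul, abs_of_pos (hc0 n), ← one_mul C]
    refine mul_le_mul (hc1 n) ?_ (abs_nonneg _) zero_le_one
    refine ((fderiv ℝ β _).le_opNorm _).trans ?_
    simpa using hC (c n • x)
  · obtain ⟨n₀, hn₀⟩ := exists_nat_gt ‖x‖
    filter_upwards [eventually_ge_atTop n₀] with n hn
    have hx : c n • x ∈ Metric.ball (0 : Plane) β.rIn := by
      rw [mem_ball_zero_iff, norm_smul, Real.norm_of_nonneg (hc0 n).le]
      show c n * ‖x‖ < 1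
      simp only [hc]
      rw [one_div_mul_eq_div, div_lt_one (by positivity)]
      have : (n₀ : ℝ) ≤ n := by exact_mod_cast hn
      linarith
    refine ⟨β.one_of_mem_closedBall (Metric.ball_subset_closedBall hx), fun k => ?_⟩
    rw [hd, (β.eventuallyEq_one_of_mem_ball hx).fderiv_eq]
    simp

section Flux

variable {Ω : Set Plane} {F : Fin 2 → Plane → ℝ} {D : Plane → ℝ}

/-- As `Ω` may be unbounded, the `H¹` approximants need not have compact support. The slowly varying
cutoffs of `exists_cutoff` remove that condition by dominated convergence. -/
theorem flux_of_memLp (hF : ∀ k, MemLp (F k) 2 (volume.restrict Ω))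
    (hD : MemLp D 2 (volume.restrict Ω))
    (hflux : ∀ φ : Plane → ℝ, ContDiff ℝ ∞ φ → HasCompactSupport φ →
      ∫ x in Ω, (∑ k, partialDeriv k φ x * F k x + φ x * D x) = 0)
    {φ : Plane → ℝ} (hφ : ContDiff ℝ ∞ φ) (hφ2 : MemLp φ 2 (volume.restrict Ω))
    (hφd : ∀ k, MemLp (partialDeriv k φ) 2 (volume.restrict Ω)) :
    ∫ x in Ω, (∑ k, partialDeriv k φ x * F k x + φ x * D x) = 0 := by
  obtain ⟨C, θ, hθs, hθc, hθ1, hθd, hθe⟩ := exists_cutoff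
  have hd : ∀ n k x, partialDeriv k (fun y => φ y * θ n y) x =
      partialDeriv k φ x * θ n x + φ x * partialDeriv k (θ n) x := fun n k x =>
    partialDeriv_mul (hφ.differentiable (by simp) x) ((hθs n).differentiable (by simp) x) k
  have h0 : ∀ n, ∫ x in Ω, (∑ k, partialDeriv k (fun y => φ y * θ n y) x * F k x +
      φ x * θ n x * D x) = 0 := fun n => hflux _ (hφ.mul (hθs n)) (hθc n).mul_left
  have hlim : Tendsto (fun n => ∫ x in Ω, (∑ k, partialDeriv k (fun y => φ y * θ n y) x * F k x +
      φ x * θ n x * D x)) atTop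
      (𝓝 (∫ x in Ω, (∑ k, partialDeriv k φ x * F k x + φ x * D x))) := by
    refine tendsto_integral_of_dominated_convergence (fun x => ∑ k, (|partialDeriv k φ x * F k x| +
      C * |φ x * F k x|) + |φ x * D x|) (fun n => ?_) ?_ (fun n => ?_) ?_
    · refine AEStronglyMeasurable.add (Finset.aestronglyMeasurable_fun_sum _ fun k _ => ?_) ?_
      · exact (contDiff_partialDeriv (hφ.mul (hθs n)) k).continuous.aestronglyMeasurable.mul (hF k).1
      · exact (hφ.mul (hθs n)).continuous.aestronglyMeasurable.mul hD.1
    · refine Integrable.add (integrable_finsetSum _ fun k _ => ?_) (hφ2.integrable_mul hD).abs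
      exact ((hφd k).integrable_mul (hF k)).abs.add ((hφ2.integrable_mul (hF k)).abs.const_mul C)
    · refine Eventually.of_forall fun x => ?_
      rw [Real.norm_eq_abs]
      refine (abs_add_le _ _).trans (add_le_add ((Finset.abs_sum_le_sum_abs _ _).trans
        (Finset.sum_le_sum fun k _ => ?_)) ?_)
      · rw [hd, add_mul]
        refine (abs_add_le _ _).trans (add_le_add ?_ ?_)
        · rw [mul_right_comm, abs_mul]
          exact mul_le_of_le_one_right (abs_nonneg _) (hθ1 n x)
        · rw [mul_right_comm, abs_mul, mul_comm]
          exact mul_le_mul_of_nonneg_right (hθd n k x) (abs_nonneg _)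
      · rw [mul_right_comm, abs_mul]
        exact mul_le_of_le_one_right (abs_nonneg _) (hθ1 n x)
    · refine Eventually.of_forall fun x => ?_
      refine tendsto_const_nhds.congr' ?_
      filter_upwards [hθe x] with n hn
      simp [hd, hn.1, hn.2]
  exact tendsto_nhds_unique hlim (by simp only [h0]; exact tendsto_const_nhds)

/-- For fixed `F` and `D` the expression is linear in the pair `(u, G)`, with coefficients in `L²`,
so it passes to the limit from the admissible test functions `w * φ n`. No trace of `u²` is needed.
-/
theorem flux_mul_of_approx {u : Plane → ℝ} {G : Fin 2 → Plane → ℝ} (hu : IsRealH1 Ω u G)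
    (hF : ∀ k, MemLp (F k) 2 (volume.restrict Ω)) (hD : MemLp D 2 (volume.restrict Ω))
    (hflux : ∀ φ : Plane → ℝ, ContDiff ℝ ∞ φ → HasCompactSupport φ →
      ∫ x in Ω, (∑ k, partialDeriv k φ x * F k x + φ x * D x) = 0)
    {φ : ℕ → Plane → ℝ} (hφ : ∀ n, ContDiff ℝ ∞ (φ n))
    (hφu : Tendsto (fun n => eLpNorm (fun x => φ n x - u x) 2 (volume.restrict Ω)) atTop (𝓝 0))
    (hφG : ∀ k, Tendsto (fun n => eLpNorm (fun x => partialDeriv k (φ n) x - G k x) 2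
        (volume.restrict Ω)) atTop (𝓝 0))
    {w : Plane → ℝ} (hw : ContDiff ℝ ∞ w) {c : ℝ} (hwc : ∀ x, |w x| ≤ c)
    (hwd : ∀ k x, |partialDeriv k w x| ≤ c) :
    ∫ x in Ω, (∑ k, (partialDeriv k w x * u x + w x * G k x) * F k x + w x * u x * D x) = 0 := by
  set μ := volume.restrict Ω
  have hmem : ∀ {ψ : ℕ → Plane → ℝ} {ψ₀ : Plane → ℝ}, (∀ n, Continuous (ψ n)) → MemLp ψ₀ 2 μ →
      Tendsto (fun n => eLpNorm (fun x => ψ n x - ψ₀ x) 2 μ) atTop (𝓝 0) →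
      ∀ᶠ n in atTop, MemLp (ψ n) 2 μ := by
    intro ψ ψ₀ hψ hψ₀ ht
    filter_upwards [ht.eventually_lt_const (ENNReal.zero_lt_top)] with n hn
    have h1 : MemLp (fun x => ψ n x - ψ₀ x) 2 μ :=
      ⟨(hψ n).aestronglyMeasurable.sub hψ₀.1, hn⟩
    have h2 := h1.add hψ₀
    refine (memLp_congr_ae (Eventually.of_forall fun x => ?_)).1 h2
    simp
  have hwdc : ∀ k, Continuous (partialDeriv k w) := fun k => (contDiff_partialDeriv hw k).continuous
  have e1 := hmem (fun n => (hφ n).continuous) hu.memLp hφu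
  have e2 := fun k => hmem (fun n => (contDiff_partialDeriv (hφ n) k).continuous)
    (hu.memLp_grad k) (hφG k)
  have hwF : ∀ k, MemLp (fun x => partialDeriv k w x * F k x) 2 μ := fun k =>
    MemLp.bdd_mul_of_continuous (hwdc k) (hwd k) (hF k)
  have hwF' : ∀ k, MemLp (fun x => w x * F k x) 2 μ := fun k =>
    MemLp.bdd_mul_of_continuous hw.continuous hwc (hF k)
  have hwD : MemLp (fun x => w x * D x) 2 μ :=
    MemLp.bdd_mul_of_continuous hw.continuous hwc hD
  have hsplit : ∀ (f : Plane → ℝ) (g : Fin 2 → Plane → ℝ), MemLp f 2 μ → (∀ k, MemLp (g k) 2 μ) →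
      ∫ x, (∑ k, (partialDeriv k w x * f x + w x * g k x) * F k x + w x * f x * D x) ∂μ =
      ∑ k, (∫ x, f x * (partialDeriv k w x * F k x) ∂μ + ∫ x, g k x * (w x * F k x) ∂μ) +
        ∫ x, f x * (w x * D x) ∂μ := by
    intro f g hf hg
    have i1 : ∀ k, Integrable (fun x => f x * (partialDeriv k w x * F k x)) μ :=
      fun k => hf.integrable_mul (hwF k)
    have i2 : ∀ k, Integrable (fun x => g k x * (w x * F k x)) μ :=
      fun k => (hg k).integrable_mul (hwF' k)
    have i3 : Integrable (fun x => f x * (w x * D x)) μ := hf.integrable_mul hwD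
    have i12 : ∀ k, Integrable
        (fun x => f x * (partialDeriv k w x * F k x) + g k x * (w x * F k x)) μ :=
      fun k => (i1 k).add (i2 k)
    have s1 : ∀ k, ∫ x, f x * (partialDeriv k w x * F k x) ∂μ + ∫ x, g k x * (w x * F k x) ∂μ =
        ∫ x, (f x * (partialDeriv k w x * F k x) + g k x * (w x * F k x)) ∂μ :=
      fun k => (integral_add (i1 k) (i2 k)).symm
    rw [Finset.sum_congr rfl fun k _ => s1 k,
      ← integral_finsetSum _ fun k _ => i12 k,
      ← integral_add (integrable_finsetSum _ fun k _ => i12 k) i3]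
    refine integral_congr_ae (Eventually.of_forall fun x => ?_)
    simp only [Fin.sum_univ_two]
    ring
  rw [hsplit u G hu.memLp hu.memLp_grad]
  have hlim : Tendsto (fun n => ∑ k, (∫ x, φ n x * (partialDeriv k w x * F k x) ∂μ +
      ∫ x, partialDeriv k (φ n) x * (w x * F k x) ∂μ) + ∫ x, φ n x * (w x * D x) ∂μ) atTop
      (𝓝 (∑ k, (∫ x, u x * (partialDeriv k w x * F k x) ∂μ + ∫ x, G k x * (w x * F k x) ∂μ) +
        ∫ x, u x * (w x * D x) ∂μ)) :=
    (tendsto_finsetSum _ fun k _ => (tendsto_integral_mul e1 hu.memLp (hwF k) hφu).add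
      (tendsto_integral_mul (e2 k) (hu.memLp_grad k) (hwF' k) (hφG k))).add
      (tendsto_integral_mul e1 hu.memLp hwD hφu)
  refine tendsto_nhds_unique hlim (tendsto_const_nhds.congr' ?_)
  filter_upwards [e1, eventually_all.2 e2] with n hn1 hn2
  rw [← hsplit (φ n) (fun k => partialDeriv k (φ n)) hn1 hn2]
  have hd : ∀ k x, partialDeriv k (fun y => w y * φ n y) x =
      partialDeriv k w x * φ n x + w x * partialDeriv k (φ n) x := fun k x =>
    partialDeriv_mul (hw.differentiable (by simp) x) ((hφ n).differentiable (by simp) x) k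
  have := flux_of_memLp hF hD hflux (hw.mul (hφ n))
    (MemLp.bdd_mul_of_continuous hw.continuous hwc hn1) (fun k => by
      have h1 := (MemLp.bdd_mul_of_continuous (hwdc k) (hwd k) hn1).add
        (MemLp.bdd_mul_of_continuous hw.continuous hwc (hn2 k))
      refine (memLp_congr_ae (Eventually.of_forall fun x => ?_)).1 h1
      exact (hd k x).symm)
  simp only [hd] at this
  exact this.symm

end Flux

/-! ### The weak form of the Robin eigenvalue problem -/

theorem integrable_smul_of_hasCompactSupport {Ω : Set Plane} {ψ : Plane → ℝ} {f : Plane → ℂ}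
    (hψ : Continuous ψ) (hψc : HasCompactSupport ψ) (hf : MemLp f 2 (volume.restrict Ω)) :
    Integrable (fun x => ψ x • f x) (volume.restrict Ω) :=
  (hf.locallyIntegrable (by norm_num)).integrable_smul_left_of_hasCompactSupport hψ hψc

theorem integrable_boundary_smul {ψ : ℝ → ℝ} {f : ℝ → ℂ} {l : ℝ} (hψ : Continuous ψ)
    (hf : MemLp f 2 (volume.restrict (Ioc 0 l))) :
    Integrable (fun s => ψ s • f s) (volume.restrict (Ioc 0 l)) := by
  have h1 : Integrable f (volume.restrict (Ioc 0 l)) := hf.integrable (by norm_num)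
  obtain ⟨c, hc⟩ := (isCompact_Icc (a := (0 : ℝ)) (b := l)).exists_bound_of_continuousOn
    hψ.continuousOn
  refine (h1.norm.const_mul c).mono' (hψ.aestronglyMeasurable.smul h1.1) ?_
  filter_upwards [ae_restrict_mem measurableSet_Ioc] with s hs
  rw [norm_smul]
  exact mul_le_mul_of_nonneg_right (hc s (Ioc_subset_Icc_self hs)) (norm_nonneg _)

theorem hasCompactSupport_partialDeriv {φ : Plane → ℝ} (h : HasCompactSupport φ) (k : Fin 2) :
    HasCompactSupport (partialDeriv k φ) :=
  (h.fderiv ℝ).comp_left (g := fun A : Plane →L[ℝ] ℝ => A (EuclideanSpace.single k 1)) (by simp)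

theorem contDiff_coord {N : Plane → Plane} (hN : ContDiff ℝ ∞ N) (k : Fin 2) :
    ContDiff ℝ ∞ fun x => N x k :=
  (EuclideanSpace.proj k : Plane →L[ℝ] ℝ).contDiff.comp hN

/-- Green's formula, applied to each `G j` with `φ` and to `u` with `φ N k`, produces the boundary
density `φ (h^(1/2) ∂_ν u - (N · ν) u)`. It vanishes since `N · ν = 1` and by the Robin condition.
-/
theorem InRobinDomain.flux_eq_zero {Ω : Set Plane} {m : ℕ} {L : Fin m → ℝ}
    {γ : Fin m → ℝ → Plane} (hγ : IsArcLengthBoundary Ω L γ) {h : ℝ} {u : Plane → ℂ}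
    {G : Fin 2 → Plane → ℂ} {H : Fin 2 → Fin 2 → Plane → ℂ} (hu : InRobinDomain Ω L γ h u G H)
    {N : Plane → Plane} (hN : ContDiff ℝ ∞ N) (hNν : ∀ i s, N (γ i s) = outwardNormal (γ i) s)
    {φ : Plane → ℝ} (hφ : ContDiff ℝ ∞ φ) (hφc : HasCompactSupport φ) :
    ∫ x in Ω, (∑ k, partialDeriv k φ x • (h ^ (1 / 2 : ℝ) • G k x - N x k • u x) +
      φ x • (h ^ (1 / 2 : ℝ) • ∑ j, H j j x - divg N x • u x - ∑ k, N x k • G k x)) = 0 := by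
  obtain ⟨g, dg, hg, hdg, hrobin⟩ := hu.robin
  set a := h ^ (1 / 2 : ℝ)
  have hNk := contDiff_coord hN
  have hφN : ∀ k, ContDiff ℝ ∞ fun x => φ x * N x k := fun k => hφ.mul (hNk k)
  have hφNc : ∀ k, HasCompactSupport fun x => φ x * N x k := fun k => hφc.mul_right
  have hd : ∀ k x, partialDeriv k (fun x => φ x * N x k) x =
      partialDeriv k φ x * N x k + φ x * partialDeriv k (fun x => N x k) x := fun k x =>
    partialDeriv_mul (hφ.differentiable (by simp) x) ((hNk k).differentiable (by simp) x) k
  have E1 := fun j => (hdg j).green j φ hφ hφc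
  have E2 := fun k => hg.green k _ (hφN k) (hφNc k)
  have I1 : ∀ j, Integrable (fun x => partialDeriv j φ x • G j x + φ x • H j j x)
      (volume.restrict Ω) := fun j =>
    (integrable_smul_of_hasCompactSupport (contDiff_partialDeriv hφ j).continuous
      (hasCompactSupport_partialDeriv hφc j) (hu.isH1_grad j).memLp).add
    (integrable_smul_of_hasCompactSupport hφ.continuous hφc ((hu.isH1_grad j).memLp_grad j))
  have I2 : ∀ k, Integrable (fun x => partialDeriv k (fun x => φ x * N x k) x • u x +
      (φ x * N x k) • G k x) (volume.restrict Ω) := fun k =>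
    (integrable_smul_of_hasCompactSupport (contDiff_partialDeriv (hφN k) k).continuous
      (hasCompactSupport_partialDeriv (hφNc k) k) hu.isH1.memLp).add
    (integrable_smul_of_hasCompactSupport (hφN k).continuous (hφNc k) (hu.isH1.memLp_grad k))
  have e0 : ∫ x in Ω, (∑ k, partialDeriv k φ x • (a • G k x - N x k • u x) +
      φ x • (a • ∑ j, H j j x - divg N x • u x - ∑ k, N x k • G k x)) =
      a • ∑ j, (∫ x in Ω, (partialDeriv j φ x • G j x + φ x • H j j x)) -
      ∑ k, ∫ x in Ω, (partialDeriv k (fun x => φ x * N x k) x • u x + (φ x * N x k) • G k x) := by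
    rw [← integral_finsetSum _ fun j _ => I1 j, ← integral_finsetSum _ fun j _ => I2 j,
      ← integral_smul]
    have I1s : Integrable (fun x => a • ∑ j, (partialDeriv j φ x • G j x + φ x • H j j x))
      (volume.restrict Ω) := (integrable_finsetSum _ fun j _ => I1 j).smul a
    rw [← integral_sub I1s (integrable_finsetSum _ fun j _ => I2 j)]
    refine integral_congr_ae (Eventually.of_forall fun x => ?_)
    simp only [hd, divg, Fin.sum_univ_two]
    module
  rw [e0]
  simp only [E1, E2]
  have J1 : ∀ j i, Integrable (fun s => (φ (γ i s) * outwardNormal (γ i) s j) • dg j i s)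
      (volume.restrict (Ioc 0 (L i))) := fun j i =>
    integrable_boundary_smul ((hφ.continuous.comp (hγ.continuous i)).mul
      ((EuclideanSpace.proj j : Plane →L[ℝ] ℝ).continuous.comp
        (contDiff_outwardNormal (hγ.smooth i)).continuous)) ((hdg j).memLp i)
  have J2 : ∀ k i, Integrable (fun s => (φ (γ i s) * N (γ i s) k * outwardNormal (γ i) s k) • g i s)
      (volume.restrict (Ioc 0 (L i))) := fun k i =>
    integrable_boundary_smul (((hφN k).continuous.comp (hγ.continuous i)).mul
      ((EuclideanSpace.proj k : Plane →L[ℝ] ℝ).continuous.comp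
        (contDiff_outwardNormal (hγ.smooth i)).continuous)) (hg.memLp i)
  rw [Finset.sum_comm, Finset.sum_comm (f := fun k i => ∫ s in Ioc 0 (L i),
    (φ (γ i s) * N (γ i s) k * outwardNormal (γ i) s k) • g i s), Finset.smul_sum,
    ← Finset.sum_sub_distrib]
  refine Finset.sum_eq_zero fun i _ => ?_
  rw [← integral_finsetSum _ fun j _ => J1 j i, ← integral_finsetSum _ fun j _ => J2 j i,
    ← integral_smul]
  have J1s : Integrable (fun s => a • ∑ j, (φ (γ i s) * outwardNormal (γ i) s j) • dg j i s)
      (volume.restrict (Ioc 0 (L i))) := (integrable_finsetSum _ fun j _ => J1 j i).smul a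
  rw [← integral_sub J1s (integrable_finsetSum _ fun j _ => J2 j i)]
  rw [← integral_zero ℝ ℂ (μ := volume.restrict (Ioc 0 (L i)))]
  refine integral_congr_ae ?_
  filter_upwards [hrobin i] with s hs
  have hn : outwardNormal (γ i) s 0 ^ 2 + outwardNormal (γ i) s 1 ^ 2 = 1 := by
    rw [← norm_sq_eq, hγ.norm_normal]; norm_num
  have hs2 : g i s = ∑ j, outwardNormal (γ i) s j • (a • dg j i s) := (sub_eq_zero.1 hs).symm
  simp only [hNν, Fin.sum_univ_two] at hs2 ⊢
  have h2 : (φ (γ i s) * outwardNormal (γ i) s 0 * outwardNormal (γ i) s 0) • g i s +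
      (φ (γ i s) * outwardNormal (γ i) s 1 * outwardNormal (γ i) s 1) • g i s =
      φ (γ i s) • g i s := by
    rw [← add_smul]
    congr 1
    linear_combination φ (γ i s) * hn
  rw [h2, hs2]
  module

/-- The weak form of the eigenvalue equation `-h² Δu = μu` with Robin boundary condition
`a ∂_ν u = u`, where `a = h ^ (1 / 2)`. -/
structure IsWeakRobin (Ω : Set Plane) (N : Plane → Plane) (h μ : ℝ) (u : Plane → ℝ)
    (G : Fin 2 → Plane → ℝ) : Prop extends IsRealH1 Ω u G where
  flux : ∀ φ : Plane → ℝ, ContDiff ℝ ∞ φ → HasCompactSupport φ →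
    ∫ x in Ω, (∑ k, partialDeriv k φ x * (h ^ (1 / 2 : ℝ) * G k x - N x k * u x) +
      φ x * (-(h ^ (1 / 2 : ℝ) * μ / h ^ 2) * u x - divg N x * u x - ∑ k, N x k * G k x)) = 0

/-- The coefficients are real, so any real-linear functional preserves the weak equation. Taking
real and imaginary parts reduces the energy argument to real functions. -/
theorem isWeakRobin_of_eigenfunction {Ω : Set Plane} {m : ℕ} {L : Fin m → ℝ}
    {γ : Fin m → ℝ → Plane} (hγ : IsArcLengthBoundary Ω L γ) {h μ : ℝ} (hh : 0 < h)
    {u : Plane → ℂ} {G : Fin 2 → Plane → ℂ} (hu : IsNormalizedEigenfunction Ω L γ h μ u G)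
    {N : Plane → Plane} (hN : ContDiff ℝ ∞ N) (hNν : ∀ i s, N (γ i s) = outwardNormal (γ i) s)
    (ℓ : ℂ →L[ℝ] ℝ) : IsWeakRobin Ω N h μ (fun x => ℓ (u x)) (fun k x => ℓ (G k x)) := by
  obtain ⟨H, hdom, heig, -⟩ := hu
  have hH : (fun x => ∑ j, H j j x) =ᵐ[volume.restrict Ω] fun x => (-(μ / h ^ 2)) • u x := by
    filter_upwards [heig] with x hx
    have h2 : (h ^ 2 : ℝ) ≠ 0 := by positivity
    rw [neg_eq_iff_eq_neg] at hx
    have h3 : (∑ j, H j j x) = (h ^ 2)⁻¹ • (h ^ 2 • ∑ j, H j j x) := by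
      rw [smul_smul, inv_mul_cancel₀ h2, one_smul]
    rw [h3, hx, smul_neg, smul_smul, neg_smul, div_eq_inv_mul]
  refine ⟨⟨ℓ.comp_memLp' hdom.isH1.memLp, fun k => ℓ.comp_memLp' (hdom.isH1.memLp_grad k), ?_⟩, ?_⟩
  · intro k φ hφ hφc hφΩ
    have h1 := congrArg ℓ (hdom.isH1.integral_eq k φ hφ hφc hφΩ)
    rw [map_neg, ← ℓ.integral_comp_comm (integrable_smul_of_hasCompactSupport
      (contDiff_partialDeriv hφ k).continuous (hasCompactSupport_partialDeriv hφc k)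
      hdom.isH1.memLp), ← ℓ.integral_comp_comm (integrable_smul_of_hasCompactSupport
      hφ.continuous hφc (hdom.isH1.memLp_grad k))] at h1
    simpa only [map_smul, smul_eq_mul] using h1
  · intro φ hφ hφc
    have h1 := hdom.flux_eq_zero hγ hN hNν hφ hφc
    set a := h ^ (1 / 2 : ℝ)
    set f : Plane → ℂ := fun x => ∑ k, partialDeriv k φ x • (a • G k x - N x k • u x) +
      φ x • ((-(a * μ / h ^ 2)) • u x - divg N x • u x - ∑ k, N x k • G k x) with hf
    have h2 : ∫ x in Ω, f x = 0 := by
      rw [← h1]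
      refine integral_congr_ae ?_
      filter_upwards [hH] with x hx
      simp only [hf]
      rw [hx, smul_smul]
      congr 5
      ring
    have hfi : Integrable f (volume.restrict Ω) := by
      have i1 : ∀ (ψ : Plane → ℝ), Continuous ψ → HasCompactSupport ψ →
          Integrable (fun x => ψ x • u x) (volume.restrict Ω) := fun ψ h1 h2 =>
        integrable_smul_of_hasCompactSupport h1 h2 hdom.isH1.memLp
      have i2 : ∀ k (ψ : Plane → ℝ), Continuous ψ → HasCompactSupport ψ →
          Integrable (fun x => ψ x • G k x) (volume.restrict Ω) := fun k ψ h1 h2 =>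
        integrable_smul_of_hasCompactSupport h1 h2 (hdom.isH1.memLp_grad k)
      have hdk := fun k => (contDiff_partialDeriv hφ k).continuous
      have hck := hasCompactSupport_partialDeriv hφc
      have hNk := fun k => (contDiff_coord hN k).continuous
      have hdiv : Continuous (divg N) := continuous_finsetSum _ fun k _ =>
        (contDiff_partialDeriv (contDiff_coord hN k) k).continuous
      have t1 : Integrable (fun x => ∑ k, ((partialDeriv k φ x * a) • G k x -
          (partialDeriv k φ x * N x k) • u x)) (volume.restrict Ω) :=
        integrable_finsetSum _ fun k _ => (i2 k _ ((hdk k).mul continuous_const)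
          (hck k).mul_right).sub (i1 _ ((hdk k).mul (hNk k)) (hck k).mul_right)
      have t2 : Integrable (fun x => (φ x * (-(a * μ / h ^ 2) - divg N x)) • u x)
          (volume.restrict Ω) :=
        i1 _ (hφ.continuous.mul (continuous_const.sub hdiv)) hφc.mul_right
      have t3 : Integrable (fun x => ∑ k, (φ x * N x k) • G k x) (volume.restrict Ω) :=
        integrable_finsetSum _ fun k _ => i2 k _ (hφ.continuous.mul (hNk k)) hφc.mul_right
      refine ((t1.add t2).sub t3).congr (Eventually.of_forall fun x => ?_)
      simp only [hf, Pi.add_apply, Pi.sub_apply, Fin.sum_univ_two]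
      module
    have h3 := ℓ.integral_comp_comm hfi
    rw [h2, map_zero] at h3
    rw [← h3]
    refine integral_congr_ae (Eventually.of_forall fun x => ?_)
    simp only [hf, map_add, map_sub, map_sum, map_smul, smul_eq_mul]

/-! ### The weighted energy estimate -/

theorem norm_sq_eq_sum (v : Plane) : ‖v‖ ^ 2 = ∑ k, v k ^ 2 := by
  rw [norm_sq_eq, Fin.sum_univ_two]

/-- A bounded smooth substitute for the squared distance to `p`. -/
noncomputable def well (p x : Plane) : ℝ := ‖x - p‖ ^ 2 / (1 + ‖x - p‖ ^ 2)

theorem well_nonneg (p x : Plane) : 0 ≤ well p x := by unfold well; positivity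

theorem well_le_one (p x : Plane) : well p x ≤ 1 := by
  unfold well; rw [div_le_one (by positivity)]; linarith

theorem well_le (p x : Plane) : well p x ≤ ‖x - p‖ ^ 2 :=
  div_le_self (sq_nonneg _) (by linarith [sq_nonneg ‖x - p‖])

theorem contDiff_well (p : Plane) : ContDiff ℝ ∞ (well p) := by
  have h : ContDiff ℝ ∞ fun x : Plane => ‖x - p‖ ^ 2 := (contDiff_id.sub contDiff_const).norm_sq ℝ
  exact h.div (contDiff_const.add h) fun x => by positivity

theorem partialDeriv_well (p x : Plane) (k : Fin 2) :
    partialDeriv k (well p) x = 2 * (x k - p k) / (1 + ‖x - p‖ ^ 2) ^ 2 := by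
  have h1 : HasDerivAt (fun t : ℝ => x - p + t • EuclideanSpace.single k (1 : ℝ))
      (EuclideanSpace.single k 1) 0 := by
    simpa using ((hasDerivAt_id (0 : ℝ)).smul_const
      (EuclideanSpace.single k (1 : ℝ) : Plane)).const_add (x - p)
  have h2 := h1.norm_sq
  rw [zero_smul, add_zero] at h2
  have h3 : (inner ℝ (x - p) (EuclideanSpace.single k (1 : ℝ)) : ℝ) = x k - p k := by
    simp [EuclideanSpace.inner_single_right]
  rw [h3] at h2
  have hne : (1 + ‖x - p + (0 : ℝ) • EuclideanSpace.single k (1 : ℝ)‖ ^ 2) ≠ 0 := by positivity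
  have h4 := h2.div (h2.const_add 1) hne
  have h5 : HasDerivAt (fun t : ℝ => x + t • EuclideanSpace.single k (1 : ℝ))
      (EuclideanSpace.single k 1) 0 := by
    simpa using ((hasDerivAt_id (0 : ℝ)).smul_const
      (EuclideanSpace.single k (1 : ℝ) : Plane)).const_add x
  have h6 : HasFDerivAt (well p) (fderiv ℝ (well p) x)
      (x + (0 : ℝ) • EuclideanSpace.single k (1 : ℝ)) := by
    simpa using ((contDiff_well p).differentiable (by simp) x).hasFDerivAt
  have h7 := h6.comp_hasDerivAt 0 h5
  have h8 : (well p ∘ fun t : ℝ => x + t • EuclideanSpace.single k (1 : ℝ)) =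
      ((fun t : ℝ => ‖x - p + t • EuclideanSpace.single k (1 : ℝ)‖ ^ 2) /
        fun t : ℝ => 1 + ‖x - p + t • EuclideanSpace.single k (1 : ℝ)‖ ^ 2) := by
    funext t
    simp only [Function.comp, well, Pi.div_apply]
    rw [add_sub_right_comm]
  rw [h8] at h7
  have h9 := h7.unique h4
  rw [partialDeriv, h9, zero_smul, add_zero]
  congr 1
  ring

/-- This eikonal-type bound lets the cost of the exponential weight be paid by the well itself, also
where the well is saturated. -/
theorem sum_sq_partialDeriv_well_le (p x : Plane) :
    ∑ k, partialDeriv k (well p) x ^ 2 ≤ 4 * well p x := by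
  have h1 : ∑ k, partialDeriv k (well p) x ^ 2 = 4 * ‖x - p‖ ^ 2 / (1 + ‖x - p‖ ^ 2) ^ 4 := by
    simp only [partialDeriv_well, norm_sq_eq (x - p), Fin.sum_univ_two, PiLp.sub_apply, div_pow]
    rw [← add_div]
    congr 1 <;> ring
  rw [h1, well, mul_div_assoc]
  gcongr
  exact le_self_pow₀ (by linarith [sq_nonneg ‖x - p‖]) (by norm_num)

theorem abs_partialDeriv_well_le (p x : Plane) (k : Fin 2) : |partialDeriv k (well p) x| ≤ 2 := by
  refine abs_le_of_sq_le_sq ?_ (by norm_num)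
  have h1 := sum_sq_partialDeriv_well_le p x
  have h2 := Finset.single_le_sum (f := fun k => partialDeriv k (well p) x ^ 2)
    (fun j _ => sq_nonneg _) (Finset.mem_univ k)
  linarith [well_le_one p x]

theorem partialDeriv_const_mul {f : Plane → ℝ} {x : Plane} (hf : DifferentiableAt ℝ f x) (c : ℝ)
    (k : Fin 2) : partialDeriv k (fun y => c * f y) x = c * partialDeriv k f x := by
  have h : HasFDerivAt (fun y => c * f y) _ x := hf.hasFDerivAt.const_mul c
  rw [partialDeriv, h.fderiv]
  simp [partialDeriv]

theorem partialDeriv_exp {f : Plane → ℝ} {x : Plane} (hf : DifferentiableAt ℝ f x) (k : Fin 2) :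
    partialDeriv k (fun y => Real.exp (f y)) x = Real.exp (f x) * partialDeriv k f x := by
  have h : HasFDerivAt (fun y => Real.exp (f y)) _ x := hf.hasFDerivAt.exp
  rw [partialDeriv, h.fderiv]
  simp [partialDeriv]

section Energy

variable {Ω : Set Plane} {u : Plane → ℝ} {G : Fin 2 → Plane → ℝ} {N : Plane → Plane}

/-- The flux identity is tested with `exp(2Φ) u` and multiplied by `τ⁶`. The cross terms are exactly
those of the displayed square, which leaves a zeroth-order potential. -/
theorem IsWeakRobin.energy_identity {τ μ : ℝ} (hτ : 0 < τ)
    (hu : IsWeakRobin Ω N (τ ^ 4) μ u G) (hN : ContDiff ℝ ∞ N) (hN1 : ∀ x, ‖N x‖ ≤ 1)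
    {K : ℝ} (hK : ∀ x, |divg N x| ≤ K)
    {φ : ℕ → Plane → ℝ} (hφ : ∀ n, ContDiff ℝ ∞ (φ n))
    (hφu : Tendsto (fun n => eLpNorm (fun x => φ n x - u x) 2 (volume.restrict Ω)) atTop (𝓝 0))
    (hφG : ∀ k, Tendsto (fun n => eLpNorm (fun x => partialDeriv k (φ n) x - G k x) 2
        (volume.restrict Ω)) atTop (𝓝 0))
    {Φ : Plane → ℝ} (hΦ : ContDiff ℝ ∞ Φ) {c : ℝ} (hΦc : ∀ x, |Φ x| ≤ c)
    (hΦd : ∀ k x, |partialDeriv k Φ x| ≤ c) :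
    ∫ x in Ω, (Real.exp (2 * Φ x) *
      ∑ k, (τ ^ 4 * G k x - τ ^ 2 * (N x k * u x) + τ ^ 4 * (partialDeriv k Φ x * u x)) ^ 2 +
      Real.exp (2 * Φ x) * ((-μ - τ ^ 4 * ‖N x‖ ^ 2 - τ ^ 6 * divg N x -
        τ ^ 8 * ∑ k, partialDeriv k Φ x ^ 2) * u x ^ 2)) = 0 := by
  have hsq : (τ ^ 4 : ℝ) ^ (1 / 2 : ℝ) = τ ^ 2 := by
    rw [← Real.sqrt_eq_rpow, show τ ^ 4 = (τ ^ 2) ^ 2 by ring, Real.sqrt_sq (by positivity)]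
  have hNk : ∀ k, Continuous fun x => N x k := fun k => (contDiff_coord hN k).continuous
  have hNk1 : ∀ k x, |N x k| ≤ 1 := fun k x => (PiLp.norm_apply_le (N x) k).trans (hN1 x)
  have hdiv : Continuous (divg N) := continuous_finsetSum _ fun k _ =>
    (contDiff_partialDeriv (contDiff_coord hN k) k).continuous
  have hF : ∀ k, MemLp (fun x => τ ^ 2 * G k x - N x k * u x) 2 (volume.restrict Ω) := fun k =>
    ((hu.memLp_grad k).const_mul (τ ^ 2)).sub
      (MemLp.bdd_mul_of_continuous (hNk k) (hNk1 k) hu.memLp)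
  have hD : MemLp (fun x => -(τ ^ 2 * μ / (τ ^ 4) ^ 2) * u x - divg N x * u x -
      ∑ k, N x k * G k x) 2 (volume.restrict Ω) :=
    ((hu.memLp.const_mul _).sub (MemLp.bdd_mul_of_continuous hdiv hK hu.memLp)).sub
      (memLp_finsetSum _ fun k _ =>
        MemLp.bdd_mul_of_continuous (hNk k) (hNk1 k) (hu.memLp_grad k))
  have hflux := hu.flux
  rw [hsq] at hflux
  have hdw : ∀ k x, partialDeriv k (fun x => Real.exp (2 * Φ x)) x =
      Real.exp (2 * Φ x) * (2 * partialDeriv k Φ x) := fun k x => by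
    have h1 := hΦ.differentiable (by simp) x
    rw [partialDeriv_exp (h1.const_mul 2), partialDeriv_const_mul h1]
  have hc0 : 0 ≤ c := (abs_nonneg _).trans (hΦc 0)
  have hw1 : ∀ x, Real.exp (2 * Φ x) ≤ Real.exp (2 * c) := fun x =>
    Real.exp_le_exp.2 (by linarith [(abs_le.1 (hΦc x)).2])
  have hmain := flux_mul_of_approx hu.toIsRealH1 hF hD hflux hφ hφu hφG
    (w := fun x => Real.exp (2 * Φ x)) (Real.contDiff_exp.comp (contDiff_const.mul hΦ))
    (c := Real.exp (2 * c) * (1 + 2 * c))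
    (fun x => by
      rw [abs_of_pos (Real.exp_pos _)]
      refine (hw1 x).trans (le_mul_of_one_le_right (Real.exp_pos _).le (by linarith)))
    (fun k x => by
      rw [hdw, abs_mul, abs_of_pos (Real.exp_pos _), abs_mul, abs_of_pos (two_pos)]
      refine mul_le_mul (hw1 x) ?_ (by positivity) (Real.exp_pos _).le
      linarith [hΦd k x])
  rw [← mul_zero (τ ^ 6), ← hmain, ← integral_const_mul]
  refine integral_congr_ae (Eventually.of_forall fun x => ?_)
  simp only [hdw, norm_sq_eq_sum, Fin.sum_univ_two]
  field_simp
  ring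

/-- Absorption of the region where the exponential weight is bounded. -/
theorem exp_absorb {α c C F : ℝ} (hα : 0 ≤ α) (hc : 0 < c) (hC : 0 ≤ C) (hF : 0 ≤ F) :
    Real.exp (2 * (α * F)) - (C + 1) * Real.exp (2 * (α * ((C + 1) / c))) ≤
      Real.exp (2 * (α * F)) * (c * F - C) := by
  -- Where `c F ≥ C + 1` the last factor is at least `1`. Elsewhere it is at least `-C`, and the
  -- weight is at most its value at `F = (C + 1) / c`.
  rcases le_total (C + 1) (c * F) with h | h
  · have h1 := Real.exp_pos (2 * (α * F))
    have h2 := Real.exp_pos (2 * (α * ((C + 1) / c)))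
    nlinarith
  · have h1 : F ≤ (C + 1) / c := by rw [le_div_iff₀ hc]; linarith
    have h2 : Real.exp (2 * (α * F)) ≤ Real.exp (2 * (α * ((C + 1) / c))) :=
      Real.exp_le_exp.2 (by gcongr)
    have h3 := Real.exp_pos (2 * (α * F))
    have h4 : 0 ≤ c * F := by positivity
    nlinarith

/-- With weight exponent `α well / τ`, hypothesis `hP` makes the potential at least `τ⁷ (c well / τ
- C)`. Every term of the resulting inequality for `u` then carries `τ⁷`, so the constants do not
depend on `τ`. -/
theorem IsWeakRobin.energy_estimate {τ μ : ℝ} (hτ : 0 < τ) (hτ1 : τ ≤ 1)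
    (hu : IsWeakRobin Ω N (τ ^ 4) μ u G) (hN : ContDiff ℝ ∞ N) (hN1 : ∀ x, ‖N x‖ ≤ 1)
    {K : ℝ} (hK : ∀ x, |divg N x| ≤ K)
    {φ : ℕ → Plane → ℝ} (hφ : ∀ n, ContDiff ℝ ∞ (φ n))
    (hφu : Tendsto (fun n => eLpNorm (fun x => φ n x - u x) 2 (volume.restrict Ω)) atTop (𝓝 0))
    (hφG : ∀ k, Tendsto (fun n => eLpNorm (fun x => partialDeriv k (φ n) x - G k x) 2
        (volume.restrict Ω)) atTop (𝓝 0))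
    {p : Plane} {α c C : ℝ} (hα : 0 ≤ α) (hc : 0 < c) (hC : 0 ≤ C)
    (hP : ∀ x, τ ^ 6 * (c * well p x) - C * τ ^ 7 ≤ -μ - τ ^ 4 * ‖N x‖ ^ 2 - τ ^ 6 * divg N x -
        τ ^ 6 * (α ^ 2 * ∑ k, partialDeriv k (well p) x ^ 2)) :
    Integrable (fun x => Real.exp (2 * (α * (well p x / τ))) *
        (u x ^ 2 + τ ^ 4 * ∑ k, G k x ^ 2)) (volume.restrict Ω) ∧
    ∫ x in Ω, Real.exp (2 * (α * (well p x / τ))) * (u x ^ 2 + τ ^ 4 * ∑ k, G k x ^ 2) ≤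
      (7 + 12 * α ^ 2) * ((C + 1) * Real.exp (2 * (α * ((C + 1) / c)))) * ∫ x in Ω, u x ^ 2 := by
  set B := (C + 1) * Real.exp (2 * (α * ((C + 1) / c))) with hB
  have hB0 : 0 ≤ B := by positivity
  set w : Plane → ℝ := fun x => Real.exp (2 * (α * (well p x / τ))) with hw
  have hwc : Continuous w := Real.continuous_exp.comp (continuous_const.mul (continuous_const.mul
    ((contDiff_well p).continuous.div_const τ)))
  have hw0 : ∀ x, 0 < w x := fun x => Real.exp_pos _
  have hwb : ∀ x, |w x| ≤ Real.exp (2 * (α * (1 / τ))) := fun x => by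
    rw [abs_of_pos (hw0 x)]
    refine Real.exp_le_exp.2 ?_
    gcongr
    exact well_le_one p x
  set Φ : Plane → ℝ := fun x => α / τ * well p x with hΦ
  have hwΦ : ∀ x, w x = Real.exp (2 * Φ x) := fun x => by
    simp only [hw, hΦ]; congr 2; ring
  have hΦd : ∀ k x, partialDeriv k Φ x = α / τ * partialDeriv k (well p) x := fun k x =>
    partialDeriv_const_mul ((contDiff_well p).differentiable (by simp) x) _ k
  have hατ : 0 ≤ α / τ := by positivity
  have hid := hu.energy_identity hτ hN hN1 hK hφ hφu hφG (Φ := Φ) (c := α / τ * 2)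
    (contDiff_const.mul (contDiff_well p))
    (fun x => by
      simp only [hΦ]
      rw [abs_mul, abs_of_nonneg hατ, abs_of_nonneg (well_nonneg p x)]
      gcongr; linarith [well_le_one p x])
    (fun k x => by
      rw [hΦd, abs_mul, abs_of_nonneg hατ]
      gcongr; exact abs_partialDeriv_well_le p x k)
  set Y : Fin 2 → Plane → ℝ := fun k x =>
    τ ^ 4 * G k x - τ ^ 2 * (N x k * u x) + τ ^ 4 * (partialDeriv k Φ x * u x) with hY
  set P : Plane → ℝ := fun x => -μ - τ ^ 4 * ‖N x‖ ^ 2 - τ ^ 6 * divg N x -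
        τ ^ 8 * ∑ k, partialDeriv k Φ x ^ 2 with hPdef
  have hNk : ∀ k, Continuous fun x => N x k := fun k => (contDiff_coord hN k).continuous
  have hNk1 : ∀ k x, |N x k| ≤ 1 := fun k x => (PiLp.norm_apply_le (N x) k).trans (hN1 x)
  have hdiv : Continuous (divg N) := continuous_finsetSum _ fun k _ =>
    (contDiff_partialDeriv (contDiff_coord hN k) k).continuous
  have hΦc : ∀ k, Continuous (partialDeriv k Φ) := fun k =>
    (contDiff_partialDeriv (contDiff_const.mul (contDiff_well p)) k).continuous
  have hΦb : ∀ k x, |partialDeriv k Φ x| ≤ α / τ * 2 := fun k x => by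
    rw [hΦd, abs_mul, abs_of_nonneg hατ]
    gcongr; exact abs_partialDeriv_well_le p x k
  have hsum : ∀ x, τ ^ 8 * ∑ k, partialDeriv k Φ x ^ 2 =
      τ ^ 6 * (α ^ 2 * ∑ k, partialDeriv k (well p) x ^ 2) := fun x => by
    simp only [hΦd, Fin.sum_univ_two]
    field_simp
  -- integrability
  have int_sq : ∀ {g : Plane → ℝ}, MemLp g 2 (volume.restrict Ω) →
      Integrable (fun x => w x * g x ^ 2) (volume.restrict Ω) := fun {g} hg => by
    have := (MemLp.bdd_mul_of_continuous hwc hwb hg).integrable_mul hg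
    refine this.congr (Eventually.of_forall fun x => ?_)
    simp only [Pi.mul_apply]; ring
  have hYm : ∀ k, MemLp (Y k) 2 (volume.restrict Ω) := fun k =>
    (((hu.memLp_grad k).const_mul _).sub ((MemLp.bdd_mul_of_continuous (hNk k) (hNk1 k)
      hu.memLp).const_mul _)).add ((MemLp.bdd_mul_of_continuous (hΦc k) (hΦb k)
      hu.memLp).const_mul _)
  have iY : Integrable (fun x => w x * ∑ k, Y k x ^ 2) (volume.restrict Ω) := by
    have : Integrable (fun x => ∑ k, w x * Y k x ^ 2) (volume.restrict Ω) :=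
      integrable_finsetSum _ fun k _ => int_sq (hYm k)
    simpa only [Finset.mul_sum] using this
  have iG : Integrable (fun x => w x * ∑ k, G k x ^ 2) (volume.restrict Ω) := by
    have : Integrable (fun x => ∑ k, w x * G k x ^ 2) (volume.restrict Ω) :=
      integrable_finsetSum _ fun k _ => int_sq (hu.memLp_grad k)
    simpa only [Finset.mul_sum] using this
  have iu : Integrable (fun x => w x * u x ^ 2) (volume.restrict Ω) := int_sq hu.memLp
  have iu0 : Integrable (fun x => u x ^ 2) (volume.restrict Ω) := hu.memLp.integrable_sq
  have hPb : ∀ x, |P x| ≤ |μ| + τ ^ 4 + τ ^ 6 * K + τ ^ 6 * (α ^ 2 * 4) := fun x => by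
    have e1 : ‖N x‖ ^ 2 ≤ 1 := pow_le_one₀ (norm_nonneg _) (hN1 x)
    have e2 := (sum_sq_partialDeriv_well_le p x).trans
      (by linarith [well_le_one p x] : 4 * well p x ≤ 4)
    have e3 : 0 ≤ ∑ k, partialDeriv k (well p) x ^ 2 := Finset.sum_nonneg fun k _ => sq_nonneg _
    have e4 := neg_abs_le (divg N x)
    have e5 := le_abs_self (divg N x)
    have e6 := hK x
    simp only [hPdef, hsum]
    have t4 : τ ^ 4 * ‖N x‖ ^ 2 ≤ τ ^ 4 * 1 := by gcongr
    have t4' : 0 ≤ τ ^ 4 * ‖N x‖ ^ 2 := by positivity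
    have t6 : τ ^ 6 * divg N x ≤ τ ^ 6 * K := by gcongr; linarith
    have t6' : τ ^ 6 * (-K) ≤ τ ^ 6 * divg N x := by gcongr; linarith
    have t7 : τ ^ 6 * (α ^ 2 * ∑ k, partialDeriv k (well p) x ^ 2) ≤ τ ^ 6 * (α ^ 2 * 4) := by
      gcongr
    have t7' : 0 ≤ τ ^ 6 * (α ^ 2 * ∑ k, partialDeriv k (well p) x ^ 2) := by positivity
    rw [abs_le]
    constructor <;> linarith [neg_abs_le μ, le_abs_self μ]
  have hPc : Continuous P := by
    have : Continuous fun x => ∑ k, partialDeriv k Φ x ^ 2 :=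
      continuous_finsetSum _ fun k _ => (hΦc k).pow 2
    exact ((continuous_const.sub (continuous_const.mul (hN.continuous.norm.pow 2))).sub
      (continuous_const.mul hdiv)).sub (continuous_const.mul this)
  have iP : Integrable (fun x => w x * (P x * u x ^ 2)) (volume.restrict Ω) := by
    have := (MemLp.bdd_mul_of_continuous hwc hwb hu.memLp).integrable_mul
      (MemLp.bdd_mul_of_continuous hPc hPb hu.memLp)
    refine this.congr (Eventually.of_forall fun x => ?_)
    simp only [Pi.mul_apply]; ring
  -- the estimate for `u`
  have hid' : ∫ x in Ω, (w x * ∑ k, Y k x ^ 2 + w x * (P x * u x ^ 2)) = 0 := by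
    rw [← hid]
    refine integral_congr_ae (Eventually.of_forall fun x => ?_)
    simp only [hwΦ, hY, hPdef]
  rw [integral_add iY iP] at hid'
  have hPu : τ ^ 7 * (∫ x in Ω, w x * u x ^ 2) - τ ^ 7 * (B * ∫ x in Ω, u x ^ 2) ≤
      ∫ x in Ω, w x * (P x * u x ^ 2) := by
    rw [← mul_sub, ← integral_const_mul B, ← integral_sub iu (iu0.const_mul B),
      ← integral_const_mul]
    refine integral_mono ((iu.sub (iu0.const_mul B)).const_mul _) iP fun x => ?_
    have e1 := exp_absorb hα hc hC (F := well p x / τ)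
      (div_nonneg (well_nonneg p x) hτ.le)
    have e2 : τ ^ 7 * (c * (well p x / τ) - C) ≤ P x := by
      simp only [hPdef, hsum]
      refine le_trans (le_of_eq ?_) (hP x)
      field_simp
    have e3 : τ ^ 7 * (w x - B) ≤ w x * P x := by
      calc τ ^ 7 * (w x - B) ≤ τ ^ 7 * (w x * (c * (well p x / τ) - C)) := by
            gcongr
        _ = w x * (τ ^ 7 * (c * (well p x / τ) - C)) := by ring
        _ ≤ w x * P x := mul_le_mul_of_nonneg_left e2 (hw0 x).le
    have e4 := mul_le_mul_of_nonneg_right e3 (sq_nonneg (u x))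
    calc τ ^ 7 * (w x * u x ^ 2 - B * u x ^ 2) = τ ^ 7 * (w x - B) * u x ^ 2 := by ring
      _ ≤ w x * P x * u x ^ 2 := e4
      _ = w x * (P x * u x ^ 2) := by ring
  have hYI : 0 ≤ ∫ x in Ω, w x * ∑ k, Y k x ^ 2 := integral_nonneg fun x =>
    mul_nonneg (hw0 x).le (Finset.sum_nonneg fun k _ => sq_nonneg _)
  have hτ7 : 0 < τ ^ 7 := by positivity
  set U := ∫ x in Ω, u x ^ 2 with hU
  have hU0 : 0 ≤ U := integral_nonneg fun x => sq_nonneg _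
  -- Here the nonnegative square is dropped. Keeping it and dropping the weighted mass instead gives
  -- `hYU`.
  have hWU : ∫ x in Ω, w x * u x ^ 2 ≤ B * U := by
    by_contra! hcon
    nlinarith
  have hYU : ∫ x in Ω, w x * ∑ k, Y k x ^ 2 ≤ τ ^ 7 * (B * U) := by
    have : 0 ≤ τ ^ 7 * ∫ x in Ω, w x * u x ^ 2 := mul_nonneg hτ7.le
      (integral_nonneg fun x => mul_nonneg (hw0 x).le (sq_nonneg _))
    linarith
  -- the estimate for the gradient
  have hpt : ∀ x, w x * (u x ^ 2 + τ ^ 4 * ∑ k, G k x ^ 2) ≤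
      (4 + 12 * α ^ 2) * (w x * u x ^ 2) + 3 / τ ^ 4 * (w x * ∑ k, Y k x ^ 2) := fun x => by
    have e0 : τ ^ 8 * ∑ k, G k x ^ 2 ≤ 3 * ∑ k, Y k x ^ 2 + 3 * τ ^ 4 * (‖N x‖ ^ 2 * u x ^ 2) +
        3 * (τ ^ 8 * ∑ k, partialDeriv k Φ x ^ 2) * u x ^ 2 := by
      have e1 : ∀ y n f : ℝ, (y + n - f) ^ 2 ≤ 3 * y ^ 2 + 3 * n ^ 2 + 3 * f ^ 2 := fun y n f => by
        nlinarith [sq_nonneg (y - n), sq_nonneg (y + f), sq_nonneg (n + f)]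
      have e2 : ∀ k, (τ ^ 4 * G k x) ^ 2 ≤ 3 * Y k x ^ 2 + 3 * (τ ^ 2 * (N x k * u x)) ^ 2 +
          3 * (τ ^ 4 * (partialDeriv k Φ x * u x)) ^ 2 := fun k => by
        have := e1 (Y k x) (τ ^ 2 * (N x k * u x)) (τ ^ 4 * (partialDeriv k Φ x * u x))
        refine le_trans (le_of_eq ?_) this
        simp only [hY]; ring
      have e3 := add_le_add (e2 0) (e2 1)
      simp only [norm_sq_eq_sum, Fin.sum_univ_two]
      nlinarith [e3]
    rw [hsum] at e0
    have e1 : ‖N x‖ ^ 2 ≤ 1 := pow_le_one₀ (norm_nonneg _) (hN1 x)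
    have e2 := (sum_sq_partialDeriv_well_le p x).trans
      (by linarith [well_le_one p x] : 4 * well p x ≤ 4)
    have hu2 := sq_nonneg (u x)
    have e3 : 3 * τ ^ 4 * (‖N x‖ ^ 2 * u x ^ 2) ≤ 3 * τ ^ 4 * (1 * u x ^ 2) := by gcongr
    have e4 : 3 * (τ ^ 6 * (α ^ 2 * ∑ k, partialDeriv k (well p) x ^ 2)) * u x ^ 2 ≤
        3 * (τ ^ 4 * (α ^ 2 * 4)) * u x ^ 2 := by
      have h6 : τ ^ 6 ≤ τ ^ 4 := pow_le_pow_of_le_one hτ.le hτ1 (by norm_num)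
      gcongr
    have e5 : τ ^ 4 * (τ ^ 4 * ∑ k, G k x ^ 2) ≤
        τ ^ 4 * ((3 + 12 * α ^ 2) * u x ^ 2 + 3 / τ ^ 4 * ∑ k, Y k x ^ 2) := by
      have : τ ^ 4 * ((3 + 12 * α ^ 2) * u x ^ 2 + 3 / τ ^ 4 * ∑ k, Y k x ^ 2) =
        3 * ∑ k, Y k x ^ 2 + 3 * τ ^ 4 * (1 * u x ^ 2) + 3 * (τ ^ 4 * (α ^ 2 * 4)) * u x ^ 2 := by
          field_simp; ring
      rw [this]
      linarith
    have e6 := le_of_mul_le_mul_left e5 (by positivity)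
    calc w x * (u x ^ 2 + τ ^ 4 * ∑ k, G k x ^ 2) ≤
        w x * (u x ^ 2 + ((3 + 12 * α ^ 2) * u x ^ 2 + 3 / τ ^ 4 * ∑ k, Y k x ^ 2)) :=
          mul_le_mul_of_nonneg_left (by linarith) (hw0 x).le
      _ = _ := by ring
  have iAll : Integrable (fun x => w x * (u x ^ 2 + τ ^ 4 * ∑ k, G k x ^ 2))
      (volume.restrict Ω) := by
    refine (iu.add (iG.const_mul (τ ^ 4))).congr (Eventually.of_forall fun x => ?_)
    simp only [Pi.add_apply]; ring
  refine ⟨iAll, ?_⟩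
  calc ∫ x in Ω, w x * (u x ^ 2 + τ ^ 4 * ∑ k, G k x ^ 2)
      ≤ ∫ x in Ω, ((4 + 12 * α ^ 2) * (w x * u x ^ 2) + 3 / τ ^ 4 * (w x * ∑ k, Y k x ^ 2)) :=
        integral_mono iAll ((iu.const_mul _).add (iY.const_mul _)) hpt
    _ = (4 + 12 * α ^ 2) * (∫ x in Ω, w x * u x ^ 2) +
        3 / τ ^ 4 * ∫ x in Ω, w x * ∑ k, Y k x ^ 2 := by
        rw [integral_add (iu.const_mul _) (iY.const_mul _), integral_const_mul, integral_const_mul]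
    _ ≤ (4 + 12 * α ^ 2) * (B * U) + 3 / τ ^ 4 * (τ ^ 7 * (B * U)) := by gcongr
    _ = (4 + 12 * α ^ 2) * (B * U) + 3 * τ ^ 3 * (B * U) := by field_simp
    _ ≤ (4 + 12 * α ^ 2) * (B * U) + 3 * 1 * (B * U) := by
        gcongr
        exact pow_le_one₀ hτ.le hτ1
    _ = (7 + 12 * α ^ 2) * B * U := by ring

end Energy

/-! ### The tangential decay estimate -/

section Final

variable {Ω : Set Plane} {m : ℕ} {L : Fin m → ℝ} {γ : Fin m → ℝ → Plane} {i₀ : Fin m}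
  {N : Plane → Plane}

theorem eq_zero_of_norm_le (hNb : ∀ x, ‖N x‖ ≤ 1 - min (boundaryDist Ω x ^ 2) 1) {x : Plane}
    (hx : 1 ≤ boundaryDist Ω x) : N x = 0 := by
  have h1 := hNb x
  rw [min_eq_right (one_le_pow₀ hx), sub_self] at h1
  exact norm_le_zero_iff.1 h1

/-- At distance at least `1` from the boundary the norm bound forces `N = 0`. This yields global
bounds on the derivatives of `N` even when `Ω` is unbounded. -/
theorem hasCompactSupport_normal_extension (hc : IsCompact (frontier Ω))
    (hne : (frontier Ω).Nonempty) (hNb : ∀ x, ‖N x‖ ≤ 1 - min (boundaryDist Ω x ^ 2) 1) :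
    HasCompactSupport N := by
  refine HasCompactSupport.of_support_subset_isCompact (hc.cthickening (r := 1)) fun x hx => ?_
  by_contra! hcon
  refine hx (eq_zero_of_norm_le hNb ?_)
  by_contra! hlt
  exact hcon (Metric.thickening_subset_cthickening _ _
    ((Metric.mem_thickening_iff_infDist_lt hne).2 hlt))

theorem contDiff_divg (hN : ContDiff ℝ ∞ N) : ContDiff ℝ ∞ (divg N) :=
  ContDiff.sum fun k _ => contDiff_partialDeriv (contDiff_coord hN k) k

theorem hasCompactSupport_divg (hN : HasCompactSupport N) : HasCompactSupport (divg N) := by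
  have h : ∀ k, HasCompactSupport (partialDeriv k fun y => N y k) := fun k =>
    hasCompactSupport_partialDeriv (hN.comp_left (g := fun v : Plane => v k) rfl) k
  have : divg N = (partialDeriv 0 fun y => N y 0) + partialDeriv 1 fun y => N y 1 := by
    funext x; simp [divg, Fin.sum_univ_two]
  rw [this]
  exact (h 0).add (h 1)

/-- The effective potential of the weighted problem is bounded below by a well at the point of
maximal curvature. -/
theorem exists_potential_bound (hγ : IsArcLengthBoundary Ω L γ)
    (hmax : HasUniqueNondegenerateMaxCurvature γ i₀) (hN : ContDiff ℝ ∞ N)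
    (hNν : ∀ i s, N (γ i s) = outwardNormal (γ i) s)
    (hNb : ∀ x, ‖N x‖ ≤ 1 - min (boundaryDist Ω x ^ 2) 1) {M : ℝ} (hM : 0 < M) :
    ∃ α > 0, ∃ c > 0, ∃ C ≥ 0, ∃ τ₀ > 0, ∀ τ ∈ Ioo (0 : ℝ) τ₀, ∀ μ : ℝ,
      μ ≤ -τ ^ 4 - curvature (γ i₀) 0 * τ ^ 6 + M * τ ^ 7 → ∀ x,
      τ ^ 6 * (c * well (γ i₀ 0) x) - C * τ ^ 7 ≤
        -μ - τ ^ 4 * ‖N x‖ ^ 2 - τ ^ 6 * divg N x -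
        τ ^ 6 * (α ^ 2 * ∑ k, partialDeriv k (well (γ i₀ 0)) x ^ 2) := by
  obtain ⟨c₀, hc₀, hdef⟩ := exists_norm_sq_le_deficit hγ hmax
  set p := γ i₀ 0 with hp
  set κ := curvature (γ i₀) 0 with hκ
  have hN1 : ∀ x, ‖N x‖ ≤ 1 := fun x => (hNb x).trans (by
    linarith [le_min (sq_nonneg (boundaryDist Ω x)) zero_le_one])
  have hNc := hasCompactSupport_normal_extension hγ.isCompact_frontier
    ⟨_, hγ.mem_frontier i₀ 0⟩ hNb
  have hdc := hasCompactSupport_divg hNc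
  obtain ⟨K, hK⟩ := (contDiff_divg hN).continuous.bounded_above_of_compact_support hdc
  have hK0 : 0 ≤ K := (norm_nonneg _).trans (hK 0)
  obtain ⟨K', hK'⟩ := (contDiff_divg hN).lipschitzWith_of_hasCompactSupport hdc (by simp)
  set l : ℝ := (K' : ℝ) with hl
  have hl0 : 0 ≤ l := K'.coe_nonneg
  set Q : ℝ := |κ| + K + c₀ + 1 with hQ
  have hQ1 : 1 ≤ Q := by rw [hQ]; linarith [abs_nonneg κ]
  have hQ0 : 0 < Q := by linarith
  -- Passing from the chord at the nearest boundary point to `well` leaves the coefficient `c₀ / 2`.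
  -- The weight costs `4 α² = c₀ / 4` of it and the rest is `c`. In `C`, `M` comes from the bound on
  -- `μ` and `l² / 2` from completing the square in the Lipschitz error of `divg N`. Small `τ`
  -- ensures `τ² Q ≤ 1/2`.
  refine ⟨Real.sqrt c₀ / 4, by positivity, c₀ / 4, by positivity, M + l ^ 2 / 2, by positivity,
    1 / (2 * Q), by positivity, fun τ hτ μ hμ x => ?_⟩
  have hτ0 := hτ.1
  have hτQ : τ * (2 * Q) < 1 := (lt_div_iff₀ (by positivity)).1 hτ.2
  have hτ1 : τ < 1 := by nlinarith
  have hτ2Q : τ ^ 2 * (2 * Q) ≤ 1 := by nlinarith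
  set S := ∑ k, partialDeriv k (well p) x ^ 2 with hS
  have hS4 : S ≤ 4 * well p x := sum_sq_partialDeriv_well_le p x
  have hα : (Real.sqrt c₀ / 4) ^ 2 * S ≤ c₀ / 4 * well p x := by
    rw [div_pow, Real.sq_sqrt hc₀.le]
    nlinarith
  have hf0 := well_nonneg p x
  have hf1 := well_le_one p x
  have hτ6 : 0 < τ ^ 6 := by positivity
  have hα' := mul_le_mul_of_nonneg_left hα hτ6.le
  have h78 : τ ^ 8 ≤ τ ^ 7 := pow_le_pow_of_le_one hτ0.le hτ1.le (by norm_num)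
  have hl78 : l ^ 2 * τ ^ 8 ≤ l ^ 2 * τ ^ 7 := by gcongr
  have hl7 : 0 ≤ l ^ 2 * τ ^ 7 := by positivity
  -- Near the boundary the gain `τ⁴ t²` is spent in halves: one on replacing the chord at the
  -- nearest point by `well p x` (`f4`), the other on the Lipschitz error `τ⁶ l t` (`f5`).
  by_cases ht : boundaryDist Ω x < 1
  · obtain ⟨⟨i, s⟩, -, hq⟩ := exists_nearest hγ i₀ x
    change dist x (γ i s) = _ at hq
    set t := boundaryDist Ω x with htdef
    have ht0 : 0 ≤ t := boundaryDist_nonneg Ω x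
    have e1 : ‖N x‖ ^ 2 ≤ 1 - t ^ 2 := by
      have h1 := hNb x
      rw [min_eq_left (by nlinarith : boundaryDist Ω x ^ 2 ≤ 1)] at h1
      have h2 : ‖N x‖ ^ 2 ≤ ‖N x‖ := by nlinarith [norm_nonneg (N x), hN1 x]
      linarith
    have e2 : divg N x ≤ κ - c₀ * ‖γ i s - p‖ ^ 2 + l * t := by
      have h1 := hK'.dist_le_mul x (γ i s)
      rw [hq, Real.dist_eq] at h1
      have h2 := hγ.divg_eq_curvature hN hN1 hNν i s
      have h3 := hdef i s
      have h4 := le_abs_self (divg N x - divg N (γ i s))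
      linarith
    have e3 : well p x ≤ 2 * ‖γ i s - p‖ ^ 2 + 2 * t ^ 2 := by
      refine (well_le p x).trans ?_
      have h1 : ‖x - p‖ ≤ t + ‖γ i s - p‖ := by
        have := norm_add_le (x - γ i s) (γ i s - p)
        rw [sub_add_sub_cancel] at this
        rwa [← dist_eq_norm x (γ i s), hq] at this
      have h2 := pow_le_pow_left₀ (norm_nonneg _) h1 2
      nlinarith [sq_nonneg (t - ‖γ i s - p‖)]
    have hτ4 : 0 < τ ^ 4 := by positivity
    have f1 := mul_le_mul_of_nonneg_left e1 hτ4.le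
    have f2 := mul_le_mul_of_nonneg_left e2 hτ6.le
    have f3 := mul_le_mul_of_nonneg_left e3 (by positivity : 0 ≤ τ ^ 6 * (c₀ / 2))
    have f4 : τ ^ 6 * c₀ * t ^ 2 ≤ 1 / 2 * (τ ^ 4 * t ^ 2) := by
      have h1 : τ ^ 2 * c₀ ≤ 1 / 2 := by
        have : c₀ ≤ Q := by rw [hQ]; linarith [abs_nonneg κ]
        have := mul_le_mul_of_nonneg_left this (sq_nonneg τ)
        linarith
      have h2 := mul_le_mul_of_nonneg_right h1 (by positivity : 0 ≤ τ ^ 4 * t ^ 2)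
      linarith
    have f5 : τ ^ 6 * (l * t) ≤ 1 / 2 * (τ ^ 4 * t ^ 2) + 1 / 2 * (l ^ 2 * τ ^ 8) := by
      linarith [sq_nonneg (τ ^ 2 * t - l * τ ^ 4)]
    linarith
  -- Far from the boundary the whole `τ⁴` of `-μ` survives, and it dominates every term of order
  -- `τ⁶`.
  · have hN0 : N x = 0 := eq_zero_of_norm_le hNb (not_lt.1 ht)
    have e1 : divg N x ≤ K := (le_abs_self _).trans (hK x)
    have f1 := mul_le_mul_of_nonneg_left e1 hτ6.le
    have f2 : τ ^ 6 * (|κ| + K + c₀) ≤ τ ^ 4 := by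
      have h1 := mul_le_mul_of_nonneg_left hτ2Q (by positivity : 0 ≤ τ ^ 4)
      have h2 : τ ^ 6 * (|κ| + K + c₀) ≤ τ ^ 6 * (2 * Q) := by
        gcongr
        rw [hQ]; linarith [abs_nonneg κ]
      linarith
    have f3 : τ ^ 6 * (-|κ|) ≤ τ ^ 6 * κ := by gcongr; exact neg_abs_le κ
    have f4 : τ ^ 6 * (c₀ / 4 * well p x) ≤ τ ^ 6 * (c₀ / 4 * 1) := by gcongr
    have f5 : 0 ≤ τ ^ 6 * c₀ := by positivity
    rw [hN0, norm_zero]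
    linarith

/-- Near the boundary the square of the boundary coordinate is controlled by the well. -/
theorem exists_arcCoord_bound (hγ : IsArcLengthBoundary Ω L γ) (i₀ : Fin m) (R : ℝ) :
    ∃ C > 0, ∀ x, boundaryDist Ω x ≤ R →
      arcCoord Ω L γ x ^ 2 ≤ C * (well (γ i₀ 0) x + boundaryDist Ω x ^ 2) := by
  obtain ⟨c, hc, hsq⟩ := exists_sq_le_norm_sq hγ i₀
  set p := γ i₀ 0
  obtain ⟨D, hD⟩ := hγ.isCompact_frontier.isBounded.subset_closedBall p
  refine ⟨2 / c * (1 + (R + D) ^ 2), by positivity, fun x hx => ?_⟩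
  obtain ⟨i, hs, hd⟩ := arcCoord_spec hγ i₀ x
  set s := arcCoord Ω L γ x
  set t := boundaryDist Ω x
  have ht0 : 0 ≤ t := boundaryDist_nonneg Ω x
  have h1 := hsq i s (Ioc_subset_Icc_self hs)
  have h2 : ‖γ i s - p‖ ≤ t + ‖x - p‖ := by
    have := norm_add_le (γ i s - x) (x - p)
    rw [sub_add_sub_cancel, ← dist_eq_norm (γ i s) x, dist_comm, hd] at this
    exact this
  have h3 : ‖γ i s - p‖ ≤ D := by
    rw [← dist_eq_norm]; exact hD (hγ.mem_frontier i s)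
  have h4 : ‖x - p‖ ≤ R + D := by
    have := norm_add_le (x - γ i s) (γ i s - p)
    rw [sub_add_sub_cancel, ← dist_eq_norm x (γ i s), hd] at this
    linarith
  have h5 : ‖γ i s - p‖ ^ 2 ≤ 2 * (t ^ 2 + ‖x - p‖ ^ 2) := by
    have := pow_le_pow_left₀ (norm_nonneg _) h2 2
    nlinarith [sq_nonneg (t - ‖x - p‖)]
  -- The saturation of `well` is undone: the loss is the factor `1 + ‖x - p‖²`, bounded because `x`
  -- stays within `R` of a bounded set.
  have h6 : ‖x - p‖ ^ 2 = (1 + ‖x - p‖ ^ 2) * well p x := by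
    unfold well; field_simp
  have h7 : ‖x - p‖ ^ 2 ≤ (1 + (R + D) ^ 2) * well p x := by
    rw [h6]
    have := well_nonneg p x
    gcongr
  have h8 : t ^ 2 ≤ (1 + (R + D) ^ 2) * t ^ 2 :=
    le_mul_of_one_le_left (sq_nonneg _) (by linarith [sq_nonneg (R + D)])
  have h9 : s ^ 2 ≤ (2 * (t ^ 2 + ‖x - p‖ ^ 2)) / c := by
    rw [le_div_iff₀ hc]; linarith
  calc s ^ 2 ≤ 2 * (t ^ 2 + ‖x - p‖ ^ 2) / c := h9
    _ ≤ 2 * ((1 + (R + D) ^ 2) * t ^ 2 + (1 + (R + D) ^ 2) * well p x) / c := by gcongr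
    _ = _ := by ring

theorem IsHalfLineCutoff.exists_bound {χ : ℝ → ℝ} (hχ : IsHalfLineCutoff χ) :
    ∃ B > 0, ∀ t, 0 ≤ t → χ t ^ 2 ≤ B := by
  obtain ⟨hs, R, hR⟩ := hχ
  obtain ⟨B, hB⟩ := (isCompact_Icc (a := (0 : ℝ)) (b := R)).exists_bound_of_continuousOn
    (hs.continuousOn.mono fun t ht => ht.1)
  refine ⟨B ^ 2 + 1, by positivity, fun t ht => ?_⟩
  rcases le_or_gt t R with h | h
  · have := pow_le_pow_left₀ (norm_nonneg _) (hB t ⟨ht, h⟩) 2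
    rw [Real.norm_eq_abs, sq_abs] at this
    linarith
  · rw [hR t h]; nlinarith [sq_nonneg B]

theorem IsHalfLineCutoff.measurable_comp {χ : ℝ → ℝ} (hχ : IsHalfLineCutoff χ) {f : Plane → ℝ}
    (hf : Continuous f) (hf0 : ∀ x, 0 ≤ f x) : Measurable fun x => χ (f x) :=
  (hχ.1.continuousOn.comp_continuous hf hf0).measurable

end Final

end Robin

end

/-! ### Assembly of the decay estimate. -/

theorem theorem5p5 (Ω : Set Robin.Plane) (hΩ_open : IsOpen Ω) (hΩ_conn : IsConnected Ω)
    (m : ℕ) (L : Fin m → ℝ) (γ : Fin m → ℝ → Robin.Plane)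
    (hγ : Robin.IsArcLengthBoundary Ω L γ)
    (i₀ : Fin m) (hmax : Robin.HasUniqueNondegenerateMaxCurvature γ i₀)
    (M : ℝ) (hM : 0 < M) (χ : ℝ → ℝ) (hχ : Robin.IsHalfLineCutoff χ) :
    ∃ C > (0 : ℝ), ∃ α > (0 : ℝ), ∃ h₀ ∈ Set.Ioo (0 : ℝ) 1, ∀ h ∈ Set.Ioo (0 : ℝ) h₀,
      ∀ (μ : ℝ) (u : Robin.Plane → ℂ) (G : Fin 2 → Robin.Plane → ℂ),
        Robin.IsNormalizedEigenfunction Ω L γ h μ u G →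
        μ ≤ -h - Robin.curvature (γ i₀) 0 * h ^ (3 / 2 : ℝ) + M * h ^ (7 / 4 : ℝ) →
        MeasureTheory.IntegrableOn (fun x => χ (Robin.boundaryDist Ω x / h ^ (1 / 8 : ℝ)) ^ 2 *
            (‖u x‖ ^ 2 + h * ∑ k, ‖G k x‖ ^ 2) *
            Real.exp (2 * α * |Robin.arcCoord Ω L γ x| ^ 2 / h ^ (1 / 4 : ℝ))) Ω ∧
        ∫ x in Ω, χ (Robin.boundaryDist Ω x / h ^ (1 / 8 : ℝ)) ^ 2 *
            (‖u x‖ ^ 2 + h * ∑ k, ‖G k x‖ ^ 2) *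
            Real.exp (2 * α * |Robin.arcCoord Ω L γ x| ^ 2 / h ^ (1 / 4 : ℝ)) ≤ C := by
  obtain ⟨N, hN, hNν, hNb⟩ := hγ.exists_normal_extension hΩ_open
  have hN1 : ∀ x, ‖N x‖ ≤ 1 := fun x => (hNb x).trans (by
    linarith [le_min (sq_nonneg (Robin.boundaryDist Ω x)) zero_le_one])
  have hne : (frontier Ω).Nonempty := ⟨_, hγ.mem_frontier i₀ 0⟩
  have hNc := Robin.hasCompactSupport_normal_extension hγ.isCompact_frontier hne hNb
  obtain ⟨D, hD⟩ := (hN.continuous_fderiv (by simp)).bounded_above_of_compact_support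
    (hNc.fderiv ℝ)
  obtain ⟨K, hK⟩ := (Robin.contDiff_divg hN).continuous.bounded_above_of_compact_support
    (Robin.hasCompactSupport_divg hNc)
  obtain ⟨δ, hδ, ε₀, hε₀, hshift⟩ := hγ.exists_shift hΩ_open hne hN.continuous hN1 hNν
  obtain ⟨α, hα, c, hc, A, hA, τ₀, hτ₀, hpot⟩ :=
    Robin.exists_potential_bound hγ hmax hN hNν hNb hM
  obtain ⟨Bχ, hBχ, hχb⟩ := hχ.exists_bound
  obtain ⟨R, hR⟩ := hχ.2
  obtain ⟨Cs, hCs, harc⟩ := Robin.exists_arcCoord_bound hγ i₀ (max R 0)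
  set p := γ i₀ 0 with hp
  set E := (7 + 12 * α ^ 2) * ((A + 1) * Real.exp (2 * (α * ((A + 1) / c)))) with hE
  have hE0 : 0 < E := by positivity
  -- After dividing `α` by `Cs`, the exponent is at most `2 α (well + dist²) / τ`. On the support of
  -- the cutoff `dist² ≤ R² τ`, so the distance contributes only the constant factor `W`.
  set W := Real.exp (2 * (α * R ^ 2)) with hW
  refine ⟨Bχ * W * E, by positivity, α / Cs, by positivity, min (1 / 2) (τ₀ ^ 4),
    ⟨lt_min (by norm_num) (by positivity), (min_le_left _ _).trans_lt (by norm_num)⟩, ?_⟩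
  intro h hh μ u G hu hμ
  have hh0 : 0 < h := hh.1
  -- In terms of `τ` all powers in the hypothesis on `μ` are integral, and the cutoff scale
  -- satisfies `(h^(1/8))² = τ`, matching the scale of the exponential weight.
  set τ := h ^ (1 / 4 : ℝ) with hτdef
  have hτ0 : 0 < τ := Real.rpow_pos_of_pos hh0 _
  have hpow : ∀ n : ℕ, τ ^ n = h ^ ((n : ℝ) / 4) := fun n => by
    rw [hτdef, ← Real.rpow_natCast, ← Real.rpow_mul hh0.le]
    congr 1; ring
  have h4 : h = τ ^ 4 := by rw [hpow]; norm_num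
  have h6 : h ^ (3 / 2 : ℝ) = τ ^ 6 := by rw [hpow]; norm_num
  have h7 : h ^ (7 / 4 : ℝ) = τ ^ 7 := by rw [hpow]; norm_num
  have h8 : (h ^ (1 / 8 : ℝ)) ^ 2 = τ := by
    rw [hτdef, ← Real.rpow_natCast, ← Real.rpow_mul hh0.le]; norm_num
  have h80 : 0 < h ^ (1 / 8 : ℝ) := Real.rpow_pos_of_pos hh0 _
  have hτ1 : τ ≤ 1 := Real.rpow_le_one hh0.le (by
    linarith [hh.2, min_le_left (1 / 2 : ℝ) (τ₀ ^ 4)]) (by norm_num)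
  have h81 : h ^ (1 / 8 : ℝ) ≤ 1 := Real.rpow_le_one hh0.le (by
    linarith [hh.2, min_le_left (1 / 2 : ℝ) (τ₀ ^ 4)]) (by norm_num)
  have hττ₀ : τ < τ₀ := by
    refine lt_of_pow_lt_pow_left₀ 4 hτ₀.le ?_
    rw [← h4]; exact hh.2.trans_le (min_le_right _ _)
  have hμ' : μ ≤ -τ ^ 4 - Robin.curvature (γ i₀) 0 * τ ^ 6 + M * τ ^ 7 := by
    rw [← h6, ← h7, ← h4]; exact hμ
  have hP := hpot τ ⟨hτ0, hττ₀⟩ μ hμ'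
  set w : Robin.Plane → ℝ := fun x => Real.exp (2 * (α * (Robin.well p x / τ))) with hw
  -- This is used for the real and imaginary parts, whose masses add up to `1`.
  have hest : ∀ ℓ : ℂ →L[ℝ] ℝ, MeasureTheory.Integrable (fun x => w x *
        (ℓ (u x) ^ 2 + τ ^ 4 * ∑ k, ℓ (G k x) ^ 2)) (MeasureTheory.volume.restrict Ω) ∧
      ∫ x in Ω, w x * (ℓ (u x) ^ 2 + τ ^ 4 * ∑ k, ℓ (G k x) ^ 2) ≤
        E * ∫ x in Ω, ℓ (u x) ^ 2 := fun ℓ => by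
    have hweak := Robin.isWeakRobin_of_eigenfunction hγ hh0 hu hN hNν ℓ
    rw [h4] at hweak
    obtain ⟨φ, hφ, hφu, hφG⟩ := hweak.toIsRealH1.exists_approx hΩ_open hN hN1 hD hδ hε₀ hshift
    exact hweak.energy_estimate hτ0 hτ1 hN hN1 hK hφ hφu hφG hα.le hc hA hP
  obtain ⟨ire, hre⟩ := hest Complex.reCLM
  obtain ⟨iim, him⟩ := hest Complex.imCLM
  simp only [Complex.reCLM_apply, Complex.imCLM_apply] at ire hre iim him
  have hnorm : ∀ z : ℂ, ‖z‖ ^ 2 = z.re ^ 2 + z.im ^ 2 := fun z => by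
    rw [Complex.sq_norm, Complex.normSq_apply]; ring
  set f : Robin.Plane → ℝ := fun x => w x * (‖u x‖ ^ 2 + h * ∑ k, ‖G k x‖ ^ 2) with hf
  have hfeq : ∀ x, f x = w x * ((u x).re ^ 2 + τ ^ 4 * ∑ k, (G k x).re ^ 2) +
      w x * ((u x).im ^ 2 + τ ^ 4 * ∑ k, (G k x).im ^ 2) := fun x => by
    simp only [hf, hnorm, Fin.sum_univ_two, ← h4]; ring
  have hfi : MeasureTheory.Integrable f (MeasureTheory.volume.restrict Ω) :=
    (ire.add iim).congr (Filter.Eventually.of_forall fun x => (hfeq x).symm)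
  have hum : MeasureTheory.MemLp u 2 (MeasureTheory.volume.restrict Ω) := by
    obtain ⟨H, hdom, -⟩ := hu
    exact hdom.isH1.memLp
  have hGm : ∀ k, MeasureTheory.MemLp (G k) 2 (MeasureTheory.volume.restrict Ω) := by
    obtain ⟨H, hdom, -⟩ := hu
    exact hdom.isH1.memLp_grad
  have hu1 : (∫ x in Ω, (u x).re ^ 2) + ∫ x in Ω, (u x).im ^ 2 = 1 := by
    obtain ⟨H, hdom, -, hone⟩ := hu
    have h1 : MeasureTheory.Integrable (fun x => (u x).re ^ 2)
      (MeasureTheory.volume.restrict Ω) := (Complex.reCLM.comp_memLp' hum).integrable_sq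
    have h2 : MeasureTheory.Integrable (fun x => (u x).im ^ 2)
      (MeasureTheory.volume.restrict Ω) := (Complex.imCLM.comp_memLp' hum).integrable_sq
    rw [← hone, ← MeasureTheory.integral_add h1 h2]
    exact MeasureTheory.integral_congr_ae (Filter.Eventually.of_forall fun x => (hnorm _).symm)
  have hfE : ∫ x in Ω, f x ≤ E := by
    have : ∫ x in Ω, f x = ∫ x in Ω, (w x * ((u x).re ^ 2 + τ ^ 4 * ∑ k, (G k x).re ^ 2) +
      w x * ((u x).im ^ 2 + τ ^ 4 * ∑ k, (G k x).im ^ 2)) := by simp only [hfeq]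
    rw [this, MeasureTheory.integral_add ire iim]
    calc _ ≤ E * (∫ x in Ω, (u x).re ^ 2) + E * ∫ x in Ω, (u x).im ^ 2 := add_le_add hre him
      _ = E * ((∫ x in Ω, (u x).re ^ 2) + ∫ x in Ω, (u x).im ^ 2) := by ring
      _ = E := by rw [hu1, mul_one]
  set g : Robin.Plane → ℝ := fun x => χ (Robin.boundaryDist Ω x / h ^ (1 / 8 : ℝ)) ^ 2 *
    (‖u x‖ ^ 2 + h * ∑ k, ‖G k x‖ ^ 2) *
    Real.exp (2 * (α / Cs) * |Robin.arcCoord Ω L γ x| ^ 2 / τ) with hg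
  have hgf : ∀ x, g x ≤ Bχ * W * f x := fun x => by
    have hpos : 0 ≤ ‖u x‖ ^ 2 + h * ∑ k, ‖G k x‖ ^ 2 :=
      add_nonneg (sq_nonneg _) (mul_nonneg hh0.le (Finset.sum_nonneg fun k _ => sq_nonneg _))
    have ht0 := Robin.boundaryDist_nonneg Ω x
    by_cases hx : R < Robin.boundaryDist Ω x / h ^ (1 / 8 : ℝ)
    · have : g x = 0 := by simp only [hg, hR _ hx]; ring
      rw [this]
      have : 0 ≤ w x := (Real.exp_pos _).le
      positivity
    · have hxR : Robin.boundaryDist Ω x ≤ R * h ^ (1 / 8 : ℝ) := by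
        rw [← div_le_iff₀ h80]; exact not_lt.1 hx
      have hxR0 : 0 ≤ R := (div_nonneg ht0 h80.le).trans (not_lt.1 hx)
      have h1 := harc x (hxR.trans ((mul_le_of_le_one_right hxR0 h81).trans (le_max_left _ _)))
      have h2 : Robin.boundaryDist Ω x ^ 2 ≤ R ^ 2 * τ := by
        have := pow_le_pow_left₀ ht0 hxR 2
        rwa [mul_pow, h8] at this
      have h3 : Real.exp (2 * (α / Cs) * |Robin.arcCoord Ω L γ x| ^ 2 / τ) ≤ w x * W := by
        rw [hw, hW, ← Real.exp_add]
        refine Real.exp_le_exp.2 ?_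
        rw [sq_abs]
        calc 2 * (α / Cs) * Robin.arcCoord Ω L γ x ^ 2 / τ
            ≤ 2 * (α / Cs) * (Cs * (Robin.well p x + R ^ 2 * τ)) / τ := by
              gcongr
              exact h1.trans (by gcongr)
          _ = _ := by field_simp
      have h4 := hχb _ (div_nonneg ht0 h80.le)
      calc g x ≤ Bχ * (‖u x‖ ^ 2 + h * ∑ k, ‖G k x‖ ^ 2) * (w x * W) := by
            simp only [hg]; gcongr
        _ = Bχ * W * f x := by simp only [hf]; ring
  have hg0 : ∀ x, 0 ≤ g x := fun x => by
    have hpos : 0 ≤ ‖u x‖ ^ 2 + h * ∑ k, ‖G k x‖ ^ 2 :=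
      add_nonneg (sq_nonneg _) (mul_nonneg hh0.le (Finset.sum_nonneg fun k _ => sq_nonneg _))
    simp only [hg]; positivity
  have hgm : MeasureTheory.AEStronglyMeasurable g (MeasureTheory.volume.restrict Ω) := by
    have m1 := (hχ.measurable_comp
      ((Robin.lipschitzWith_boundaryDist Ω).continuous.div_const (h ^ (1 / 8 : ℝ)))
      (fun x => div_nonneg (Robin.boundaryDist_nonneg Ω x) h80.le)).pow_const 2
    have m2 : AEMeasurable (fun x => ‖u x‖ ^ 2 + h * ∑ k, ‖G k x‖ ^ 2)
        (MeasureTheory.volume.restrict Ω) :=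
      (hum.1.norm.aemeasurable.pow_const 2).add ((Finset.aemeasurable_fun_sum _ fun k _ =>
        (hGm k).1.norm.aemeasurable.pow_const 2).const_mul h)
    have m3 := (Robin.aemeasurable_arcCoord hγ i₀).mono_measure
      (MeasureTheory.Measure.restrict_le_self (s := Ω))
    have m4 : AEMeasurable (fun x => Real.exp (2 * (α / Cs) * |Robin.arcCoord Ω L γ x| ^ 2 / τ))
        (MeasureTheory.volume.restrict Ω) :=
      Real.measurable_exp.comp_aemeasurable ((((measurable_norm.comp_aemeasurable m3).pow_const
        2).const_mul _).div_const τ)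
    exact ((m1.aemeasurable.mul m2).mul m4).aestronglyMeasurable
  have hgi : MeasureTheory.Integrable g (MeasureTheory.volume.restrict Ω) :=
    (hfi.const_mul (Bχ * W)).mono' hgm (Filter.Eventually.of_forall fun x => by
      rw [Real.norm_of_nonneg (hg0 x)]; exact hgf x)
  refine ⟨hgi, ?_⟩
  calc ∫ x in Ω, g x ≤ ∫ x in Ω, Bχ * W * f x :=
        MeasureTheory.integral_mono hgi (hfi.const_mul _) hgf
    _ = Bχ * W * ∫ x in Ω, f x := MeasureTheory.integral_const_mul _ _
    _ ≤ Bχ * W * E := by gcongr
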